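/- Let $X$ be a real Banach space that admits a $C^1$ Lipschitz bump function, i.e. a $C^1$ Lipschitz function $b:X\to\mathbb R$ whose support $\overline{\{b\ne 0\}}$ is bounded and non-empty. Let $M$ be a connected paracompact (Hausdorff) $C^1$ Banach manifold modeled on $X$, equipped with a $C^1$ Finsler structure in the sense of Palais: a continuous map $\|\cdot\|:TM\to[0,\infty)$ whose restriction $\|\cdot\|_x$ to each $T_xM$ is a norm, such that for every $C^1$ chart $\varphi:U\to X$ and $x_0\in U$, (P1) the norm $v\mapsto\|d\varphi^{-1}(\varphi(x_0))v\|_{x_0}$ is equivalent to the norm of $X$, and (P2) for every $\varepsilon>0$ there is a neighbourhood $W$ of $x_0$ with $$(1+\varepsilon)^{-1}\|d\varphi^{-1}(\varphi(x_0))v\|_{x_0}\le\|d\varphi^{-1}(\varphi(x))v\|_{x}\le(1+\varepsilon)\|d\varphi^{-1}(\varphi(x_0))v\|_{x_0}\qquad(x\in W,\ v\in X).$$ Let $d(p,q)$ be the infimum of the lengths $\int_a^b\|c'(t)\|_{c(t)}\,dt$ of the piecewise $C^1$ paths $c$ from $p$ to $q$, and suppose that $M$ is complete for $d$. For $\Delta\in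 T_xM^*$ put $\|\Delta\|_x=\sup\{|\Delta(\xi)|:\xi\in T_xM,\ \|\xi\|_x=1\}$. For $u:M\to\mathbb R$ let $D^-u(x)$ (resp. $D^+u(x)$) be the set of all $dg(x)\in T_xM^*$ with $g:M\to\mathbb R$ of class $C^1$ such that $u-g$ has a local minimum (resp. local maximum) at $x$. Let $H:M\times\mathbb R\to\mathbb R$ be continuous and consider the equation $$u(x)+H(x,\|du(x)\|_x)=0\quad\text{on } M.\tag{E}$$ A function $u:M\to\mathbb R$ is a viscosity subsolution of (E) if it is upper semicontinuous and $u(x)+H(x,\|\Delta\|_x)\le0$ for all $x\in M$, $\Delta\in D^+u(x)$; it is a viscosity supersolution if it is lower semicontinuous and $u(x)+H(x,\|\Delta\|_x)\ge0$ for all $x\in M$, $\Delta\in D^-u(x)$; it is a viscosity solution if it is both. Assume that there are real constants $K_0,K_1$ with $K_0\le H(x,0)\le K_1$ for all $x\in M$, and that at least one of the following holds: (i) $H$ is uniformly continuous on $M\times\mathbb R$ (with respect to $d$ on $M$) and $\liminf_{t\to\infty}H(x,t)>K_1$ for each $x\in M$; (ii) there are a constant $C\ge0$ and a continuous $\omega:\mathbb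 R\times\mathbb R\to\mathbb R$ with $\omega(0,0)=0$ such that $$|H(x_1,t_1)-H(x_2,t_2)|\le\omega(d(x_1,x_2),t_1-t_2)+C\max\{|t_1|,|t_2|\}\,d(x_1,x_2)$$ for all $x_1,x_2\in M$, $t_1,t_2\in\mathbb R$ (condition (A)), and there is a constant $K_1'>K_1$ such that $\liminf_{t\to\infty}H(x,t)\ge K_1'$ locally uniformly in $x$, i.e. every point of $M$ has a neighbourhood $U$ such that for every $\varepsilon>0$ there is $R$ with $H(x,t)\ge K_1'-\varepsilon$ for all $x\in U$ and $t\ge R$. Then (E) has a unique bounded viscosity solution $u$. Moreover $u$ is the pointwise supremum of the family of all viscosity subsolutions $w$ of (E) with $-K_1\le w\le -K_0$ on $M$, and $u$ is locally Lipschitz with respect to $d$. -/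

import Mathlib

open Set Filter Topology MeasureTheory
open scoped Manifold ENNReal

/-- The Banach space `X` admits a `C¹` Lipschitz bump function: a `C¹` Lipschitz function
`b : X → ℝ` whose (closed) support is bounded and non-empty. -/
def HasC1LipschitzBump (X : Type*) [NormedAddCommGroup X] [NormedSpace ℝ X] : Prop :=
  ∃ b : X → ℝ, ContDiff ℝ 1 b ∧ (∃ L, LipschitzWith L b) ∧
    Bornology.IsBounded (tsupport b) ∧ (tsupport b).Nonempty

/-- A `C¹` Finsler structure in the sense of Palais on a `C¹` Banach manifold `M` modeled on `X`:
a continuous function on the tangent bundle which is a norm on every tangent space and satisfies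
the two conditions of Palais. For a chart `e` and `x ∈ e.source`, the map
`d e⁻¹ (e x) : X → T_x M` is `mfderiv 𝓘(ℝ, X) 𝓘(ℝ, X) e.symm (e x)`, and charts run over
the maximal `C¹` atlas. -/
structure FinslerStructure (X : Type*) [NormedAddCommGroup X] [NormedSpace ℝ X]
    (M : Type*) [TopologicalSpace M] [ChartedSpace X M] [IsManifold 𝓘(ℝ, X) 1 M] where
  /-- The (semi)norm `‖·‖_x` on `T_x M`; it is a norm by `eq_zero_of_norm_eq_zero`. -/
  norm : ∀ x : M, Seminorm ℝ (TangentSpace 𝓘(ℝ, X) x)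
  eq_zero_of_norm_eq_zero : ∀ (x : M) (v : TangentSpace 𝓘(ℝ, X) x), norm x v = 0 → v = 0
  continuous_norm : Continuous fun v : TangentBundle 𝓘(ℝ, X) M => norm v.proj v.snd
  /-- (P1): in every chart around `x`, the norm `‖·‖_x` is equivalent to the norm of `X`. -/
  norm_equivalent : ∀ e ∈ IsManifold.maximalAtlas 𝓘(ℝ, X) 1 M, ∀ x ∈ e.source,
    ∃ K : ℝ, 1 ≤ K ∧ ∀ v : X,
      K⁻¹ * ‖v‖ ≤ norm (e.symm (e x)) (mfderiv 𝓘(ℝ, X) 𝓘(ℝ, X) e.symm (e x) v) ∧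
      norm (e.symm (e x)) (mfderiv 𝓘(ℝ, X) 𝓘(ℝ, X) e.symm (e x) v) ≤ K * ‖v‖
  /-- (P2): in every chart around `x₀`, the norms `‖·‖_x` with `x` close to `x₀` are
  `(1 + ε)`-equivalent to `‖·‖_{x₀}`. -/
  palais : ∀ e ∈ IsManifold.maximalAtlas 𝓘(ℝ, X) 1 M, ∀ x₀ ∈ e.source, ∀ ε : ℝ, 0 < ε →
    ∀ᶠ x in 𝓝 x₀, ∀ v : X,
      (1 + ε)⁻¹ * norm (e.symm (e x₀)) (mfderiv 𝓘(ℝ, X) 𝓘(ℝ, X) e.symm (e x₀) v) ≤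
        norm (e.symm (e x)) (mfderiv 𝓘(ℝ, X) 𝓘(ℝ, X) e.symm (e x) v) ∧
      norm (e.symm (e x)) (mfderiv 𝓘(ℝ, X) 𝓘(ℝ, X) e.symm (e x) v) ≤
        (1 + ε) * norm (e.symm (e x₀)) (mfderiv 𝓘(ℝ, X) 𝓘(ℝ, X) e.symm (e x₀) v)

/-- `γ` is a (continuous) piecewise `C¹` path on `[a, b]`: there are finitely many points such
that `γ` is `C¹` on each closed subinterval of `[a, b]` without such a point in its interior. -/
def IsPiecewiseC1Path (X : Type*) [NormedAddCommGroup X] [NormedSpace ℝ X]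
    {M : Type*} [TopologicalSpace M] [ChartedSpace X M] (γ : ℝ → M) (a b : ℝ) : Prop :=
  ContinuousOn γ (Icc a b) ∧
    ∃ s : Finset ℝ, ∀ c d : ℝ, a ≤ c → c < d → d ≤ b → Disjoint (Ioo c d) (s : Set ℝ) →
      ContMDiffOn 𝓘(ℝ, ℝ) 𝓘(ℝ, X) 1 γ (Icc c d)

section Finsler

variable {X : Type*} [NormedAddCommGroup X] [NormedSpace ℝ X]
  {M : Type*} [TopologicalSpace M] [ChartedSpace X M] [IsManifold 𝓘(ℝ, X) 1 M]

namespace FinslerStructure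

/-- The length `∫_a^b ‖γ'(t)‖_{γ(t)} dt` of a path. -/
noncomputable def pathLength (F : FinslerStructure X M) (γ : ℝ → M) (a b : ℝ) : ℝ≥0∞ :=
  ∫⁻ t in Icc a b, ENNReal.ofReal (F.norm (γ t) (mfderiv 𝓘(ℝ, ℝ) 𝓘(ℝ, X) γ t (1 : ℝ)))

/-- The Finsler distance: the infimum of the lengths of the piecewise `C¹` paths from `p` to `q`
(such paths exist, and have finite length, on a connected manifold). -/
noncomputable def dist (F : FinslerStructure X M) (p q : M) : ℝ :=
  (sInf {ℓ : ℝ≥0∞ | ∃ (γ : ℝ → M) (a b : ℝ), a ≤ b ∧ IsPiecewiseC1Path X γ a b ∧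
    γ a = p ∧ γ b = q ∧ ℓ = F.pathLength γ a b}).toReal

/-- `M` is complete for the Finsler distance: every Cauchy sequence converges. -/
def IsComplete (F : FinslerStructure X M) : Prop :=
  ∀ s : ℕ → M, (∀ ε > 0, ∃ N, ∀ m ≥ N, ∀ n ≥ N, F.dist (s m) (s n) < ε) →
    ∃ x, Tendsto (fun n => F.dist (s n) x) atTop (𝓝 0)

/-- The dual norm `‖Δ‖_x = sup {|Δ ξ| : ‖ξ‖_x = 1}` on `T_x M*` (zero if `T_x M = 0`). -/
noncomputable def dualNorm (F : FinslerStructure X M) (x : M)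
    (Δ : TangentSpace 𝓘(ℝ, X) x →L[ℝ] ℝ) : ℝ :=
  sSup {r : ℝ | ∃ ξ : TangentSpace 𝓘(ℝ, X) x, F.norm x ξ = 1 ∧ r = |Δ ξ|}

/-- `u` is locally Lipschitz for the Finsler distance. -/
def LocallyLipschitz (F : FinslerStructure X M) (u : M → ℝ) : Prop :=
  ∀ x : M, ∃ U ∈ 𝓝 x, ∃ L : ℝ, ∀ y ∈ U, ∀ z ∈ U, |u y - u z| ≤ L * F.dist y z

end FinslerStructure

/-- The set `D⁻u(x)` of subdifferentials: the `dg(x)` with `g : M → ℝ` of class `C¹` such that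
`u - g` attains a local minimum at `x`. -/
def subdifferential (X : Type*) [NormedAddCommGroup X] [NormedSpace ℝ X]
    {M : Type*} [TopologicalSpace M] [ChartedSpace X M] (u : M → ℝ) (x : M) :
    Set (TangentSpace 𝓘(ℝ, X) x →L[ℝ] ℝ) :=
  {Δ | ∃ g : M → ℝ, ContMDiff 𝓘(ℝ, X) 𝓘(ℝ, ℝ) 1 g ∧ IsLocalMin (fun y => u y - g y) x ∧
    Δ = mvfderiv 𝓘(ℝ, X) g x}

/-- The set `D⁺u(x)` of superdifferentials: the `dg(x)` with `g : M → ℝ` of class `C¹` such that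
`u - g` attains a local maximum at `x`. -/
def superdifferential (X : Type*) [NormedAddCommGroup X] [NormedSpace ℝ X]
    {M : Type*} [TopologicalSpace M] [ChartedSpace X M] (u : M → ℝ) (x : M) :
    Set (TangentSpace 𝓘(ℝ, X) x →L[ℝ] ℝ) :=
  {Δ | ∃ g : M → ℝ, ContMDiff 𝓘(ℝ, X) 𝓘(ℝ, ℝ) 1 g ∧ IsLocalMax (fun y => u y - g y) x ∧
    Δ = mvfderiv 𝓘(ℝ, X) g x}

/-- `u` is a viscosity subsolution of `u(x) + H(x, ‖du(x)‖_x) = 0`. -/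
def IsViscositySubsolution (F : FinslerStructure X M) (H : M × ℝ → ℝ) (u : M → ℝ) : Prop :=
  UpperSemicontinuous u ∧
    ∀ x : M, ∀ Δ ∈ superdifferential X u x, u x + H (x, F.dualNorm x Δ) ≤ 0

/-- `u` is a viscosity supersolution of `u(x) + H(x, ‖du(x)‖_x) = 0`. -/
def IsViscositySupersolution (F : FinslerStructure X M) (H : M × ℝ → ℝ) (u : M → ℝ) : Prop :=
  LowerSemicontinuous u ∧
    ∀ x : M, ∀ Δ ∈ subdifferential X u x, 0 ≤ u x + H (x, F.dualNorm x Δ)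

/-- `u` is a viscosity solution of `u(x) + H(x, ‖du(x)‖_x) = 0`. -/
def IsViscositySolution (F : FinslerStructure X M) (H : M × ℝ → ℝ) (u : M → ℝ) : Prop :=
  IsViscositySubsolution F H u ∧ IsViscositySupersolution F H u

/-- `H` is uniformly continuous on `M × ℝ`, where `M` carries the Finsler distance. -/
def IsUniformlyContinuousHamiltonian (F : FinslerStructure X M) (H : M × ℝ → ℝ) : Prop :=
  ∀ ε : ℝ, 0 < ε → ∃ δ : ℝ, 0 < δ ∧ ∀ (x₁ x₂ : M) (t₁ t₂ : ℝ),
    F.dist x₁ x₂ < δ → |t₁ - t₂| < δ → |H (x₁, t₁) - H (x₂, t₂)| < ε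

/-- Condition (A) for the Hamiltonian `H`. -/
def ConditionA (F : FinslerStructure X M) (H : M × ℝ → ℝ) : Prop :=
  ∃ (C : ℝ) (ω : ℝ × ℝ → ℝ), 0 ≤ C ∧ Continuous ω ∧ ω (0, 0) = 0 ∧
    ∀ (x₁ x₂ : M) (t₁ t₂ : ℝ), |H (x₁, t₁) - H (x₂, t₂)| ≤
      ω (F.dist x₁ x₂, t₁ - t₂) + C * max |t₁| |t₂| * F.dist x₁ x₂

/-- `liminf_{t → ∞} H(x, t) ≥ K` locally uniformly in `x`: every point has a neighbourhood on which,
for every `ε > 0`, the inequality `H(x, t) ≥ K - ε` holds for all `t` beyond a common threshold. -/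
def LocallyUniformLiminfGE (H : M × ℝ → ℝ) (K : ℝ) : Prop :=
  ∀ x₀ : M, ∃ U ∈ 𝓝 x₀, ∀ ε : ℝ, 0 < ε → ∃ R : ℝ, ∀ x ∈ U, ∀ t : ℝ, R ≤ t → K - ε ≤ H (x, t)

end Finsler

/-! The solution is built by Perron's method and its uniqueness comes from a comparison principle.
Compactness and a smooth norm on `X` are both missing; smooth variational principles driven by the
bump function replace them.

The local tool is a fuzzy sum rule, `HasC1LipschitzBump.exists_fuzzy_sum`. If `f - g - k` has a
value at `a` that exceeds its values away from the centre of a ball by a definite gap, then there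
are nearby points `x`, `y`, `z`, a superdifferential `p` of `f` at `x` and subdifferentials `q`, `s`
of `g`, `k` at `y`, `z` with `p - q - s` small. It follows from doubling (here tripling) variables,
with a bump as penalty, and from the Deville–Godefroy–Zizler principle on `X × X × X`.

Coercivity then gives regularity. At a superdifferential of a subsolution `w ≥ -K₁` the equation
reads `H ≤ -w ≤ K₁`, so the dual norm stays below a threshold that is locally uniform. An upper
semicontinuous function with bounded superdifferentials is Lipschitz, hence all bounded subsolutions
above `-K₁` are equi-Lipschitz in charts (`exists_lipschitz_of_isViscositySubsolution`). Their
supremum is Lipschitz, is again a subsolution by the fuzzy sum rule, and is a supersolution because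
otherwise a small bump would produce a larger subsolution.

For comparison of a locally Lipschitz subsolution `u` with a supersolution `v`, Ekeland's principle
on the complete space `(M, d)` yields a point where `v - u` is almost minimal up to a small multiple
of `d`. The fuzzy sum rule in a chart there produces differentials of `u` and `v` at nearby points
with nearly equal Finsler dual norms, by (P2). The modulus of `H` contradicts `u > v`.

Uniqueness: comparison with the constant subsolution `-K₁` puts any bounded solution above `-K₁`; it
is then locally Lipschitz by coercivity, and comparison applies in both directions. -/

/-! ### Bump functions and the smooth variational principle. -/

/-- A `C¹`, `L`-Lipschitz bump function with values in `[0, 1]`, equal to `1` near the origin and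
vanishing outside of the unit ball. -/
structure NormalizedBump {E : Type*} [NormedAddCommGroup E] [NormedSpace ℝ E] (b : E → ℝ)
    (L : ℝ) : Prop where
  contDiff : ContDiff ℝ 1 b
  lipschitz : ∀ x y, |b x - b y| ≤ L * ‖x - y‖
  nonneg : ∀ x, 0 ≤ b x
  le_one : ∀ x, b x ≤ 1
  eventually_eq_one : ∀ᶠ x in 𝓝 0, b x = 1
  eq_zero : ∀ x, 1 ≤ ‖x‖ → b x = 0

namespace NormalizedBump

variable {E : Type*} [NormedAddCommGroup E] [NormedSpace ℝ E] {b : E → ℝ} {L : ℝ}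

theorem apply_zero (hb : NormalizedBump b L) : b 0 = 1 :=
  hb.eventually_eq_one.self_of_nhds

end NormalizedBump

/-- After an affine change of variable and division by `b₀ x₀`, the given bump is `1` at the origin
and `0` off the unit ball. Composition with a smooth bump on `ℝ` centred at `1`, whose support
misses `0`, makes it constant near the origin and forces values in `[0, 1]`. -/
theorem HasC1LipschitzBump.exists_normalizedBump {E : Type*} [NormedAddCommGroup E]
    [NormedSpace ℝ E] (hE : HasC1LipschitzBump E) :
    ∃ (b : E → ℝ) (L : ℝ), 0 ≤ L ∧ NormalizedBump b L := by
  obtain ⟨b₀, hb, ⟨L₀, hL⟩, hbd, hne⟩ := hE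
  obtain ⟨x₀, hx₀⟩ : ∃ x₀, b₀ x₀ ≠ 0 := by
    by_contra! h
    have : b₀ = 0 := funext h
    rw [this] at hne
    simp [tsupport] at hne
  obtain ⟨R, hR⟩ := hbd.subset_ball x₀
  have hR0 : 0 < R := by
    have := hR (subset_tsupport _ hx₀)
    simpa using this
  let s : ContDiffBump (1 : ℝ) := ⟨1 / 4, 1 / 2, by norm_num, by norm_num⟩
  obtain ⟨C, hC⟩ := s.contDiff.lipschitzWith_of_hasCompactSupport (n := 1) s.hasCompactSupport
    one_ne_zero
  have hsc : ∀ x y : E, ‖(x₀ + R • x) - (x₀ + R • y)‖ = R * ‖x - y‖ := fun x y => by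
    rw [add_sub_add_left_eq_sub, ← smul_sub, norm_smul, Real.norm_of_nonneg hR0.le]
  have hT : Continuous fun x : E => b₀ (x₀ + R • x) / b₀ x₀ := by
    have := hb.continuous
    fun_prop
  refine ⟨fun x => s (b₀ (x₀ + R • x) / b₀ x₀), C * (L₀ * R / |b₀ x₀|), by positivity, ?_, ?_,
    fun x => s.nonneg, fun x => s.le_one, ?_, ?_⟩
  · exact s.contDiff.comp ((hb.comp (by fun_prop)).div_const _)
  · intro x y
    have h1 := hC.dist_le_mul (b₀ (x₀ + R • x) / b₀ x₀) (b₀ (x₀ + R • y) / b₀ x₀)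
    have h2 := hL.dist_le_mul (x₀ + R • x) (x₀ + R • y)
    rw [dist_eq_norm (x₀ + R • x), hsc, Real.dist_eq] at h2
    rw [Real.dist_eq, Real.dist_eq, ← sub_div, abs_div] at h1
    refine h1.trans ?_
    rw [mul_assoc]
    gcongr
    calc _ ≤ L₀ * (R * ‖x - y‖) / |b₀ x₀| := by gcongr
      _ = _ := by ring
  · have h1 : Tendsto (fun x : E => b₀ (x₀ + R • x) / b₀ x₀) (𝓝 0) (𝓝 1) := by
      have := hT.tendsto 0
      simpa [hx₀] using this
    exact h1.eventually s.eventuallyEq_one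
  · intro x hx
    have h0 : b₀ (x₀ + R • x) = 0 := by
      by_contra h
      have := hR (subset_tsupport _ h)
      rw [mem_ball_iff_norm] at this
      simp only [add_sub_cancel_left, norm_smul, Real.norm_of_nonneg hR0.le] at this
      nlinarith
    simp only [h0, zero_div]
    apply s.zero_of_le_dist
    simp [s]
    norm_num

theorem NormalizedBump.prod {E E' : Type*} [NormedAddCommGroup E] [NormedSpace ℝ E]
    [NormedAddCommGroup E'] [NormedSpace ℝ E'] {b : E → ℝ} {b' : E' → ℝ} {L L' : ℝ}
    (hL : 0 ≤ L) (hL' : 0 ≤ L')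
    (hb : NormalizedBump b L) (hb' : NormalizedBump b' L') :
    NormalizedBump (fun z : E × E' => b z.1 * b' z.2) (L + L') where
  contDiff := (hb.contDiff.comp contDiff_fst).mul (hb'.contDiff.comp contDiff_snd)
  lipschitz x y := by
    have h1 : |b x.1 - b y.1| ≤ L * ‖x - y‖ := (hb.lipschitz _ _).trans <| by
      gcongr; exact norm_fst_le (x - y)
    have h2 : |b' x.2 - b' y.2| ≤ L' * ‖x - y‖ := (hb'.lipschitz _ _).trans <| by
      gcongr; exact norm_snd_le (x - y)
    calc |b x.1 * b' x.2 - b y.1 * b' y.2|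
        = |(b x.1 - b y.1) * b' x.2 + b y.1 * (b' x.2 - b' y.2)| := by ring_nf
      _ ≤ |b x.1 - b y.1| * b' x.2 + b y.1 * |b' x.2 - b' y.2| := by
        refine (abs_add_le _ _).trans ?_
        rw [abs_mul, abs_mul, abs_of_nonneg (hb'.nonneg _), abs_of_nonneg (hb.nonneg _)]
      _ ≤ |b x.1 - b y.1| * 1 + 1 * |b' x.2 - b' y.2| := by
        gcongr
        · exact hb'.le_one _
        · exact hb.le_one _
      _ ≤ (L + L') * ‖x - y‖ := by linarith
  nonneg x := mul_nonneg (hb.nonneg _) (hb'.nonneg _)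
  le_one x := mul_le_one₀ (hb.le_one _) (hb'.nonneg _) (hb'.le_one _)
  eventually_eq_one := by
    have h0 : (0 : E × E') = (0, 0) := rfl
    rw [h0]
    filter_upwards [hb.eventually_eq_one.prod_nhds hb'.eventually_eq_one] with x hx
    rw [hx.1, hx.2, one_mul]
  eq_zero x hx := by
    rw [Prod.norm_def, le_max_iff] at hx
    rcases hx with h | h
    · rw [hb.eq_zero _ h, zero_mul]
    · rw [hb'.eq_zero _ h, mul_zero]

/-- The weights `8⁻ⁱ` beat the Lipschitz factors `2ⁱ` of the rescaled bumps: derivatives are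
dominated by `δ L 4⁻ⁱ`, so the series can be differentiated term by term. -/
theorem NormalizedBump.exists_contDiff_series {E : Type*} [NormedAddCommGroup E] [NormedSpace ℝ E]
    {b : E → ℝ} {L : ℝ} (hL : 0 ≤ L) (hb : NormalizedBump b L) {δ : ℝ} (hδ : 0 ≤ δ)
    (x : ℕ → E) :
    let t : ℕ → E → ℝ := fun i y => δ * (1 / 8) ^ i * b ((2 : ℝ) ^ i • (y - x i))
    (∀ y, Summable fun i => t i y) ∧ ContDiff ℝ 1 (fun y => ∑' i, t i y) ∧
      ∀ y, ‖fderiv ℝ (fun y => ∑' i, t i y) y‖ ≤ 2 * (δ * L) := by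
  intro t
  have hsum : ∀ y, Summable fun i => t i y := fun y => by
    refine Summable.of_nonneg_of_le (fun i => mul_nonneg (by positivity) (hb.nonneg _))
      (fun i => mul_le_of_le_one_right (by positivity) (hb.le_one _))
      ((summable_geometric_of_lt_one (r := (1 / 8 : ℝ)) (by norm_num) (by norm_num)).mul_left δ)
  have hC : ∀ i, ContDiff ℝ 1 (t i) := fun i =>
    contDiff_const.mul (hb.contDiff.comp (by fun_prop))
  have hd : ∀ i y, ‖fderiv ℝ (t i) y‖ ≤ δ * L * (1 / 4) ^ i := fun i y => by
    have hlip : LipschitzWith ⟨δ * L * (1 / 4) ^ i, by positivity⟩ (t i) :=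
      LipschitzWith.of_dist_le_mul fun y z => by
        rw [Real.dist_eq, dist_eq_norm, ← mul_sub, abs_mul, abs_of_nonneg (by positivity)]
        have := hb.lipschitz ((2 : ℝ) ^ i • (y - x i)) ((2 : ℝ) ^ i • (z - x i))
        rw [← smul_sub, sub_sub_sub_cancel_right, norm_smul, norm_pow,
          Real.norm_of_nonneg zero_le_two] at this
        calc _ ≤ δ * (1 / 8) ^ i * (L * (2 ^ i * ‖y - z‖)) := by gcongr
          _ = δ * L * ((1 / 8 : ℝ) ^ i * 2 ^ i) * ‖y - z‖ := by ring
          _ = δ * L * (1 / 4) ^ i * ‖y - z‖ := by rw [← mul_pow]; norm_num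
          _ = _ := rfl
    exact norm_fderiv_le_of_lipschitz ℝ hlip
  have hg : HasSum (fun i : ℕ => δ * L * (1 / 4 : ℝ) ^ i) (δ * L * (1 - 1 / 4)⁻¹) :=
    (hasSum_geometric_of_lt_one (by norm_num) (by norm_num)).mul_left _
  have hF : (fderiv ℝ fun y => ∑' i, t i y) = fun y => ∑' i, fderiv ℝ (t i) y :=
    fderiv_tsum hg.summable (fun i => (hC i).differentiable one_ne_zero) hd (hsum 0)
  refine ⟨hsum, ?_, fun y => ?_⟩
  · rw [contDiff_one_iff_fderiv]
    refine ⟨fun y => ?_, ?_⟩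
    · exact (hasFDerivAt_tsum hg.summable
        (fun n y => ((hC n).differentiable one_ne_zero y).hasFDerivAt) hd (hsum 0)
        y).differentiableAt
    · rw [hF]
      exact continuous_tsum (fun i => (hC i).continuous_fderiv one_ne_zero) hg.summable hd
  · rw [hF]
    refine (tsum_of_norm_bounded hg fun i => hd i y).trans ?_
    have : 0 ≤ δ * L := by positivity
    norm_num
    linarith

/-- The smooth variational principle of Deville, Godefroy and Zizler on a closed set. -/
theorem NormalizedBump.exists_contDiff_add_isMinOn {E : Type*} [NormedAddCommGroup E]
    [NormedSpace ℝ E] [CompleteSpace E] {b : E → ℝ} {L : ℝ} (hL : 0 ≤ L) (hb : NormalizedBump b L)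
    {S : Set E} (hS : IsClosed S) (hne : S.Nonempty) {f : E → ℝ} (hf : LowerSemicontinuousOn f S)
    (hbdd : BddBelow (f '' S)) {ε : ℝ} (hε : 0 < ε) :
    ∃ φ : E → ℝ, ContDiff ℝ 1 φ ∧ (∀ x, |φ x| ≤ ε) ∧ (∀ x, ‖fderiv ℝ φ x‖ ≤ ε) ∧
      ∃ x ∈ S, IsMinOn (fun y => f y + φ y) S x := by
  classical
  set δ : ℝ := ε / (2 * (1 + L)) with hδ_def
  have hδ : 0 < δ := by positivity
  have hδ1 : 2 * δ ≤ ε := by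
    rw [hδ_def, mul_div_assoc', div_le_iff₀ (by positivity)]
    nlinarith [mul_nonneg hε.le hL]
  have hδ2 : 2 * (δ * L) ≤ ε := by
    rw [hδ_def, div_mul_eq_mul_div, mul_div_assoc', div_le_iff₀ (by positivity)]
    nlinarith [mul_nonneg hε.le hL]
  set c : ℕ → ℝ := fun i => δ * (1 / 8) ^ i with hc
  have hc0 : ∀ i, 0 < c i := fun i => by positivity
  have hcs : ∀ i, c (i + 1) = c i / 8 := fun i => by simp only [hc, pow_succ]; ring
  -- The choice of an almost minimizer is made total, so that the recursion can be defined before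
  -- its functions are known to be bounded below.
  have hpick : ∀ (g : E → ℝ) (η : ℝ), ∃ x, x ∈ S ∧
      (BddBelow (g '' S) → 0 < η → ∀ y ∈ S, g x ≤ g y + η) := by
    intro g η
    by_cases h : BddBelow (g '' S) ∧ 0 < η
    · obtain ⟨_, ⟨x, hx, rfl⟩, hlt⟩ := exists_lt_of_csInf_lt (hne.image g)
        (lt_add_of_pos_right (sInf (g '' S)) h.2)
      refine ⟨x, hx, fun _ _ y hy => ?_⟩
      linarith [csInf_le h.1 (mem_image_of_mem g hy)]
    · obtain ⟨x, hx⟩ := hne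
      exact ⟨x, hx, fun h1 h2 => absurd ⟨h1, h2⟩ h⟩
  choose pick hpickS hpick using hpick
  let g : ℕ → E → ℝ := fun n => Nat.rec f (fun i h y =>
    h y - c i * b ((2 : ℝ) ^ i • (y - pick h (c i / 2)))) n
  let x : ℕ → E := fun i => pick (g i) (c i / 2)
  have hxS : ∀ i, x i ∈ S := fun i => hpickS _ _
  have hgs : ∀ i y, g (i + 1) y = g i y - c i * b ((2 : ℝ) ^ i • (y - x i)) := fun i y => rfl
  have hgle : ∀ i y, g i y - c i ≤ g (i + 1) y := fun i y => by
    rw [hgs]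
    have := mul_le_of_le_one_right (hc0 i).le (hb.le_one ((2 : ℝ) ^ i • (y - x i)))
    linarith
  have hgbdd : ∀ i, BddBelow (g i '' S) := by
    intro i
    induction i with
    | zero => exact hbdd
    | succ i ih =>
      obtain ⟨m, hm⟩ := ih
      refine ⟨m - c i, ?_⟩
      rintro _ ⟨y, hy, rfl⟩
      linarith [hm (mem_image_of_mem _ hy), hgle i y]
  have hmin : ∀ i, ∀ y ∈ S, g i (x i) ≤ g i y + c i / 2 := fun i =>
    hpick _ _ (hgbdd i) (half_pos (hc0 i))
  -- If `x (i + 1)` escaped the ball of radius `2⁻ⁱ`, the `i`-th bump would vanish there while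
  -- lowering `x i` by `c i`. The errors `c i / 2` and `c (i + 1) / 2 = c i / 16` of almost
  -- minimality add up to less than `c i`, a contradiction.
  have hdist : ∀ i, dist (x i) (x (i + 1)) ≤ 1 * (1 / 2) ^ i := by
    intro i
    by_contra! h
    have h1 : b ((2 : ℝ) ^ i • (x (i + 1) - x i)) = 0 := by
      apply hb.eq_zero
      rw [norm_smul, norm_pow, Real.norm_of_nonneg zero_le_two, ← dist_eq_norm, dist_comm]
      calc (1 : ℝ) = 2 ^ i * (1 * (1 / 2) ^ i) := by rw [one_mul, ← mul_pow]; norm_num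
        _ ≤ _ := by gcongr
    have h2 := hmin (i + 1) _ (hxS i)
    rw [hgs, hgs, h1, sub_self, smul_zero, hb.apply_zero, hcs] at h2
    have h3 := hmin i _ (hxS (i + 1))
    linarith [hc0 i]
  obtain ⟨a, ha⟩ := cauchySeq_tendsto_of_complete
    (cauchySeq_of_le_geometric (1 / 2) 1 (by norm_num) hdist)
  have haS : a ∈ S := hS.mem_of_tendsto ha (Eventually.of_forall hxS)
  obtain ⟨hsum, hC1, hder⟩ := hb.exists_contDiff_series hL hδ.le x
  set t : ℕ → E → ℝ := fun i y => δ * (1 / 8) ^ i * b ((2 : ℝ) ^ i • (y - x i)) with ht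
  have ht0 : ∀ i y, 0 ≤ t i y := fun i y => mul_nonneg (hc0 i).le (hb.nonneg _)
  have htc : ∀ i y, t i y ≤ c i := fun i y => mul_le_of_le_one_right (hc0 i).le (hb.le_one _)
  have hcsum : ∀ i, HasSum (fun j => c (j + i)) (c i * (1 - 1 / 8)⁻¹) := fun i => by
    have h : (fun j => c (j + i)) = fun j => c i * (1 / 8) ^ j := by
      ext j
      simp only [hc, pow_add]
      ring
    rw [h]
    exact (hasSum_geometric_of_lt_one (by norm_num) (by norm_num)).mul_left (c i)
  have hgi : ∀ i y, g i y = f y - ∑ j ∈ Finset.range i, t j y := by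
    intro i y
    induction i with
    | zero => simp [g]
    | succ i ih => rw [hgs, ih, Finset.sum_range_succ]; ring
  have hsplit : ∀ i y, f y - ∑' j, t j y = g i y - ∑' j, t (j + i) y := fun i y => by
    rw [hgi, ← (hsum y).sum_add_tsum_nat_add i]; ring
  have htail0 : ∀ i y, 0 ≤ ∑' j, t (j + i) y := fun i y => tsum_nonneg fun j => ht0 _ _
  have htail : ∀ i y, ∑' j, t (j + i) y ≤ 3 / 2 * c i := fun i y => by
    have h1 : ∑' j, t (j + i) y ≤ c i * (1 - 1 / 8)⁻¹ := by
      rw [← (hcsum i).tsum_eq]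
      exact ((summable_nat_add_iff i).2 (hsum y)).tsum_le_tsum (fun j => htc _ _)
        (hcsum i).summable
    refine h1.trans ?_
    norm_num
    linarith [hc0 i]
  refine ⟨fun y => -∑' i, t i y, hC1.neg, fun y => ?_, fun y => ?_, a, haS, ?_⟩
  · have h1 := htail 0 y
    have h2 := htail0 0 y
    have h3 : c 0 = δ := by simp [hc]
    rw [h3] at h1
    change |-∑' i, t (i + 0) y| ≤ ε
    rw [abs_neg, abs_of_nonneg h2]
    linarith
  · rw [fderiv_fun_neg, norm_neg]
    exact (hder y).trans hδ2
  · have hlsc : LowerSemicontinuousOn (fun y => f y + -∑' i, t i y) S :=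
      hf.add hC1.neg.continuous.continuousOn.lowerSemicontinuousOn
    intro y hy
    show f a + -∑' i, t i a ≤ f y + -∑' i, t i y
    by_contra! hlt
    obtain ⟨m, hm1, hm2⟩ := exists_between hlt
    have hev := (tendsto_nhdsWithin_iff.2 ⟨ha, Eventually.of_forall hxS⟩).eventually
      (hlsc a haS m hm2)
    -- The full perturbed function differs from `g i` by a tail in `[0, 3/2 * c i]`, to which the
    -- error `c i / 2` is added. Lower semicontinuity then passes minimality to the limit `a`.
    have hle : ∀ i, f (x i) + -∑' j, t j (x i) ≤ f y + -∑' j, t j y + 2 * c i := fun i => by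
      rw [← sub_eq_add_neg, ← sub_eq_add_neg, hsplit i, hsplit i]
      linarith [hmin i y hy, htail i y, htail0 i (x i)]
    have hc_tendsto : Tendsto (fun i => f y + -∑' j, t j y + 2 * c i) atTop
        (𝓝 (f y + -∑' j, t j y + 2 * (δ * 0))) :=
      (((tendsto_pow_atTop_nhds_zero_of_lt_one (by norm_num) (by norm_num)).const_mul
        δ).const_mul 2).const_add _
    rw [mul_zero, mul_zero, add_zero] at hc_tendsto
    obtain ⟨i, hi1, hi2⟩ := (hev.and (hc_tendsto.eventually_lt_const hm1)).exists
    linarith [hle i]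

/-! ### Sub- and superdifferentials in a normed space and the fuzzy sum rule. -/

section NormedSpace

variable {X : Type*} [NormedAddCommGroup X] [NormedSpace ℝ X]

/-- The superdifferential of `f` at `x`, with respect to `C¹` test functions on a normed space. -/
def c1Superdifferential (f : X → ℝ) (x : X) : Set (X →L[ℝ] ℝ) :=
  {p | ∃ φ : X → ℝ, ContDiff ℝ 1 φ ∧ IsLocalMax (fun y => f y - φ y) x ∧ p = fderiv ℝ φ x}

/-- The subdifferential of `f` at `x`, with respect to `C¹` test functions on a normed space. -/
def c1Subdifferential (f : X → ℝ) (x : X) : Set (X →L[ℝ] ℝ) :=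
  {p | ∃ φ : X → ℝ, ContDiff ℝ 1 φ ∧ IsLocalMin (fun y => f y - φ y) x ∧ p = fderiv ℝ φ x}

theorem neg_mem_c1Superdifferential {f : X → ℝ} {x : X} {p : X →L[ℝ] ℝ}
    (h : p ∈ c1Subdifferential (fun y => -f y) x) : -p ∈ c1Superdifferential f x := by
  obtain ⟨φ, hφ, hmin, rfl⟩ := h
  refine ⟨fun y => -φ y, hφ.neg, ?_, by rw [fderiv_fun_neg]⟩
  filter_upwards [hmin] with y hy
  linarith

theorem neg_mem_c1Subdifferential {f : X → ℝ} {x : X} {p : X →L[ℝ] ℝ}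
    (h : p ∈ c1Superdifferential (fun y => -f y) x) : -p ∈ c1Subdifferential f x := by
  obtain ⟨φ, hφ, hmin, rfl⟩ := h
  refine ⟨fun y => -φ y, hφ.neg, ?_, by rw [fderiv_fun_neg]⟩
  filter_upwards [hmin] with y hy
  linarith

theorem eq_fderiv_of_mem_c1Subdifferential {f : X → ℝ} {x : X} {p : X →L[ℝ] ℝ}
    (hf : DifferentiableAt ℝ f x) (h : p ∈ c1Subdifferential f x) : p = fderiv ℝ f x := by
  obtain ⟨φ, hφ, hmin, rfl⟩ := h
  have := hmin.fderiv_eq_zero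
  rw [fderiv_fun_sub hf (hφ.differentiable one_ne_zero x)] at this
  exact (sub_eq_zero.1 this).symm

/-- Along `x + t v` with `t > 0` the slopes of `φ` are at most those of `f`; the limit bounds the
derivative above, and `-v` gives the other side. A general seminorm is allowed so that the bound can
be taken in the Finsler norm of a chart. -/
theorem abs_le_of_isLocalMin_of_lipschitz {f φ : X → ℝ} {x : X} {N : Seminorm ℝ X}
    {C : ℝ} (hf : ∀ᶠ y in 𝓝 x, |f y - f x| ≤ C * N (y - x)) (hφ : DifferentiableAt ℝ φ x)
    (h : IsLocalMin (fun y => f y - φ y) x) (v : X) : |fderiv ℝ φ x v| ≤ C * N v := by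
  have key : ∀ v : X, fderiv ℝ φ x v ≤ C * N v := by
    intro v
    have hline : Tendsto (fun t : ℝ => x + t • v) (𝓝[>] 0) (𝓝 x) := by
      have : Tendsto (fun t : ℝ => x + t • v) (𝓝 0) (𝓝 (x + (0 : ℝ) • v)) :=
        Continuous.tendsto (by fun_prop) 0
      rw [zero_smul, add_zero] at this
      exact this.mono_left nhdsWithin_le_nhds
    have hd : HasDerivAt (fun t : ℝ => φ (x + t • v)) (fderiv ℝ φ x v) 0 := by
      have h1 : HasDerivAt (fun t : ℝ => x + t • v) v 0 := by
        simpa using ((hasDerivAt_id (0 : ℝ)).smul_const v).const_add x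
      have h2 : HasFDerivAt φ (fderiv ℝ φ x) (x + (0 : ℝ) • v) := by
        simpa using hφ.hasFDerivAt
      exact h2.comp_hasDerivAt 0 h1
    have hs := hd.hasDerivWithinAt (s := Ioi 0)
    rw [hasDerivWithinAt_iff_tendsto_slope' (by simp)] at hs
    refine le_of_tendsto hs ?_
    filter_upwards [hline.eventually hf, hline.eventually h, self_mem_nhdsWithin] with t h1 h2 h3
    have ht : (0 : ℝ) < t := h3
    rw [slope_def_field, sub_zero, div_le_iff₀ ht, zero_smul, add_zero]
    rw [add_sub_cancel_left, map_smul_eq_mul, Real.norm_of_nonneg ht.le] at h1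
    linarith [le_abs_self (f (x + t • v) - f x)]
  refine abs_le.2 ⟨?_, key v⟩
  have := key (-v)
  rw [map_neg, map_neg_eq_map] at this
  linarith

theorem abs_le_of_mem_c1Subdifferential {f : X → ℝ} {x : X} {N : Seminorm ℝ X} {C : ℝ}
    (hf : ∀ᶠ y in 𝓝 x, |f y - f x| ≤ C * N (y - x)) {p : X →L[ℝ] ℝ}
    (h : p ∈ c1Subdifferential f x) (v : X) : |p v| ≤ C * N v := by
  obtain ⟨φ, hφ, hmin, rfl⟩ := h
  exact abs_le_of_isLocalMin_of_lipschitz hf (hφ.differentiable one_ne_zero x) hmin v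

/-- On the segment from `x` to `a` the cone is affine with slope `-A * ‖x - a‖`, whether or not the
norm is differentiable, and a test function touching it from below has the same derivative in that
direction. -/
theorem le_norm_of_mem_c1Subdifferential_norm {A : ℝ} {x a : X} (hx : x ≠ a) {p : X →L[ℝ] ℝ}
    (h : p ∈ c1Subdifferential (fun y => A * ‖y - a‖) x) : A ≤ ‖p‖ := by
  obtain ⟨φ, hφ, hmin, rfl⟩ := h
  have h1 : HasDerivAt (fun t : ℝ => x + t • (a - x)) (a - x) 0 := by
    simpa using ((hasDerivAt_id (0 : ℝ)).smul_const (a - x)).const_add x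
  have hd : HasDerivAt (fun t : ℝ => φ (x + t • (a - x))) (fderiv ℝ φ x (a - x)) 0 := by
    have h2 : HasFDerivAt φ (fderiv ℝ φ x) (x + (0 : ℝ) • (a - x)) := by
      simpa using (hφ.differentiable one_ne_zero x).hasFDerivAt
    exact h2.comp_hasDerivAt 0 h1
  have hd2 : HasDerivAt (fun t : ℝ => A * ((1 - t) * ‖x - a‖) - φ (x + t • (a - x)))
      (A * (-1 * ‖x - a‖) - fderiv ℝ φ x (a - x)) 0 :=
    ((((hasDerivAt_id (0 : ℝ)).const_sub 1).mul_const _).const_mul A).sub hd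
  have hline : Tendsto (fun t : ℝ => x + t • (a - x)) (𝓝 0) (𝓝 x) := by
    have := h1.continuousAt.tendsto
    simpa using this
  have hlm : IsLocalMin (fun t : ℝ => A * ((1 - t) * ‖x - a‖) - φ (x + t • (a - x))) 0 := by
    filter_upwards [hline.eventually hmin, gt_mem_nhds (zero_lt_one (α := ℝ))] with t ht ht1
    have : x + t • (a - x) - a = (1 - t) • (x - a) := by module
    rw [this, norm_smul, Real.norm_of_nonneg (by linarith)] at ht
    simpa using ht
  have h0 := hlm.hasDerivAt_eq_zero hd2
  have hpos : 0 < ‖x - a‖ := norm_pos_iff.2 (sub_ne_zero.2 hx)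
  have h3 := neg_le_of_abs_le (((fderiv ℝ φ x).le_opNorm (a - x)))
  rw [norm_sub_rev] at h3
  nlinarith

/-- A fuzzy sum rule for a difference `f - g - k` with `f` upper semicontinuous and `g`, `k`
Lipschitz. -/
theorem HasC1LipschitzBump.exists_fuzzy_sum [CompleteSpace X] (hX : HasC1LipschitzBump X)
    {c a : X} {r r' η Lg Lk : ℝ} (hr : r' < r) (hη : 0 < η) (ha : a ∈ Metric.closedBall c r)
    {f g k : X → ℝ} (hf : UpperSemicontinuousOn f (Metric.closedBall c r))
    (hfb : BddAbove (f '' Metric.closedBall c r))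
    (hg : ∀ x ∈ Metric.closedBall c r, ∀ y ∈ Metric.closedBall c r, |g x - g y| ≤ Lg * ‖x - y‖)
    (hk : ∀ x ∈ Metric.closedBall c r, ∀ y ∈ Metric.closedBall c r, |k x - k y| ≤ Lk * ‖x - y‖)
    (hsep : ∀ y ∈ Metric.closedBall c r, r' ≤ ‖y - c‖ → f y - g y - k y ≤ f a - g a - k a - η)
    {ε : ℝ} (hε : 0 < ε) :
    ∃ x y z, ‖x - c‖ < r' ∧ ‖x - y‖ < ε ∧ ‖x - z‖ < ε ∧ y ∈ Metric.ball c r ∧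
      z ∈ Metric.ball c r ∧ (∃ p ∈ c1Superdifferential f x, ∃ q ∈ c1Subdifferential g y,
        ∃ s ∈ c1Subdifferential k z, ‖p - q - s‖ ≤ ε) ∧
      f a - g a - k a - ε ≤ f x - g y - k z := by
  obtain ⟨b, L, hL, hb⟩ := hX.exists_normalizedBump
  set B := Metric.closedBall c r with hB
  have hB3 := hb.prod hL (by positivity) (hb.prod hL hL hb)
  obtain ⟨mf, hmf⟩ := hfb
  have hLg : ∀ x ∈ B, ∀ y ∈ B, |g x - g y| ≤ |Lg| * ‖x - y‖ := fun x hx y hy =>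
    (hg x hx y hy).trans (by gcongr; exact le_abs_self _)
  have hLk : ∀ x ∈ B, ∀ y ∈ B, |k x - k y| ≤ |Lk| * ‖x - y‖ := fun x hx y hy =>
    (hk x hx y hy).trans (by gcongr; exact le_abs_self _)
  have hdiam : ∀ x ∈ B, ∀ y ∈ B, ‖x - y‖ ≤ 2 * r := fun x hx y hy => by
    rw [hB, mem_closedBall_iff_norm] at hx hy
    have := norm_sub_le_norm_sub_add_norm_sub x c y
    rw [norm_sub_rev c y] at this
    linarith
  have hgB : ∀ y ∈ B, g a - |Lg| * (2 * r) ≤ g y := fun y hy => by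
    have h1 := abs_le.1 (hLg y hy a ha)
    have h2 : |Lg| * ‖y - a‖ ≤ |Lg| * (2 * r) := by gcongr; exact hdiam y hy a ha
    linarith
  have hkB : ∀ y ∈ B, k a - |Lk| * (2 * r) ≤ k y := fun y hy => by
    have h1 := abs_le.1 (hLk y hy a ha)
    have h2 : |Lk| * ‖y - a‖ ≤ |Lk| * (2 * r) := by gcongr; exact hdiam y hy a ha
    linarith
  set m : ℝ := -mf + (g a - |Lg| * (2 * r)) + (k a - |Lk| * (2 * r)) with hm
  have hlow : ∀ x ∈ B, ∀ y ∈ B, ∀ z ∈ B, m ≤ -f x + g y + k z := fun x hx y hy z hz => by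
    have := hmf (mem_image_of_mem f hx)
    linarith [hgB y hy, hkB z hz]
  obtain ⟨ε', hε', hε'1, hε'2⟩ : ∃ ε' : ℝ, 0 < ε' ∧ 4 * ε' ≤ ε ∧ 4 * ε' ≤ η :=
    ⟨min ε η / 4, by positivity, by linarith [min_le_left ε η], by linarith [min_le_right ε η]⟩
  -- `A` exceeds what the value at `(a, a, a)`, perturbations included, leaves above the lower bound
  -- `m`; a minimizer cannot pay a penalty of `A`.
  obtain ⟨A, hA0, hA⟩ : ∃ A : ℝ, 0 < A ∧ -(f a - g a - k a) + 2 * ε' - m < A :=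
    ⟨max 1 (-(f a - g a - k a) + 2 * ε' - m + 1), by positivity,
      by linarith [le_max_right 1 (-(f a - g a - k a) + 2 * ε' - m + 1)]⟩
  -- `τ` bounds the distances from `x` to `y` and `z`: the condition `τ ≤ r - r'` keeps `y` and `z`
  -- interior, and the last one makes the change of `g` and `k` small against the gap `η`.
  obtain ⟨τ, hτ, hτ1, hτ2, hτ3⟩ : ∃ τ : ℝ, 0 < τ ∧ τ ≤ ε ∧ τ ≤ r - r' ∧
      (|Lg| + |Lk|) * τ ≤ η / 4 := by
    refine ⟨min (min ε (r - r')) (η / 4 / (|Lg| + |Lk| + 1)), ?_, ?_, ?_, ?_⟩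
    · have := sub_pos.2 hr
      positivity
    · exact (min_le_left _ _).trans (min_le_left _ _)
    · exact (min_le_left _ _).trans (min_le_right _ _)
    · calc _ ≤ (|Lg| + |Lk| + 1) * (η / 4 / (|Lg| + |Lk| + 1)) := by
            have := sub_pos.2 hr
            exact mul_le_mul (by linarith) (min_le_right _ _) (by positivity) (by positivity)
        _ = η / 4 := by field_simp
  -- The bump replaces the usual squared norm, which need not be `C¹`: the penalty is `0` at
  -- coincidence and saturates at `A` from distance `τ` on.
  let ψ : X → ℝ := fun w => A * (1 - b (τ⁻¹ • w))
  have hψC : ContDiff ℝ 1 ψ :=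
    contDiff_const.mul (contDiff_const.sub (hb.contDiff.comp (by fun_prop)))
  have hψ0 : ψ 0 = 0 := by simp [ψ, hb.apply_zero]
  have hψnn : ∀ w, 0 ≤ ψ w := fun w => mul_nonneg hA0.le (sub_nonneg.2 (hb.le_one _))
  have hψlt : ∀ w, ψ w < A → ‖w‖ < τ := fun w hw => by
    by_contra! h
    have : b (τ⁻¹ • w) = 0 := by
      apply hb.eq_zero
      rw [norm_smul, norm_inv, Real.norm_of_nonneg hτ.le, inv_mul_eq_div, le_div_iff₀ hτ, one_mul]
      exact h
    simp [ψ, this] at hw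
  let Φ : X × X × X → ℝ := fun w =>
    -f w.1 + (g w.2.1 + k w.2.2 + (ψ (w.1 - w.2.1) + ψ (w.1 - w.2.2)))
  let S : Set (X × X × X) := B ×ˢ B ×ˢ B
  have hS : IsClosed S :=
    Metric.isClosed_closedBall.prod (Metric.isClosed_closedBall.prod Metric.isClosed_closedBall)
  have hgc : ContinuousOn g B := by
    have : LipschitzOnWith ⟨|Lg|, abs_nonneg _⟩ g B := LipschitzOnWith.of_dist_le_mul
      fun x hx y hy => by rw [Real.dist_eq, dist_eq_norm]; exact hLg x hx y hy
    exact this.continuousOn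
  have hkc : ContinuousOn k B := by
    have : LipschitzOnWith ⟨|Lk|, abs_nonneg _⟩ k B := LipschitzOnWith.of_dist_le_mul
      fun x hx y hy => by rw [Real.dist_eq, dist_eq_norm]; exact hLk x hx y hy
    exact this.continuousOn
  have hΦ : LowerSemicontinuousOn Φ S := by
    refine LowerSemicontinuousOn.add ?_ (ContinuousOn.lowerSemicontinuousOn ?_)
    · intro w hw e he
      have h1 := hf w.1 hw.1 (-e) (by linarith)
      have h2 : Tendsto Prod.fst (𝓝[S] w) (𝓝[B] w.1) :=
        tendsto_nhdsWithin_iff.2 ⟨(continuous_fst.tendsto w).mono_left nhdsWithin_le_nhds,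
          eventually_nhdsWithin_of_forall fun w hw => hw.1⟩
      filter_upwards [h2.eventually h1] with w hw
      linarith
    · refine ContinuousOn.add (ContinuousOn.add ?_ ?_) (Continuous.continuousOn ?_)
      · exact hgc.comp (by fun_prop) fun w hw => hw.2.1
      · exact hkc.comp (by fun_prop) fun w hw => hw.2.2
      · have := hψC.continuous
        fun_prop
  have hbd : BddBelow (Φ '' S) := by
    refine ⟨m, ?_⟩
    rintro _ ⟨w, hw, rfl⟩
    show m ≤ -f w.1 + (g w.2.1 + k w.2.2 + (ψ (w.1 - w.2.1) + ψ (w.1 - w.2.2)))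
    linarith [hlow _ hw.1 _ hw.2.1 _ hw.2.2, hψnn (w.1 - w.2.1), hψnn (w.1 - w.2.2)]
  obtain ⟨φ, hφC, hφ, hφd, ⟨x, y, z⟩, ⟨hxB, hyB, hzB⟩, hmin⟩ :=
    hB3.exists_contDiff_add_isMinOn (by positivity) hS ⟨(a, a, a), ha, ha, ha⟩ hΦ hbd hε'
  have hval : -f x + (g y + k z + (ψ (x - y) + ψ (x - z))) + φ (x, y, z) ≤
      -f a + (g a + k a + (ψ (a - a) + ψ (a - a))) + φ (a, a, a) :=
    hmin (show (a, a, a) ∈ S from ⟨ha, ha, ha⟩)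
  rw [sub_self, hψ0] at hval
  have hφ1 := abs_le.1 (hφ (x, y, z))
  have hφ2 := abs_le.1 (hφ (a, a, a))
  have hm1 := hlow x hxB y hyB z hzB
  have hp1 := hψnn (x - y)
  have hp2 := hψnn (x - z)
  have hxy : ‖x - y‖ < τ := hψlt _ (by linarith)
  have hxz : ‖x - z‖ < τ := hψlt _ (by linarith)
  have hg1 : g x - g y ≤ |Lg| * τ := (le_abs_self _).trans ((hLg x hxB y hyB).trans (by gcongr))
  have hk1 : k x - k z ≤ |Lk| * τ := (le_abs_self _).trans ((hLk x hxB z hzB).trans (by gcongr))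
  -- Outside the smaller ball the gap `η` would have to be covered by `2 * ε' ≤ η / 2` and the
  -- Lipschitz errors of total size at most `η / 4`.
  have hxr : ‖x - c‖ < r' := by
    by_contra! h
    have := hsep x hxB h
    linarith
  have hyr : y ∈ Metric.ball c r := by
    rw [mem_ball_iff_norm, norm_sub_rev]
    have := norm_sub_le_norm_sub_add_norm_sub c x y
    rw [norm_sub_rev c x] at this
    linarith
  have hzr : z ∈ Metric.ball c r := by
    rw [mem_ball_iff_norm, norm_sub_rev]
    have := norm_sub_le_norm_sub_add_norm_sub c x z
    rw [norm_sub_rev c x] at this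
    linarith
  have hψd : ∀ w, HasFDerivAt ψ (fderiv ℝ ψ w) w := fun w =>
    (hψC.differentiable one_ne_zero w).hasFDerivAt
  have hφD : HasFDerivAt φ (fderiv ℝ φ (x, y, z)) (x, y, z) :=
    (hφC.differentiable one_ne_zero _).hasFDerivAt
  set D := fderiv ℝ φ (x, y, z)
  have hBx : B ∈ 𝓝 x := mem_of_superset (Metric.isOpen_ball.mem_nhds
    (show x ∈ Metric.ball c r by rw [mem_ball_iff_norm]; linarith)) Metric.ball_subset_closedBall
  have hBy : B ∈ 𝓝 y := mem_of_superset (Metric.isOpen_ball.mem_nhds hyr)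
    Metric.ball_subset_closedBall
  have hBz : B ∈ 𝓝 z := mem_of_superset (Metric.isOpen_ball.mem_nhds hzr)
    Metric.ball_subset_closedBall
  have dx : HasFDerivAt (fun x' => ψ (x' - y) + ψ (x' - z) + φ (x', y, z))
      (fderiv ℝ ψ (x - y) + fderiv ℝ ψ (x - z) +
        D.comp ((ContinuousLinearMap.id ℝ X).prod (0 : X →L[ℝ] X × X))) x := by
    refine HasFDerivAt.add (HasFDerivAt.add ?_ ?_) ?_
    · exact (hψd (x - y)).comp x ((hasFDerivAt_id x).sub_const y)
    · exact (hψd (x - z)).comp x ((hasFDerivAt_id x).sub_const z)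
    · exact hφD.comp x ((hasFDerivAt_id x).prodMk (hasFDerivAt_const (y, z) x))
  have dy : HasFDerivAt (fun y' => -(ψ (x - y') + φ (x, y', z)))
      (-((fderiv ℝ ψ (x - y)).comp (-ContinuousLinearMap.id ℝ X) +
        D.comp ((0 : X →L[ℝ] X).prod ((ContinuousLinearMap.id ℝ X).prod (0 : X →L[ℝ] X))))) y := by
    refine (HasFDerivAt.add ?_ ?_).neg
    · exact (hψd (x - y)).comp y ((hasFDerivAt_id y).const_sub x)
    · exact hφD.comp y ((hasFDerivAt_const x y).prodMk
        ((hasFDerivAt_id y).prodMk (hasFDerivAt_const z y)))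
  have dz : HasFDerivAt (fun z' => -(ψ (x - z') + φ (x, y, z')))
      (-((fderiv ℝ ψ (x - z)).comp (-ContinuousLinearMap.id ℝ X) +
        D.comp ((0 : X →L[ℝ] X).prod ((0 : X →L[ℝ] X).prod (ContinuousLinearMap.id ℝ X))))) z := by
    refine (HasFDerivAt.add ?_ ?_).neg
    · exact (hψd (x - z)).comp z ((hasFDerivAt_id z).const_sub x)
    · exact hφD.comp z ((hasFDerivAt_const x z).prodMk
        ((hasFDerivAt_const y z).prodMk (hasFDerivAt_id z)))
  refine ⟨x, y, z, hxr, hxy.trans_le hτ1, hxz.trans_le hτ1, hyr, hzr,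
    ⟨_, ⟨_, ?_, ?_, dx.fderiv.symm⟩, _, ⟨_, ?_, ?_, dy.fderiv.symm⟩, _,
      ⟨_, ?_, ?_, dz.fderiv.symm⟩, ?_⟩, by linarith⟩
  · fun_prop
  · filter_upwards [hBx] with x' hx'
    have h : -f x + (g y + k z + (ψ (x - y) + ψ (x - z))) + φ (x, y, z) ≤
      -f x' + (g y + k z + (ψ (x' - y) + ψ (x' - z))) + φ (x', y, z) :=
      hmin (show (x', y, z) ∈ S from ⟨hx', hyB, hzB⟩)
    linarith
  · fun_prop
  · filter_upwards [hBy] with y' hy'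
    have h : -f x + (g y + k z + (ψ (x - y) + ψ (x - z))) + φ (x, y, z) ≤
      -f x + (g y' + k z + (ψ (x - y') + ψ (x - z))) + φ (x, y', z) :=
      hmin (show (x, y', z) ∈ S from ⟨hxB, hy', hzB⟩)
    linarith
  · fun_prop
  · filter_upwards [hBz] with z' hz'
    have h : -f x + (g y + k z + (ψ (x - y) + ψ (x - z))) + φ (x, y, z) ≤
      -f x + (g y + k z' + (ψ (x - y) + ψ (x - z'))) + φ (x, y, z') :=
      hmin (show (x, y, z') ∈ S from ⟨hxB, hyB, hz'⟩)
    linarith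
  · refine ContinuousLinearMap.opNorm_le_bound _ hε.le fun v => ?_
    -- The penalty derivatives cancel, because `ψ` depends on differences only; just the small
    -- perturbation in the diagonal direction survives.
    have hv : (fderiv ℝ ψ (x - y) + fderiv ℝ ψ (x - z) +
        D.comp ((ContinuousLinearMap.id ℝ X).prod (0 : X →L[ℝ] X × X)) -
        -((fderiv ℝ ψ (x - y)).comp (-ContinuousLinearMap.id ℝ X) +
          D.comp ((0 : X →L[ℝ] X).prod ((ContinuousLinearMap.id ℝ X).prod (0 : X →L[ℝ] X)))) -
        -((fderiv ℝ ψ (x - z)).comp (-ContinuousLinearMap.id ℝ X) +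
          D.comp ((0 : X →L[ℝ] X).prod ((0 : X →L[ℝ] X).prod (ContinuousLinearMap.id ℝ X))))) v =
        D (v, v, v) := by
      have : ((v, v, v) : X × X × X) = (v, 0) + ((0, v, 0) + (0, 0, v)) := by simp
      rw [this, map_add, map_add]
      simp
      ring
    rw [hv]
    refine (D.le_opNorm _).trans ?_
    have h1 : ‖((v, v, v) : X × X × X)‖ = ‖v‖ := by simp [Prod.norm_def]
    rw [h1]
    gcongr
    linarith [hφd (x, y, z)]

/-- An upper semicontinuous function with bounded superdifferentials is Lipschitz. -/
theorem HasC1LipschitzBump.sub_le_of_c1Superdifferential_bounded [CompleteSpace X]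
    (hX : HasC1LipschitzBump X) {w : X → ℝ} {c : X} {r B R A : ℝ} (hr : 0 < r)
    (hw : UpperSemicontinuousOn w (Metric.closedBall c r))
    (hB : ∀ x ∈ Metric.closedBall c r, |w x| ≤ B)
    (hR : ∀ x ∈ Metric.ball c r, ∀ p ∈ c1Superdifferential w x, ‖p‖ ≤ R)
    (hA : R < A) (hAB : 4 * B < A * r) {x₁ x₂ : X} (h₁ : x₁ ∈ Metric.closedBall c (r / 4))
    (h₂ : x₂ ∈ Metric.closedBall c (r / 4)) : w x₂ - w x₁ ≤ A * ‖x₂ - x₁‖ := by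
  by_contra! hlt
  rw [mem_closedBall_iff_norm] at h₁ h₂
  have hsub : Metric.closedBall x₁ (3 * r / 4) ⊆ Metric.closedBall c r := by
    apply Metric.closedBall_subset_closedBall'
    rw [dist_eq_norm]
    linarith
  have hsub' : Metric.ball x₁ (3 * r / 4) ⊆ Metric.ball c r := by
    apply Metric.ball_subset_ball'
    rw [dist_eq_norm]
    linarith
  have h21 : ‖x₂ - x₁‖ ≤ r / 2 := by
    have := norm_sub_le_norm_sub_add_norm_sub x₂ c x₁
    rw [norm_sub_rev c x₁] at this
    linarith
  have hx₁ : x₁ ∈ Metric.closedBall x₁ (3 * r / 4) := Metric.mem_closedBall_self (by positivity)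
  have hx₂ : x₂ ∈ Metric.closedBall x₁ (3 * r / 4) := by
    rw [mem_closedBall_iff_norm]
    linarith
  have hA0 : 0 < A := by
    have := (abs_nonneg _).trans (hB x₁ (hsub hx₁))
    by_contra! h
    nlinarith
  have hev : ∀ᶠ x in 𝓝 x₁, w x < w x₂ - A * ‖x₂ - x₁‖ - (w x₂ - A * ‖x₂ - x₁‖ - w x₁) / 2 := by
    have := (hw.mono hsub) x₁ hx₁ (w x₂ - A * ‖x₂ - x₁‖ - (w x₂ - A * ‖x₂ - x₁‖ - w x₁) / 2)
      (by linarith)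
    rwa [nhdsWithin_eq_nhds.2 (Metric.closedBall_mem_nhds _ (by positivity))] at this
  obtain ⟨ρ, hρ, hball⟩ := Metric.eventually_nhds_iff.1 hev
  obtain ⟨ε, hε, hε1, hε2, hε3⟩ : ∃ ε : ℝ, 0 < ε ∧ ε ≤ ρ ∧
      ε ≤ (w x₂ - A * ‖x₂ - x₁‖ - w x₁) / 2 ∧ ε < A - R := by
    have h1 := sub_pos.2 hA
    have h2 : 0 < w x₂ - A * ‖x₂ - x₁‖ - w x₁ := by linarith
    refine ⟨min ρ (min ((w x₂ - A * ‖x₂ - x₁‖ - w x₁) / 2) ((A - R) / 2)), by positivity,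
      min_le_left _ _, (min_le_right _ _).trans (min_le_left _ _), ?_⟩
    have := (min_le_right ρ (min ((w x₂ - A * ‖x₂ - x₁‖ - w x₁) / 2) ((A - R) / 2))).trans
      (min_le_right _ _)
    linarith
  -- The cone of slope `A` is based at `x₁` and the competitor is `x₂`. At distance at least `r / 2`
  -- from `x₁` the difference is at most `B - A * r / 2`, while at `x₂` it exceeds `w x₁ ≥ -B`; this
  -- is the gap `η`.
  obtain ⟨x, y, z, hx, hxy, -, -, -, ⟨p, hp, q, hq, s, hs, hpqs⟩, hval⟩ :=
    hX.exists_fuzzy_sum (c := x₁) (a := x₂) (r := 3 * r / 4) (r' := r / 2)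
      (η := (A * r - 4 * B) / 2) (Lg := A) (Lk := 0) (by linarith) (by linarith) hx₂
      (hw.mono hsub)
      ⟨B, by rintro _ ⟨x, hx, rfl⟩; exact (le_abs_self _).trans (hB x (hsub hx))⟩
      (g := fun y => A * ‖y - x₁‖) (k := fun _ => 0)
      (fun x _ y _ => by
        rw [← mul_sub, abs_mul, abs_of_pos hA0]
        gcongr
        simpa using abs_norm_sub_norm_le (x - x₁) (y - x₁))
      (fun x _ y _ => by simp)
      (fun y hy hry => by
        have h1 := abs_le.1 (hB y (hsub hy))
        have h2 := abs_le.1 (hB x₁ (hsub hx₁))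
        have h3 : A * (r / 2) ≤ A * ‖y - x₁‖ := by gcongr
        linarith) hε
  have hs0 : s = 0 := by
    rw [eq_fderiv_of_mem_c1Subdifferential (differentiableAt_const _) hs]
    simp
  rw [hs0, sub_zero] at hpqs
  have hp' := hR x (hsub' (by rw [mem_ball_iff_norm]; linarith)) p hp
  -- The apex is the only point where the cone may have small subdifferentials. It is excluded by
  -- upper semicontinuity of `w` at `x₁`; elsewhere `‖q‖ ≥ A` contradicts the bound `R` on `‖p‖`.
  by_cases hy : y = x₁
  · subst hy
    have := hball (y := x) (by rw [dist_eq_norm]; linarith)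
    simp only [sub_self, norm_zero, mul_zero, sub_zero] at hval
    linarith
  · have h1 := le_norm_of_mem_c1Subdifferential_norm hy hq
    have h2 := norm_sub_norm_le q p
    rw [norm_sub_rev] at h2
    linarith

end NormedSpace

/-! ### Dual norms with respect to a varying norm. -/

section DualSeminorm

variable {X : Type*} [NormedAddCommGroup X] [NormedSpace ℝ X]

/-- The norm of a continuous linear form `p` dual to a norm `N`, which may differ from the norm of
the space. -/
noncomputable def Seminorm.dual (N : Seminorm ℝ X) (p : X →L[ℝ] ℝ) : ℝ :=
  sSup {r : ℝ | ∃ v : X, N v = 1 ∧ r = |p v|}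

theorem Seminorm.dual_nonneg (N : Seminorm ℝ X) (p : X →L[ℝ] ℝ) : 0 ≤ N.dual p := by
  apply Real.sSup_nonneg
  rintro _ ⟨v, -, rfl⟩
  exact abs_nonneg _

theorem Seminorm.dual_le {N : Seminorm ℝ X} {p : X →L[ℝ] ℝ} {C : ℝ} (hC : 0 ≤ C)
    (h : ∀ v, |p v| ≤ C * N v) : N.dual p ≤ C := by
  apply Real.sSup_le _ hC
  rintro _ ⟨v, hv, rfl⟩
  simpa [hv] using h v

/-- Control of `‖v‖` by `N v` is what makes the set in the definition of `Seminorm.dual` bounded, so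
that its real supremum is the true one. -/
theorem Seminorm.abs_le_dual_mul {N : Seminorm ℝ X} {K : ℝ} (hN : ∀ v, ‖v‖ ≤ K * N v)
    (p : X →L[ℝ] ℝ) (v : X) : |p v| ≤ N.dual p * N v := by
  have hbdd : BddAbove {r : ℝ | ∃ v : X, N v = 1 ∧ r = |p v|} := by
    refine ⟨‖p‖ * K, ?_⟩
    rintro _ ⟨v, hv, rfl⟩
    refine (p.le_opNorm v).trans ?_
    have := hN v
    rw [hv, mul_one] at this
    gcongr
  rcases (apply_nonneg N v).eq_or_lt with h | h
  · have h1 := hN v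
    rw [← h, mul_zero] at h1
    rw [norm_le_zero_iff.1 h1]
    simp
  · have h1 : |p ((N v)⁻¹ • v)| ≤ N.dual p := by
      refine le_csSup hbdd ⟨_, ?_, rfl⟩
      rw [map_smul_eq_mul, norm_inv, Real.norm_of_nonneg h.le, inv_mul_cancel₀ h.ne']
    rwa [map_smul, smul_eq_mul, abs_mul, abs_inv, abs_of_pos h, inv_mul_le_iff₀ h, mul_comm] at h1

theorem Seminorm.dual_le_add {N N' : Seminorm ℝ X} {K θ c : ℝ} (hN' : ∀ v, ‖v‖ ≤ K * N' v)
    (hθ : 0 ≤ θ) (hc : 0 ≤ c) (h : ∀ v, N' v ≤ (1 + θ) * N v) {p q : X →L[ℝ] ℝ}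
    (hpq : ∀ v, |p v| ≤ |q v| + c * N v) : N.dual p ≤ (1 + θ) * N'.dual q + c := by
  have h0 := N'.dual_nonneg q
  refine Seminorm.dual_le (by positivity) fun v => (hpq v).trans ?_
  have h1 := (Seminorm.abs_le_dual_mul hN' q v).trans (mul_le_mul_of_nonneg_left (h v) h0)
  linarith

end DualSeminorm

/-! ### Charts: extension by zero, test functions and the Finsler norm in coordinates. -/

namespace OpenPartialHomeomorph

variable {X : Type*} [NormedAddCommGroup X] {M : Type*} [TopologicalSpace M]

/-- Extension by zero of a function in a chart. -/
noncomputable def extendByZero (e : OpenPartialHomeomorph M X) (φ : X → ℝ) :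
    M → ℝ :=
  e.source.indicator (fun x => φ (e x))

theorem extendByZero_symm {e : OpenPartialHomeomorph M X} (φ : X → ℝ) {y : X}
    (hy : y ∈ e.target) : e.extendByZero φ (e.symm y) = φ y := by
  rw [extendByZero, indicator_of_mem (e.map_target hy), e.right_inv hy]

theorem extendByZero_of_notMem {e : OpenPartialHomeomorph M X} {φ : X → ℝ}
    {s : Set X} (hφ : ∀ y ∉ s, φ y = 0) {x : M} (hx : x ∉ e.symm '' s) :
    e.extendByZero φ x = 0 := by
  by_cases h : x ∈ e.source
  · rw [extendByZero, indicator_of_mem h]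
    exact hφ _ fun h' => hx ⟨_, h', e.left_inv h⟩
  · exact indicator_of_notMem h _

/-- A closed subset of a chart domain need not be closed in `M`. Regularity of `M` gives a closed
neighbourhood inside the domain, and small balls are mapped into it; this makes extension by zero
`C¹` across the chart boundary. -/
theorem exists_isClosed_image_closedBall [T2Space M] [ParacompactSpace M]
    (e : OpenPartialHomeomorph M X) {y : X} (hy : y ∈ e.target) :
    ∃ ρ > 0, Metric.closedBall y ρ ⊆ e.target ∧
      ∀ s ⊆ Metric.closedBall y ρ, IsClosed s → IsClosed (e.symm '' s) := by
  obtain ⟨V, hV, hVc, hVs⟩ := exists_mem_nhds_isClosed_subset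
    (e.open_source.mem_nhds (e.map_target hy))
  have h1 : e.target ∩ e.symm ⁻¹' V ∈ 𝓝 y :=
    inter_mem (e.open_target.mem_nhds hy) ((e.continuousAt_symm hy).preimage_mem_nhds hV)
  obtain ⟨ρ, hρ, hsub⟩ := Metric.nhds_basis_closedBall.mem_iff.1 h1
  refine ⟨ρ, hρ, fun z hz => (hsub hz).1, fun s hs hsc => ?_⟩
  have h2 : e.symm '' s = V ∩ e ⁻¹' s := by
    ext x
    constructor
    · rintro ⟨z, hz, rfl⟩
      refine ⟨(hsub (hs hz)).2, ?_⟩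
      rw [mem_preimage, e.right_inv (hsub (hs hz)).1]
      exact hz
    · rintro ⟨hx, hx'⟩
      exact ⟨_, hx', e.left_inv (hVs hx)⟩
  rw [h2]
  exact (e.continuousOn.mono hVs).preimage_isClosed_of_isClosed hVc hsc

theorem isLocalMax_symm {e : OpenPartialHomeomorph M X} {y : X}
    (hy : y ∈ e.target) {f : M → ℝ} :
    IsLocalMax f (e.symm y) ↔ IsLocalMax (fun z => f (e.symm z)) y := by
  constructor
  · intro h
    exact (e.continuousAt_symm hy).eventually h
  · intro h
    have h1 : Tendsto e (𝓝 (e.symm y)) (𝓝 y) := by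
      have := (e.continuousAt (e.map_target hy)).tendsto
      rwa [e.right_inv hy] at this
    filter_upwards [h1.eventually h, e.open_source.mem_nhds (e.map_target hy)] with x hx hxs
    rwa [e.left_inv hxs] at hx

theorem isLocalMin_symm {e : OpenPartialHomeomorph M X} {y : X}
    (hy : y ∈ e.target) {f : M → ℝ} :
    IsLocalMin f (e.symm y) ↔ IsLocalMin (fun z => f (e.symm z)) y := by
  have h := e.isLocalMax_symm hy (f := fun x => -f x)
  constructor
  · intro h1
    simpa using (h.1 h1.neg).neg
  · intro h1
    simpa using (h.2 h1.neg).neg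

end OpenPartialHomeomorph

section Charts

variable {X : Type*} [NormedAddCommGroup X] [NormedSpace ℝ X]
  {M : Type*} [TopologicalSpace M] [ChartedSpace X M]

theorem OpenPartialHomeomorph.mdifferentiable_of_mem_maximalAtlas {e : OpenPartialHomeomorph M X}
    (he : e ∈ IsManifold.maximalAtlas 𝓘(ℝ, X) 1 M) : e.MDifferentiable 𝓘(ℝ, X) 𝓘(ℝ, X) :=
  ⟨fun _ hx => (mdifferentiableAt_of_mem_maximalAtlas he hx).mdifferentiableWithinAt,
    fun _ hx => (mdifferentiableAt_symm_of_mem_maximalAtlas he hx).mdifferentiableWithinAt⟩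

theorem fderiv_comp_chart_symm {e : OpenPartialHomeomorph M X}
    (he : e ∈ IsManifold.maximalAtlas 𝓘(ℝ, X) 1 M) {y : X} (hy : y ∈ e.target) {g : M → ℝ}
    (hg : MDifferentiableAt 𝓘(ℝ, X) 𝓘(ℝ, ℝ) g (e.symm y)) (v : X) :
    fderiv ℝ (fun z => g (e.symm z)) y v =
      mvfderiv 𝓘(ℝ, X) g (e.symm y) (mfderiv 𝓘(ℝ, X) 𝓘(ℝ, X) e.symm y v) := by
  have h := mvfderiv_comp_apply y hg (mdifferentiableAt_symm_of_mem_maximalAtlas he hy) v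
  rw [← h]
  change _ = mfderiv 𝓘(ℝ, X) 𝓘(ℝ, ℝ) (g ∘ e.symm) y v
  rw [mfderiv_eq_fderiv]
  rfl

theorem OpenPartialHomeomorph.contMDiff_extendByZero {e : OpenPartialHomeomorph M X}
    (he : e ∈ IsManifold.maximalAtlas 𝓘(ℝ, X) 1 M) {s : Set X} (hs : IsClosed (e.symm '' s))
    (hst : s ⊆ e.target) {φ : X → ℝ} (hφ : ContDiff ℝ 1 φ) (hφs : ∀ y ∉ s, φ y = 0) :
    ContMDiff 𝓘(ℝ, X) 𝓘(ℝ, ℝ) 1 (e.extendByZero φ) := by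
  intro x
  by_cases hx : x ∈ e.source
  · have h1 : ContMDiffAt 𝓘(ℝ, X) 𝓘(ℝ, ℝ) 1 (φ ∘ e) x :=
      hφ.contMDiff.contMDiffAt.comp x (contMDiffAt_of_mem_maximalAtlas he hx)
    refine h1.congr_of_eventuallyEq ?_
    filter_upwards [e.open_source.mem_nhds hx] with z hz
    rw [extendByZero, indicator_of_mem hz, Function.comp_apply]
  · have hx' : x ∉ e.symm '' s := by
      rintro ⟨y, hy, rfl⟩
      exact hx (e.map_target (hst hy))
    refine (contMDiffAt_const (c := (0 : ℝ))).congr_of_eventuallyEq ?_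
    filter_upwards [hs.isOpen_compl.mem_nhds hx'] with z hz
    exact extendByZero_of_notMem hφs hz

/-- Test functions in `superdifferential` and `subdifferential` live on all of `M`. A cutoff turns a
test function in a chart into a global one with the same germ. -/
theorem HasC1LipschitzBump.exists_contMDiff_eventuallyEq [T2Space M] [ParacompactSpace M]
    (hX : HasC1LipschitzBump X) {e : OpenPartialHomeomorph M X}
    (he : e ∈ IsManifold.maximalAtlas 𝓘(ℝ, X) 1 M) {y : X} (hy : y ∈ e.target) {φ : X → ℝ}
    (hφ : ContDiff ℝ 1 φ) :
    ∃ g : M → ℝ, ContMDiff 𝓘(ℝ, X) 𝓘(ℝ, ℝ) 1 g ∧ (fun z => g (e.symm z)) =ᶠ[𝓝 y] φ := by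
  obtain ⟨b, L, hL, hb⟩ := hX.exists_normalizedBump
  obtain ⟨ρ, hρ, hρt, hcl⟩ := e.exists_isClosed_image_closedBall hy
  refine ⟨e.extendByZero fun z => b (ρ⁻¹ • (z - y)) * φ z,
    OpenPartialHomeomorph.contMDiff_extendByZero he (hcl _ Subset.rfl Metric.isClosed_closedBall)
      hρt ((hb.contDiff.comp (by fun_prop)).mul hφ) ?_, ?_⟩
  · intro z hz
    rw [mem_closedBall_iff_norm, not_le] at hz
    rw [hb.eq_zero, zero_mul]
    rw [norm_smul, norm_inv, Real.norm_of_nonneg hρ.le, inv_mul_eq_div, le_div_iff₀ hρ, one_mul]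
    exact hz.le
  · have h1 : Tendsto (fun z => ρ⁻¹ • (z - y)) (𝓝 y) (𝓝 0) := by
      have : Continuous fun z => ρ⁻¹ • (z - y) := by fun_prop
      simpa using this.tendsto y
    filter_upwards [h1.eventually hb.eventually_eq_one, e.open_target.mem_nhds hy] with z hz hzt
    rw [e.extendByZero_symm _ hzt, hz, one_mul]

end Charts

namespace FinslerStructure

variable {X : Type*} [NormedAddCommGroup X] [NormedSpace ℝ X]
  {M : Type*} [TopologicalSpace M] [ChartedSpace X M] [IsManifold 𝓘(ℝ, X) 1 M]
  (F : FinslerStructure X M)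

/-- The Finsler norm read in a chart. -/
noncomputable def chartNorm (e : OpenPartialHomeomorph M X) (y : X) : Seminorm ℝ X :=
  (F.norm (e.symm y)).comp (mfderiv 𝓘(ℝ, X) 𝓘(ℝ, X) e.symm y).toLinearMap

variable {e : OpenPartialHomeomorph M X} (he : e ∈ IsManifold.maximalAtlas 𝓘(ℝ, X) 1 M)
  {y : X} (hy : y ∈ e.target)

include he hy

theorem exists_chartNorm_equivalent : ∃ K : ℝ, 1 ≤ K ∧ ∀ v, ‖v‖ ≤ K * F.chartNorm e y v ∧
    F.chartNorm e y v ≤ K * ‖v‖ := by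
  have h : ∃ K : ℝ, 1 ≤ K ∧ ∀ v : X, K⁻¹ * ‖v‖ ≤ F.chartNorm e (e (e.symm y)) v ∧
      F.chartNorm e (e (e.symm y)) v ≤ K * ‖v‖ := F.norm_equivalent e he _ (e.map_target hy)
  rw [e.right_inv hy] at h
  obtain ⟨K, hK, h⟩ := h
  refine ⟨K, hK, fun v => ⟨?_, (h v).2⟩⟩
  rw [← inv_mul_le_iff₀ (by positivity)]
  exact (h v).1

theorem eventually_chartNorm_le {ε : ℝ} (hε : 0 < ε) : ∀ᶠ z in 𝓝 y, ∀ v,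
    F.chartNorm e y v ≤ (1 + ε) * F.chartNorm e z v ∧
      F.chartNorm e z v ≤ (1 + ε) * F.chartNorm e y v := by
  have h : ∀ᶠ x in 𝓝 (e.symm y), ∀ v : X,
      (1 + ε)⁻¹ * F.chartNorm e (e (e.symm y)) v ≤ F.chartNorm e (e x) v ∧
      F.chartNorm e (e x) v ≤ (1 + ε) * F.chartNorm e (e (e.symm y)) v :=
    F.palais e he _ (e.map_target hy) ε hε
  rw [e.right_inv hy] at h
  filter_upwards [(e.continuousAt_symm hy).eventually h, e.open_target.mem_nhds hy] with z hz hzt v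
  rw [e.right_inv hzt] at hz
  exact ⟨(inv_mul_le_iff₀ (by positivity)).1 (hz v).1, (hz v).2⟩

/-- The derivative of the inverse chart is onto and, by definition of `chartNorm`, isometric, so the
two suprema run over the same numbers. -/
theorem dualNorm_mvfderiv {g : M → ℝ} (hg : MDifferentiableAt 𝓘(ℝ, X) 𝓘(ℝ, ℝ) g (e.symm y)) :
    F.dualNorm (e.symm y) (mvfderiv 𝓘(ℝ, X) g (e.symm y)) =
      (F.chartNorm e y).dual (fderiv ℝ (fun z => g (e.symm z)) y) := by
  unfold dualNorm Seminorm.dual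
  congr 1
  ext r
  constructor
  · rintro ⟨ξ, hξ, rfl⟩
    obtain ⟨v, rfl⟩ : ∃ v : X, mfderiv 𝓘(ℝ, X) 𝓘(ℝ, X) e.symm y v = ξ :=
      (e.mdifferentiable_of_mem_maximalAtlas he).symm.mfderiv_surjective hy ξ
    exact ⟨v, hξ, congrArg abs (fderiv_comp_chart_symm he hy hg v).symm⟩
  · rintro ⟨v, hv, rfl⟩
    exact ⟨_, hv, congrArg abs (fderiv_comp_chart_symm he hy hg v)⟩

variable {F} [T2Space M] [ParacompactSpace M] {H : M × ℝ → ℝ}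

theorem _root_.IsViscositySubsolution.le_of_mem_c1Superdifferential (hX : HasC1LipschitzBump X)
    {w : M → ℝ} (hw : IsViscositySubsolution F H w) {p : X →L[ℝ] ℝ}
    (hp : p ∈ c1Superdifferential (fun z => w (e.symm z)) y) :
    w (e.symm y) + H (e.symm y, (F.chartNorm e y).dual p) ≤ 0 := by
  obtain ⟨φ, hφ, hmax, rfl⟩ := hp
  obtain ⟨g, hg, hgφ⟩ := hX.exists_contMDiff_eventuallyEq he hy hφ
  have h1 := F.dualNorm_mvfderiv he hy (hg.mdifferentiable one_ne_zero (e.symm y))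
  rw [hgφ.fderiv_eq] at h1
  rw [← h1]
  refine hw.2 _ _ ⟨g, hg, ?_, rfl⟩
  rw [OpenPartialHomeomorph.isLocalMax_symm hy]
  filter_upwards [hmax, hgφ] with z hz hgz
  rw [hgz, hgφ.eq_of_nhds]
  exact hz

theorem _root_.IsViscositySupersolution.le_of_mem_c1Subdifferential (hX : HasC1LipschitzBump X)
    {w : M → ℝ} (hw : IsViscositySupersolution F H w) {p : X →L[ℝ] ℝ}
    (hp : p ∈ c1Subdifferential (fun z => w (e.symm z)) y) :
    0 ≤ w (e.symm y) + H (e.symm y, (F.chartNorm e y).dual p) := by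
  obtain ⟨φ, hφ, hmax, rfl⟩ := hp
  obtain ⟨g, hg, hgφ⟩ := hX.exists_contMDiff_eventuallyEq he hy hφ
  have h1 := F.dualNorm_mvfderiv he hy (hg.mdifferentiable one_ne_zero (e.symm y))
  rw [hgφ.fderiv_eq] at h1
  rw [← h1]
  refine hw.2 _ _ ⟨g, hg, ?_, rfl⟩
  rw [OpenPartialHomeomorph.isLocalMin_symm hy]
  filter_upwards [hmax, hgφ] with z hz hgz
  rw [hgz, hgφ.eq_of_nhds]
  exact hz

end FinslerStructure

/-! ### Piecewise `C¹` paths and the Finsler distance. -/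

section Paths

variable {X : Type*} [NormedAddCommGroup X] [NormedSpace ℝ X]
  {M : Type*} [TopologicalSpace M] [ChartedSpace X M]

namespace IsPiecewiseC1Path

theorem exists_finset_mdifferentiableAt {γ : ℝ → M} {a b : ℝ} (h : IsPiecewiseC1Path X γ a b) :
    ∃ s : Finset ℝ, ∀ t ∈ Icc a b, t ∉ s → t ∈ Ioo a b ∧ MDifferentiableAt 𝓘(ℝ, ℝ) 𝓘(ℝ, X) γ t := by
  classical
  obtain ⟨-, s, hs⟩ := h
  -- The endpoints join the exceptional set: `mfderiv` is two-sided and sees the path outside `[a,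
  -- b]`.
  refine ⟨insert a (insert b s), fun t ht hts => ?_⟩
  simp only [Finset.mem_insert, not_or] at hts
  have hta : a < t := lt_of_le_of_ne ht.1 (Ne.symm hts.1)
  have htb : t < b := lt_of_le_of_ne ht.2 hts.2.1
  refine ⟨⟨hta, htb⟩, ?_⟩
  have h1 : (Ioo a b ∩ (s : Set ℝ)ᶜ) ∈ 𝓝 t :=
    inter_mem (Ioo_mem_nhds hta htb) (s.finite_toSet.isClosed.isOpen_compl.mem_nhds hts.2.2)
  obtain ⟨ρ, hρ, hsub⟩ := Metric.nhds_basis_closedBall.mem_iff.1 h1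
  rw [Real.closedBall_eq_Icc] at hsub
  have h2 := hs (t - ρ) (t + ρ) (hsub ⟨le_rfl, by linarith⟩).1.1.le (by linarith)
    (hsub ⟨by linarith, le_rfl⟩).1.2.le
    (Set.disjoint_left.2 fun z hz hzs => (hsub ⟨hz.1.le, hz.2.le⟩).2 hzs)
  exact (h2.contMDiffAt (Icc_mem_nhds (by linarith) (by linarith))).mdifferentiableAt one_ne_zero

theorem comp_add {γ : ℝ → M} {a b : ℝ} (h : IsPiecewiseC1Path X γ a b) (c : ℝ) :
    IsPiecewiseC1Path X (fun t => γ (t + c)) (a - c) (b - c) := by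
  classical
  obtain ⟨hc, s, hs⟩ := h
  refine ⟨hc.comp (by fun_prop) fun t ht => ⟨by linarith [ht.1], by linarith [ht.2]⟩,
    s.image fun t => t - c, fun u v hu huv hv hd => ?_⟩
  refine (hs (u + c) (v + c) (by linarith) (by linarith) (by linarith) ?_).comp
    (ContDiff.contMDiff (by fun_prop)).contMDiffOn fun t ht => ⟨by linarith [ht.1], by linarith [ht.2]⟩
  refine Set.disjoint_left.2 fun z hz hzs => disjoint_left.1 hd (?_ : z - c ∈ _) ?_
  · exact ⟨by linarith [hz.1], by linarith [hz.2]⟩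
  · exact Finset.mem_image_of_mem _ hzs

theorem comp_neg {γ : ℝ → M} {a b : ℝ} (h : IsPiecewiseC1Path X γ a b) :
    IsPiecewiseC1Path X (fun t => γ (-t)) (-b) (-a) := by
  classical
  obtain ⟨hc, s, hs⟩ := h
  refine ⟨hc.comp (by fun_prop) fun t ht => ⟨by linarith [ht.2], by linarith [ht.1]⟩,
    s.image fun t => -t, fun u v hu huv hv hd => ?_⟩
  refine (hs (-v) (-u) (by linarith) (by linarith) (by linarith) ?_).comp
    (ContDiff.contMDiff (by fun_prop)).contMDiffOn fun t ht => ⟨by linarith [ht.2], by linarith [ht.1]⟩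
  refine Set.disjoint_left.2 fun z hz hzs => disjoint_left.1 hd (?_ : -z ∈ _) ?_
  · exact ⟨by linarith [hz.2], by linarith [hz.1]⟩
  · exact Finset.mem_image_of_mem _ hzs

theorem concat {γ₁ γ₂ : ℝ → M} {a b c : ℝ} (hab : a ≤ b) (hbc : b ≤ c)
    (h₁ : IsPiecewiseC1Path X γ₁ a b) (h₂ : IsPiecewiseC1Path X γ₂ b c) (h : γ₁ b = γ₂ b) :
    IsPiecewiseC1Path X (fun t => if t ≤ b then γ₁ t else γ₂ t) a c := by
  classical
  obtain ⟨hc₁, s₁, hs₁⟩ := h₁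
  obtain ⟨hc₂, s₂, hs₂⟩ := h₂
  have e₁ : ∀ t ≤ b, (if t ≤ b then γ₁ t else γ₂ t) = γ₁ t := fun t ht => if_pos ht
  have e₂ : ∀ t, b ≤ t → (if t ≤ b then γ₁ t else γ₂ t) = γ₂ t := fun t ht => by
    split_ifs with h'
    · rw [le_antisymm h' ht, h]
    · rfl
  refine ⟨?_, insert b (s₁ ∪ s₂), fun u v hu huv hv hd => ?_⟩
  · rw [← Icc_union_Icc_eq_Icc hab hbc]
    exact (hc₁.congr fun t ht => e₁ t ht.2).union_of_isClosed (hc₂.congr fun t ht => e₂ t ht.1)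
      isClosed_Icc isClosed_Icc
  · rw [Finset.coe_insert, Finset.coe_union, Set.disjoint_insert_right, disjoint_union_right] at hd
    rcases le_or_gt v b with hvb | hvb
    · exact (hs₁ u v hu huv hvb hd.2.1).congr fun t ht => e₁ t (ht.2.trans hvb)
    · have hub : b ≤ u := by
        by_contra! h'
        exact hd.1 ⟨h', hvb⟩
      exact (hs₂ u v hub huv hv hd.2.2).congr fun t ht => e₂ t (hub.trans ht.1)

end IsPiecewiseC1Path

end Paths

namespace FinslerStructure

variable {X : Type*} [NormedAddCommGroup X] [NormedSpace ℝ X]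
  {M : Type*} [TopologicalSpace M] [ChartedSpace X M] [IsManifold 𝓘(ℝ, X) 1 M]
  (F : FinslerStructure X M)

/-- The speed `‖γ'(t)‖` of a path. -/
noncomputable def speed (γ : ℝ → M) (t : ℝ) : ℝ≥0∞ :=
  ENNReal.ofReal (F.norm (γ t) (mfderiv 𝓘(ℝ, ℝ) 𝓘(ℝ, X) γ t (1 : ℝ)))

theorem pathLength_eq_lintegral_speed (γ : ℝ → M) (a b : ℝ) :
    F.pathLength γ a b = ∫⁻ t in Icc a b, F.speed γ t := rfl

theorem speed_congr {γ γ' : ℝ → M} {t : ℝ} (h : γ =ᶠ[𝓝 t] γ') : F.speed γ t = F.speed γ' t := by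
  have h1 : ∀ x x' : M, x = x' → ∀ v : X,
      F.norm x (show TangentSpace 𝓘(ℝ, X) x from v) =
        F.norm x' (show TangentSpace 𝓘(ℝ, X) x' from v) := by
    rintro x _ rfl v
    rfl
  have h2 : (mfderiv 𝓘(ℝ, ℝ) 𝓘(ℝ, X) γ t (1 : ℝ) : X) = mfderiv 𝓘(ℝ, ℝ) 𝓘(ℝ, X) γ' t (1 : ℝ) :=
    congrArg (fun A : ℝ →L[ℝ] X => A 1) h.mfderiv_eq
  exact congrArg ENNReal.ofReal ((h1 _ _ h.eq_of_nhds _).trans (congrArg (F.norm (γ' t)) h2))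

theorem speed_comp {γ : ℝ → M} {h : ℝ → ℝ} {t σ : ℝ} (hh : HasDerivAt h σ t) (hσ : |σ| = 1)
    (hγ : MDifferentiableAt 𝓘(ℝ, ℝ) 𝓘(ℝ, X) γ (h t)) :
    F.speed (fun t => γ (h t)) t = F.speed γ (h t) := by
  have h2 : mfderiv 𝓘(ℝ, ℝ) 𝓘(ℝ, X) (fun t => γ (h t)) t =
      (mfderiv 𝓘(ℝ, ℝ) 𝓘(ℝ, X) γ (h t)).comp (ContinuousLinearMap.toSpanSingleton ℝ σ) :=
    (hγ.hasMFDerivAt.comp t hh.hasFDerivAt.hasMFDerivAt).mfderiv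
  have h3 : (mfderiv 𝓘(ℝ, ℝ) 𝓘(ℝ, X) (fun t => γ (h t)) t (1 : ℝ) : TangentSpace 𝓘(ℝ, X) (γ (h t))) =
      σ • mfderiv 𝓘(ℝ, ℝ) 𝓘(ℝ, X) γ (h t) (1 : ℝ) := by
    have h4 : mfderiv 𝓘(ℝ, ℝ) 𝓘(ℝ, X) γ (h t) (σ • (1 : ℝ)) =
      σ • mfderiv 𝓘(ℝ, ℝ) 𝓘(ℝ, X) γ (h t) (1 : ℝ) :=
      (mfderiv 𝓘(ℝ, ℝ) 𝓘(ℝ, X) γ (h t)).map_smul σ (1 : ℝ)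
    rw [← h4, h2]
    change mfderiv 𝓘(ℝ, ℝ) 𝓘(ℝ, X) γ (h t) ((1 : ℝ) • σ) = _
    rw [smul_eq_mul, smul_eq_mul, mul_comm]
  refine congrArg ENNReal.ofReal ((congrArg (F.norm (γ (h t))) h3).trans ?_)
  rw [map_smul_eq_mul, Real.norm_eq_abs, hσ, one_mul]

theorem pathLength_comp_add {γ : ℝ → M} {a b : ℝ} (h : IsPiecewiseC1Path X γ a b) (c : ℝ) :
    F.pathLength (fun t => γ (t + c)) (a - c) (b - c) = F.pathLength γ a b := by
  obtain ⟨s, hs⟩ := h.exists_finset_mdifferentiableAt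
  rw [pathLength_eq_lintegral_speed, pathLength_eq_lintegral_speed,
    ← lintegral_indicator measurableSet_Icc, ← lintegral_indicator measurableSet_Icc,
    ← lintegral_add_right_eq_self ((Icc a b).indicator (F.speed γ)) c]
  apply lintegral_congr_ae
  -- At break points the speed may take a meaningless default value, so equality is only claimed off
  -- this null set.
  filter_upwards [((s.finite_toSet.image fun t => t - c).countable.ae_notMem volume)] with t ht
  by_cases hab : t + c ∈ Icc a b
  · rw [indicator_of_mem hab, indicator_of_mem
      (show t ∈ Icc (a - c) (b - c) from ⟨by linarith [hab.1], by linarith [hab.2]⟩)]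
    exact F.speed_comp ((hasDerivAt_id t).add_const c) abs_one
      (hs _ hab fun h' => ht ⟨_, h', by simp⟩).2
  · rw [indicator_of_notMem hab, indicator_of_notMem]
    exact fun h' => hab ⟨by linarith [h'.1], by linarith [h'.2]⟩

theorem pathLength_comp_neg {γ : ℝ → M} {a b : ℝ} (h : IsPiecewiseC1Path X γ a b) :
    F.pathLength (fun t => γ (-t)) (-b) (-a) = F.pathLength γ a b := by
  obtain ⟨s, hs⟩ := h.exists_finset_mdifferentiableAt
  rw [pathLength_eq_lintegral_speed, pathLength_eq_lintegral_speed,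
    ← lintegral_indicator measurableSet_Icc, ← lintegral_indicator measurableSet_Icc,
    ← lintegral_neg_eq_self ((Icc a b).indicator (F.speed γ))]
  apply lintegral_congr_ae
  filter_upwards [((s.finite_toSet.image fun t => -t).countable.ae_notMem volume)] with t ht
  by_cases hab : -t ∈ Icc a b
  · rw [indicator_of_mem hab, indicator_of_mem
      (show t ∈ Icc (-b) (-a) from ⟨by linarith [hab.2], by linarith [hab.1]⟩)]
    exact F.speed_comp (hasDerivAt_neg t) (by simp) (hs _ hab fun h' => ht ⟨_, h', by simp⟩).2
  · rw [indicator_of_notMem hab, indicator_of_notMem]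
    exact fun h' => hab ⟨by linarith [h'.2], by linarith [h'.1]⟩

theorem pathLength_concat (γ₁ γ₂ : ℝ → M) {a b c : ℝ} (hab : a ≤ b) (hbc : b ≤ c) :
    F.pathLength (fun t => if t ≤ b then γ₁ t else γ₂ t) a c =
      F.pathLength γ₁ a b + F.pathLength γ₂ b c := by
  simp only [pathLength_eq_lintegral_speed]
  have h1 : Icc a c = Icc a b ∪ Ioc b c := (Icc_union_Ioc_eq_Icc hab hbc).symm
  have h2 : Disjoint (Icc a b) (Ioc b c) :=
    Set.disjoint_left.2 fun t h h' => absurd h'.1 (not_lt.2 h.2)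
  rw [h1, lintegral_union measurableSet_Ioc h2, ← restrict_Ioc_eq_restrict_Icc (a := b) (b := c)]
  congr 1
  · rw [← restrict_Ico_eq_restrict_Icc]
    refine setLIntegral_congr_fun measurableSet_Ico fun t ht => F.speed_congr ?_
    filter_upwards [gt_mem_nhds ht.2] with u hu using if_pos hu.le
  · refine setLIntegral_congr_fun measurableSet_Ioc fun t ht => F.speed_congr ?_
    filter_upwards [lt_mem_nhds ht.1] with u hu using if_neg (not_le.2 hu)

/-- The Finsler distance as an extended nonnegative real. -/
noncomputable def edist (F : FinslerStructure X M) (p q : M) : ℝ≥0∞ :=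
  sInf {ℓ : ℝ≥0∞ | ∃ (γ : ℝ → M) (a b : ℝ), a ≤ b ∧ IsPiecewiseC1Path X γ a b ∧
    γ a = p ∧ γ b = q ∧ ℓ = F.pathLength γ a b}

theorem edist_le_pathLength {γ : ℝ → M} {a b : ℝ} (hab : a ≤ b) (h : IsPiecewiseC1Path X γ a b) :
    F.edist (γ a) (γ b) ≤ F.pathLength γ a b :=
  sInf_le ⟨γ, a, b, hab, h, rfl, rfl, rfl⟩

theorem exists_pathLength_lt {p q : M} {r : ℝ≥0∞} (h : F.edist p q < r) :
    ∃ (γ : ℝ → M) (a b : ℝ), a ≤ b ∧ IsPiecewiseC1Path X γ a b ∧ γ a = p ∧ γ b = q ∧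
      F.pathLength γ a b < r := by
  obtain ⟨_, ⟨γ, a, b, hab, hγ, ha, hb, rfl⟩, hlt⟩ := sInf_lt_iff.1 h
  exact ⟨γ, a, b, hab, hγ, ha, hb, hlt⟩

theorem edist_self (p : M) : F.edist p p = 0 := by
  have h : IsPiecewiseC1Path X (fun _ : ℝ => p) 0 0 :=
    ⟨continuousOn_const, ∅, fun _ _ _ _ _ _ => contMDiffOn_const⟩
  have := F.edist_le_pathLength le_rfl h
  simpa [pathLength] using this

theorem edist_comm_le (p q : M) : F.edist p q ≤ F.edist q p := by
  refine le_sInf ?_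
  rintro _ ⟨γ, a, b, hab, hγ, rfl, rfl, rfl⟩
  have := F.edist_le_pathLength (neg_le_neg hab) hγ.comp_neg
  rw [F.pathLength_comp_neg hγ] at this
  simpa using this

theorem edist_comm (p q : M) : F.edist p q = F.edist q p :=
  le_antisymm (F.edist_comm_le p q) (F.edist_comm_le q p)

theorem edist_triangle (p q r : M) : F.edist p r ≤ F.edist p q + F.edist q r := by
  refine ENNReal.le_of_forall_pos_le_add fun ε hε hfin => ?_
  obtain ⟨h1, h2⟩ := ENNReal.add_lt_top.1 hfin
  have hε2 : ((ε / 2 : NNReal) : ℝ≥0∞) ≠ 0 := by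
    rw [Ne, ENNReal.coe_eq_zero]
    positivity
  obtain ⟨γ₁, a, b, hab, hγ₁, rfl, hb, hl₁⟩ :=
    F.exists_pathLength_lt (ENNReal.lt_add_right h1.ne hε2)
  obtain ⟨γ₂, c, d, hcd, hγ₂, hc, rfl, hl₂⟩ :=
    F.exists_pathLength_lt (ENNReal.lt_add_right h2.ne hε2)
  have hb' : c - (c - b) = b := by ring
  have h3 := hγ₂.comp_add (c - b)
  have h4 := F.pathLength_comp_add hγ₂ (c - b)
  rw [hb'] at h3 h4
  have hbd : b ≤ d - (c - b) := by linarith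
  have h5 := F.edist_le_pathLength (hab.trans hbd)
    (hγ₁.concat hab hbd h3 (by simp [hb, hc]))
  rw [F.pathLength_concat _ _ hab hbd, h4] at h5
  have h6 : (if d - (c - b) ≤ b then γ₁ (d - (c - b)) else γ₂ (d - (c - b) + (c - b))) = γ₂ d := by
    split_ifs with h'
    · have hdc : d = c := by linarith
      rw [hdc, hb', hb, hc]
    · simp
  rw [if_pos hab, h6] at h5
  refine (h5.trans (add_le_add hl₁.le hl₂.le)).trans (le_of_eq ?_)
  have : (ε : ℝ≥0∞) = (ε / 2 : NNReal) + (ε / 2 : NNReal) := by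
    rw [← ENNReal.coe_add, add_halves]
  rw [this]
  ring

end FinslerStructure

/-! ### Comparison of the Finsler distance with the norm of a chart. -/

namespace FinslerStructure

variable {X : Type*} [NormedAddCommGroup X] [NormedSpace ℝ X]
  {M : Type*} [TopologicalSpace M] [ChartedSpace X M] [IsManifold 𝓘(ℝ, X) 1 M]
  (F : FinslerStructure X M)

theorem speed_chart_line {e : OpenPartialHomeomorph M X}
    (he : e ∈ IsManifold.maximalAtlas 𝓘(ℝ, X) 1 M) {y v : X} {t : ℝ}
    (ht : y + t • v ∈ e.target) :
    F.speed (fun t : ℝ => e.symm (y + t • v)) t =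
      ENNReal.ofReal (F.chartNorm e (y + t • v) v) := by
  have h1 : HasFDerivAt (fun t : ℝ => y + t • v) (ContinuousLinearMap.toSpanSingleton ℝ v) t := by
    have : HasDerivAt (fun t : ℝ => y + t • v) v t := by
      simpa using ((hasDerivAt_id t).smul_const v).const_add y
    exact this.hasFDerivAt
  have h2 : mfderiv 𝓘(ℝ, ℝ) 𝓘(ℝ, X) (fun t : ℝ => e.symm (y + t • v)) t =
      (mfderiv 𝓘(ℝ, X) 𝓘(ℝ, X) e.symm (y + t • v)).comp
        (ContinuousLinearMap.toSpanSingleton ℝ v) :=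
    ((mdifferentiableAt_symm_of_mem_maximalAtlas he ht).hasMFDerivAt.comp t
      h1.hasMFDerivAt).mfderiv
  have h3 : mfderiv 𝓘(ℝ, ℝ) 𝓘(ℝ, X) (fun t : ℝ => e.symm (y + t • v)) t (1 : ℝ) =
      mfderiv 𝓘(ℝ, X) 𝓘(ℝ, X) e.symm (y + t • v) v := by
    rw [h2]
    change mfderiv 𝓘(ℝ, X) 𝓘(ℝ, X) e.symm (y + t • v) ((1 : ℝ) • v) = _
    rw [one_smul]
  exact congrArg (fun w => ENNReal.ofReal (F.norm (e.symm (y + t • v)) w)) h3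

/-- The straight segment in the chart is a competitor; (P2) with `ε = 1` bounds its speed, whence
the factor `2`. -/
theorem exists_edist_chart_le {e : OpenPartialHomeomorph M X}
    (he : e ∈ IsManifold.maximalAtlas 𝓘(ℝ, X) 1 M) {y₀ : X} (hy₀ : y₀ ∈ e.target) :
    ∃ ρ > 0, ∀ y ∈ Metric.ball y₀ ρ, ∀ z ∈ Metric.ball y₀ ρ,
      F.edist (e.symm y) (e.symm z) ≤ ENNReal.ofReal (2 * F.chartNorm e y₀ (z - y)) := by
  obtain ⟨ρ, hρ, hsub⟩ := Metric.eventually_nhds_iff_ball.1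
    ((F.eventually_chartNorm_le he hy₀ one_pos).and (e.open_target.mem_nhds hy₀))
  refine ⟨ρ, hρ, fun y hy z hz => ?_⟩
  have hmem : ∀ t ∈ Icc (0 : ℝ) 1, y + t • (z - y) ∈ Metric.ball y₀ ρ := fun t ht =>
    (convex_ball y₀ ρ).add_smul_sub_mem hy hz ht
  have hC : ContMDiffOn 𝓘(ℝ, ℝ) 𝓘(ℝ, X) 1 (fun t : ℝ => e.symm (y + t • (z - y))) (Icc 0 1) :=
    (contMDiffOn_symm_of_mem_maximalAtlas he).comp (s := Icc (0 : ℝ) 1)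
      (f := fun t : ℝ => y + t • (z - y))
      (ContDiff.contMDiff (by fun_prop)).contMDiffOn fun t ht => (hsub _ (hmem t ht)).2
  have hp : IsPiecewiseC1Path X (fun t : ℝ => e.symm (y + t • (z - y))) 0 1 :=
    ⟨hC.continuousOn, ∅, fun c d hc _ hd _ => hC.mono (Icc_subset_Icc hc hd)⟩
  have h1 := F.edist_le_pathLength zero_le_one hp
  simp only [zero_smul, add_zero, one_smul, add_sub_cancel] at h1
  refine h1.trans ?_
  rw [pathLength_eq_lintegral_speed]
  calc ∫⁻ t in Icc (0 : ℝ) 1, F.speed (fun t : ℝ => e.symm (y + t • (z - y))) t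
      ≤ ∫⁻ t in Icc (0 : ℝ) 1, ENNReal.ofReal (2 * F.chartNorm e y₀ (z - y)) := by
        refine setLIntegral_mono' measurableSet_Icc fun t ht => ?_
        rw [F.speed_chart_line he (hsub _ (hmem t ht)).2]
        apply ENNReal.ofReal_le_ofReal
        have := ((hsub _ (hmem t ht)).1 (z - y)).2
        linarith
    _ = _ := by simp

theorem eventually_edist_lt_top (p : M) : ∀ᶠ q in 𝓝 p, F.edist p q < ⊤ := by
  have hp := mem_chart_source X p
  obtain ⟨ρ, hρ, h⟩ := F.exists_edist_chart_le
    (IsManifold.chart_mem_maximalAtlas (I := 𝓘(ℝ, X)) (n := 1) p) (mem_chart_target X p)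
  have h1 := ((chartAt X p).continuousAt hp).preimage_mem_nhds (Metric.ball_mem_nhds _ hρ)
  filter_upwards [h1, (chartAt X p).open_source.mem_nhds hp] with q hq hqs
  have := h _ (Metric.mem_ball_self hρ) _ hq
  rw [(chartAt X p).left_inv hp, (chartAt X p).left_inv hqs] at this
  exact this.trans_lt ENNReal.ofReal_lt_top

theorem edist_lt_top [ConnectedSpace M] (p q : M) : F.edist p q < ⊤ := by
  have hclopen : IsClopen {q | F.edist p q < ⊤} := by
    constructor
    · rw [← isOpen_compl_iff, isOpen_iff_mem_nhds]
      intro q hq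
      filter_upwards [F.eventually_edist_lt_top q] with r hr hr'
      rw [F.edist_comm] at hr
      exact hq ((F.edist_triangle p r q).trans_lt (ENNReal.add_lt_top.2 ⟨hr', hr⟩))
    · rw [isOpen_iff_mem_nhds]
      intro q hq
      filter_upwards [F.eventually_edist_lt_top q] with r hr
      exact (F.edist_triangle p q r).trans_lt (ENNReal.add_lt_top.2 ⟨hq, hr⟩)
  have h := hclopen.eq_univ ⟨p, (F.edist_self p).trans_lt ENNReal.zero_lt_top⟩
  exact h.ge (mem_univ q)

theorem dist_nonneg (p q : M) : 0 ≤ F.dist p q := ENNReal.toReal_nonneg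

theorem dist_eq_toReal_edist (p q : M) : F.dist p q = (F.edist p q).toReal := rfl

theorem dist_self (p : M) : F.dist p p = 0 := by
  rw [dist_eq_toReal_edist, edist_self, ENNReal.toReal_zero]

theorem dist_comm (p q : M) : F.dist p q = F.dist q p := by
  rw [dist_eq_toReal_edist, edist_comm, dist_eq_toReal_edist]

theorem dist_triangle [ConnectedSpace M] (p q r : M) : F.dist p r ≤ F.dist p q + F.dist q r := by
  simp only [dist_eq_toReal_edist]
  rw [← ENNReal.toReal_add (F.edist_lt_top p q).ne (F.edist_lt_top q r).ne]
  exact ENNReal.toReal_mono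
    (ENNReal.add_lt_top.2 ⟨F.edist_lt_top p q, F.edist_lt_top q r⟩).ne (F.edist_triangle p q r)

theorem exists_dist_chart_le {e : OpenPartialHomeomorph M X}
    (he : e ∈ IsManifold.maximalAtlas 𝓘(ℝ, X) 1 M) {y₀ : X} (hy₀ : y₀ ∈ e.target) :
    ∃ ρ > 0, ∀ y ∈ Metric.ball y₀ ρ, ∀ z ∈ Metric.ball y₀ ρ,
      F.dist (e.symm y) (e.symm z) ≤ 2 * F.chartNorm e y₀ (z - y) := by
  obtain ⟨ρ, hρ, h⟩ := F.exists_edist_chart_le he hy₀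
  exact ⟨ρ, hρ, fun y hy z hz => ENNReal.toReal_le_of_le_ofReal
    (mul_nonneg zero_le_two (apply_nonneg _ _)) (h y hy z hz)⟩

variable {F} in
-- The fundamental theorem of calculus along the path, valid off finitely many break points. Finite
-- length supplies integrability of the derivative.
theorem enorm_sub_le_pathLength {f : M → ℝ} (hf : ContMDiff 𝓘(ℝ, X) 𝓘(ℝ, ℝ) 1 f) {C : ℝ}
    (hC : ∀ x ξ, |mvfderiv 𝓘(ℝ, X) f x ξ| ≤ C * F.norm x ξ) {γ : ℝ → M} {a b : ℝ} (hab : a ≤ b)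
    (hγ : IsPiecewiseC1Path X γ a b) (hfin : F.pathLength γ a b < ⊤) :
    ‖f (γ b) - f (γ a)‖ₑ ≤ ENNReal.ofReal C * F.pathLength γ a b := by
  obtain ⟨s, hs⟩ := hγ.exists_finset_mdifferentiableAt
  have hderiv : ∀ t ∈ Icc a b, t ∉ s → HasDerivAt (fun t => f (γ t))
      (mvfderiv 𝓘(ℝ, X) f (γ t) (mfderiv 𝓘(ℝ, ℝ) 𝓘(ℝ, X) γ t (1 : ℝ))) t := fun t ht hts => by
    have h1 : HasFDerivAt (E := ℝ) (F := ℝ) (fun t => f (γ t))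
        ((mvfderiv 𝓘(ℝ, X) f (γ t)).comp (mfderiv 𝓘(ℝ, ℝ) 𝓘(ℝ, X) γ t) : ℝ →L[ℝ] ℝ) t :=
      ((hf.mdifferentiable one_ne_zero (γ t)).hasMFDerivAt.comp t
        (hs t ht hts).2.hasMFDerivAt).hasFDerivAt
    exact h1.hasDerivAt
  set D : ℝ → ℝ := deriv fun t => f (γ t) with hD
  have hbound : ∫⁻ t in Icc a b, ‖D t‖ₑ ≤ ENNReal.ofReal C * F.pathLength γ a b := by
    rw [pathLength_eq_lintegral_speed, ← lintegral_const_mul' _ _ ENNReal.ofReal_ne_top]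
    refine setLIntegral_mono_ae' measurableSet_Icc ?_
    filter_upwards [s.finite_toSet.countable.ae_notMem volume] with t hts ht
    rw [hD, (hderiv t ht hts).deriv, speed, ← ENNReal.ofReal_mul' (apply_nonneg _ _),
      Real.enorm_eq_ofReal_abs]
    exact ENNReal.ofReal_le_ofReal (hC _ _)
  have hint : IntervalIntegrable D volume a b := by
    rw [intervalIntegrable_iff_integrableOn_Icc_of_le hab]
    refine ⟨(measurable_deriv _).aestronglyMeasurable, ?_⟩
    exact hbound.trans_lt (ENNReal.mul_lt_top ENNReal.ofReal_lt_top hfin)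
  have hftc := integral_eq_of_hasDerivAt_off_countable_of_le (fun t => f (γ t)) D hab
    s.finite_toSet.countable (hf.continuous.comp_continuousOn hγ.1)
    (fun t ht => by
      rw [hD]
      exact (hderiv t (Ioo_subset_Icc_self ht.1) ht.2).differentiableAt.hasDerivAt) hint
  rw [← hftc, intervalIntegral.integral_of_le hab]
  refine (enorm_integral_le_lintegral_enorm _).trans (le_trans ?_ hbound)
  exact lintegral_mono_set Ioc_subset_Icc_self

variable {F} in
theorem abs_sub_le_mul_dist [ConnectedSpace M] {f : M → ℝ}
    (hf : ContMDiff 𝓘(ℝ, X) 𝓘(ℝ, ℝ) 1 f) {C : ℝ} (hC0 : 0 ≤ C)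
    (hC : ∀ x ξ, |mvfderiv 𝓘(ℝ, X) f x ξ| ≤ C * F.norm x ξ) (p q : M) :
    |f p - f q| ≤ C * F.dist p q := by
  have key : ∀ r > F.dist p q, |f p - f q| ≤ C * r := by
    intro r hr
    have hr0 : 0 ≤ r := (F.dist_nonneg p q).trans hr.le
    have h1 : F.edist p q < ENNReal.ofReal r :=
      (ENNReal.lt_ofReal_iff_toReal_lt (F.edist_lt_top p q).ne).2 hr
    obtain ⟨γ, a, b, hab, hγ, rfl, rfl, hl⟩ := F.exists_pathLength_lt h1
    have h2 := enorm_sub_le_pathLength hf hC hab hγ (hl.trans ENNReal.ofReal_lt_top)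
    have h3 := h2.trans (mul_le_mul_right hl.le _)
    rw [← ENNReal.ofReal_mul hC0, Real.enorm_eq_ofReal_abs,
      ENNReal.ofReal_le_ofReal_iff (by positivity)] at h3
    rwa [abs_sub_comm]
  refine ge_of_tendsto (x := 𝓝[>] (F.dist p q)) (f := fun r => C * r) ?_
    (eventually_nhdsWithin_of_forall fun r hr => key r hr)
  exact ((continuous_const.mul continuous_id).tendsto _).mono_left nhdsWithin_le_nhds

end FinslerStructure

theorem HasC1LipschitzBump.exists_bump {X : Type*} [NormedAddCommGroup X] [NormedSpace ℝ X]
    (hX : HasC1LipschitzBump X) : ∃ L : ℝ, 0 ≤ L ∧ ∀ (c : X) (ρ : ℝ), 0 < ρ → ∃ β : X → ℝ,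
      ContDiff ℝ 1 β ∧ (∀ z, 0 ≤ β z ∧ β z ≤ 1) ∧ (∀ᶠ z in 𝓝 c, β z = 1) ∧
      (∀ z, ρ ≤ ‖z - c‖ → β z = 0) ∧ ∀ z, ‖fderiv ℝ β z‖ ≤ L / ρ := by
  obtain ⟨b, L, hL, hb⟩ := hX.exists_normalizedBump
  refine ⟨L, hL, fun c ρ hρ => ⟨fun z => b (ρ⁻¹ • (z - c)), hb.contDiff.comp (by fun_prop),
    fun z => ⟨hb.nonneg _, hb.le_one _⟩, ?_, fun z hz => hb.eq_zero _ ?_, fun z => ?_⟩⟩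
  · have h1 : Tendsto (fun z => ρ⁻¹ • (z - c)) (𝓝 c) (𝓝 0) := by
      have : Continuous fun z => ρ⁻¹ • (z - c) := by fun_prop
      simpa using this.tendsto c
    exact h1.eventually hb.eventually_eq_one
  · rwa [norm_smul, norm_inv, Real.norm_of_nonneg hρ.le, inv_mul_eq_div, le_div_iff₀ hρ, one_mul]
  · have h : LipschitzWith ⟨L / ρ, by positivity⟩ (fun z => b (ρ⁻¹ • (z - c))) :=
      LipschitzWith.of_dist_le_mul fun x y => by
        rw [Real.dist_eq, dist_eq_norm]
        refine (hb.lipschitz _ _).trans (le_of_eq ?_)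
        rw [← smul_sub, sub_sub_sub_cancel_right, norm_smul, norm_inv, Real.norm_of_nonneg hρ.le]
        change _ = L / ρ * _
        ring
    exact norm_fderiv_le_of_lipschitz ℝ h

namespace FinslerStructure

variable {X : Type*} [NormedAddCommGroup X] [NormedSpace ℝ X]
  {M : Type*} [TopologicalSpace M] [ChartedSpace X M] [IsManifold 𝓘(ℝ, X) 1 M]
  (F : FinslerStructure X M) {e : OpenPartialHomeomorph M X}
  (he : e ∈ IsManifold.maximalAtlas 𝓘(ℝ, X) 1 M) {y₀ : X}

include he

theorem exists_norm_le_chartNorm (hy₀ : y₀ ∈ e.target) :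
    ∃ K : ℝ, 1 ≤ K ∧ ∀ᶠ y in 𝓝 y₀, ∀ v, ‖v‖ ≤ K * F.chartNorm e y v ∧
      F.chartNorm e y v ≤ K * ‖v‖ := by
  obtain ⟨K, hK, h⟩ := F.exists_chartNorm_equivalent he hy₀
  refine ⟨2 * K, by linarith, ?_⟩
  filter_upwards [F.eventually_chartNorm_le he hy₀ one_pos] with y hy v
  have h1 := h v
  have h2 := hy v
  constructor
  · calc ‖v‖ ≤ K * F.chartNorm e y₀ v := h1.1
      _ ≤ K * ((1 + 1) * F.chartNorm e y v) := by gcongr; exact h2.1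
      _ = _ := by ring
  · calc _ ≤ (1 + 1) * F.chartNorm e y₀ v := h2.2
      _ ≤ (1 + 1) * (K * ‖v‖) := by gcongr; exact h1.2
      _ = _ := by ring

theorem abs_mvfderiv_extendByZero_le {s : Set X} (hs : IsClosed (e.symm '' s)) (hst : s ⊆ e.target)
    {φ : X → ℝ} (hφ : ContDiff ℝ 1 φ) (hφs : ∀ y ∉ s, φ y = 0) {C K : ℝ} (hC0 : 0 ≤ C)
    (hK0 : 0 ≤ K)
    (hC : ∀ y ∈ s, ‖fderiv ℝ φ y‖ ≤ C) (hK : ∀ y ∈ s, ∀ v, ‖v‖ ≤ K * F.chartNorm e y v)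
    (x : M) (ξ : TangentSpace 𝓘(ℝ, X) x) :
    |mvfderiv 𝓘(ℝ, X) (e.extendByZero φ) x ξ| ≤ C * K * F.norm x ξ := by
  have hg := e.contMDiff_extendByZero he hs hst hφ hφs
  by_cases hx : x ∈ e.symm '' s
  · obtain ⟨y, hy, rfl⟩ := hx
    obtain ⟨v, rfl⟩ : ∃ v : X, mfderiv 𝓘(ℝ, X) 𝓘(ℝ, X) e.symm y v = ξ :=
      (e.mdifferentiable_of_mem_maximalAtlas he).symm.mfderiv_surjective (hst hy) ξ
    have h1 := fderiv_comp_chart_symm he (hst hy) (hg.mdifferentiable one_ne_zero _) v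
    have h2 : (fun z => e.extendByZero φ (e.symm z)) =ᶠ[𝓝 y] φ := by
      filter_upwards [e.open_target.mem_nhds (hst hy)] with z hz using e.extendByZero_symm φ hz
    rw [h2.fderiv_eq] at h1
    have h3 : |fderiv ℝ φ y v| ≤ C * K * F.chartNorm e y v := by
      calc |fderiv ℝ φ y v| ≤ ‖fderiv ℝ φ y‖ * ‖v‖ := (fderiv ℝ φ y).le_opNorm v
        _ ≤ C * (K * F.chartNorm e y v) := by
          gcongr
          · exact hC y hy
          · exact hK y hy v
        _ = _ := by ring
    rw [h1] at h3
    exact h3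
  · have h1 : HasMFDerivAt 𝓘(ℝ, X) 𝓘(ℝ, ℝ) (e.extendByZero φ) x
        (0 : TangentSpace 𝓘(ℝ, X) x →L[ℝ] ℝ) := by
      refine (hasMFDerivAt_const (0 : ℝ) x).congr_of_eventuallyEq ?_
      filter_upwards [hs.isOpen_compl.mem_nhds hx] with z hz
      exact e.extendByZero_of_notMem hφs hz
    have h2 : mvfderiv 𝓘(ℝ, X) (e.extendByZero φ) x = 0 := h1.mfderiv
    rw [h2]
    simp only [zero_apply, abs_zero]
    have := apply_nonneg (F.norm x) ξ
    positivity

variable [T2Space M] [ParacompactSpace M] [ConnectedSpace M] (hX : HasC1LipschitzBump X)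

include hX

/-- Paths that leave the chart need no separate treatment: a linear form norming `y - z`, cut off by
a bump, is a globally Lipschitz function on `M` that separates the two points by `‖y - z‖`. The bump
has derivative at most `L / ρ` and the form is at most `ρ` on the ball, so the derivative of the
product is at most `1 + L`, uniformly in the form. -/
theorem exists_norm_sub_le_mul_dist (hy₀ : y₀ ∈ e.target) :
    ∃ ρ > 0, ∃ K : ℝ, 0 ≤ K ∧ ∀ y ∈ Metric.ball y₀ ρ, ∀ z ∈ Metric.ball y₀ ρ,
      ‖y - z‖ ≤ K * F.dist (e.symm y) (e.symm z) := by
  obtain ⟨K, hK1, hK⟩ := F.exists_norm_le_chartNorm he hy₀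
  obtain ⟨ρ₁, hρ₁, hρ₁K⟩ := Metric.nhds_basis_closedBall.eventually_iff.1 hK
  obtain ⟨ρ₂, hρ₂, hρ₂t, hcl⟩ := e.exists_isClosed_image_closedBall hy₀
  obtain ⟨L, hL, hbump⟩ := hX.exists_bump
  set ρ := min ρ₁ ρ₂
  have hρ : 0 < ρ := lt_min hρ₁ hρ₂
  have hsub₂ : Metric.closedBall y₀ ρ ⊆ Metric.closedBall y₀ ρ₂ :=
    Metric.closedBall_subset_closedBall (min_le_right _ _)
  have hsub₁ : Metric.closedBall y₀ ρ ⊆ Metric.closedBall y₀ ρ₁ :=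
    Metric.closedBall_subset_closedBall (min_le_left _ _)
  obtain ⟨β, hβC, hβ, hβ1, hβ0, hβd⟩ := hbump y₀ ρ hρ
  obtain ⟨τ, hτ, hτβ⟩ := Metric.eventually_nhds_iff_ball.1
    (hβ1.and (e.open_target.mem_nhds hy₀))
  refine ⟨τ, hτ, (1 + L) * K, by positivity, fun y hy z hz => ?_⟩
  obtain ⟨ℓ, hℓ, hℓyz⟩ := exists_dual_vector'' ℝ (y - z)
  have hφC : ContDiff ℝ 1 fun w => β w * ℓ (w - y₀) := hβC.mul (ℓ.contDiff.comp (by fun_prop))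
  have hφ0 : ∀ w ∉ Metric.closedBall y₀ ρ, β w * ℓ (w - y₀) = 0 := fun w hw => by
    rw [mem_closedBall_iff_norm, not_le] at hw
    rw [hβ0 w hw.le, zero_mul]
  have hφd : ∀ w ∈ Metric.closedBall y₀ ρ, ‖fderiv ℝ (fun w => β w * ℓ (w - y₀)) w‖ ≤ 1 + L := by
    intro w hw
    rw [mem_closedBall_iff_norm] at hw
    have h1 : HasFDerivAt (fun w => β w * ℓ (w - y₀)) (β w • ℓ + ℓ (w - y₀) • fderiv ℝ β w) w :=
      ((hβC.differentiable one_ne_zero w).hasFDerivAt).mul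
        (ℓ.hasFDerivAt.comp w ((hasFDerivAt_id w).sub_const y₀))
    rw [h1.fderiv]
    refine (norm_add_le _ _).trans ?_
    rw [norm_smul, norm_smul, Real.norm_of_nonneg (hβ w).1]
    have h2 : ‖ℓ (w - y₀)‖ ≤ 1 * ρ := (ℓ.le_opNorm _).trans (by gcongr)
    calc β w * ‖ℓ‖ + ‖ℓ (w - y₀)‖ * ‖fderiv ℝ β w‖ ≤ 1 * 1 + 1 * ρ * (L / ρ) := by
          gcongr
          · exact (hβ w).2
          · exact hβd w
      _ = 1 + L := by field_simp
  have h1 := abs_sub_le_mul_dist (F := F)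
    (e.contMDiff_extendByZero he (hcl _ hsub₂ Metric.isClosed_closedBall) (hsub₂.trans hρ₂t)
      hφC hφ0) (C := (1 + L) * K) (by positivity)
    (F.abs_mvfderiv_extendByZero_le he (hcl _ hsub₂ Metric.isClosed_closedBall)
      (hsub₂.trans hρ₂t) hφC hφ0 (by positivity) (by positivity) hφd
      fun w hw v => (hρ₁K (hsub₁ hw) v).1) (e.symm y) (e.symm z)
  rw [e.extendByZero_symm _ (hτβ y hy).2, e.extendByZero_symm _ (hτβ z hz).2, (hτβ y hy).1,
    (hτβ z hz).1, one_mul, one_mul, ← map_sub, sub_sub_sub_cancel_right, hℓyz] at h1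
  simpa using h1

omit he

/-- A bump supported in a given neighbourhood is Lipschitz for `d` and equals `1` at `x`; points
close to `x` for `d` must lie where it is nonzero. Semicontinuity in the topology of `M` thus
becomes usable in Ekeland's principle for `d`. -/
theorem tendsto_of_tendsto_dist {ι : Type*} {l : Filter ι} {s : ι → M} {x : M}
    (h : Tendsto (fun i => F.dist (s i) x) l (𝓝 0)) : Tendsto s l (𝓝 x) := by
  set e := chartAt X x
  have he : e ∈ IsManifold.maximalAtlas 𝓘(ℝ, X) 1 M := IsManifold.chart_mem_maximalAtlas x
  have hx : x ∈ e.source := mem_chart_source X x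
  have hy₀ : e x ∈ e.target := mem_chart_target X x
  obtain ⟨K, hK1, hK⟩ := F.exists_norm_le_chartNorm he hy₀
  obtain ⟨ρ₁, hρ₁, hρ₁K⟩ := Metric.nhds_basis_closedBall.eventually_iff.1 hK
  obtain ⟨ρ₂, hρ₂, hρ₂t, hcl⟩ := e.exists_isClosed_image_closedBall hy₀
  obtain ⟨L, hL, hbump⟩ := hX.exists_bump
  intro U hU
  have hU' : e.symm ⁻¹' U ∈ 𝓝 (e x) :=
    (e.continuousAt_symm hy₀).preimage_mem_nhds (by rwa [e.left_inv hx])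
  obtain ⟨ρ₃, hρ₃, hρ₃U⟩ := Metric.nhds_basis_closedBall.mem_iff.1 hU'
  set ρ := min ρ₁ (min ρ₂ ρ₃)
  have hρ : 0 < ρ := lt_min hρ₁ (lt_min hρ₂ hρ₃)
  have hsub₁ : Metric.closedBall (e x) ρ ⊆ Metric.closedBall (e x) ρ₁ :=
    Metric.closedBall_subset_closedBall (min_le_left _ _)
  have hsub₂ : Metric.closedBall (e x) ρ ⊆ Metric.closedBall (e x) ρ₂ :=
    Metric.closedBall_subset_closedBall ((min_le_right _ _).trans (min_le_left _ _))
  have hsub₃ : Metric.closedBall (e x) ρ ⊆ Metric.closedBall (e x) ρ₃ :=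
    Metric.closedBall_subset_closedBall ((min_le_right _ _).trans (min_le_right _ _))
  obtain ⟨β, hβC, hβ, hβ1, hβ0, hβd⟩ := hbump (e x) ρ hρ
  have hβ0' : ∀ w ∉ Metric.closedBall (e x) ρ, β w = 0 := fun w hw => by
    rw [mem_closedBall_iff_norm, not_le] at hw
    exact hβ0 w hw.le
  have hlip := abs_sub_le_mul_dist (F := F)
    (e.contMDiff_extendByZero he (hcl _ hsub₂ Metric.isClosed_closedBall) (hsub₂.trans hρ₂t)
      hβC hβ0') (C := L / ρ * K) (by positivity)
    (F.abs_mvfderiv_extendByZero_le he (hcl _ hsub₂ Metric.isClosed_closedBall)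
      (hsub₂.trans hρ₂t) hβC hβ0' (by positivity) (by positivity) (fun w _ => hβd w)
      fun w hw v => (hρ₁K (hsub₁ hw) v).1)
  have h1 : Tendsto (fun i => L / ρ * K * F.dist (s i) x) l (𝓝 (L / ρ * K * 0)) := h.const_mul _
  rw [mul_zero] at h1
  change ∀ᶠ i in l, s i ∈ U
  filter_upwards [h1.eventually_lt_const one_pos] with i hi
  by_contra hiU
  have h2 := hlip (s i) x
  have h3 : e.extendByZero β x = 1 := by
    have := e.extendByZero_symm β hy₀
    rwa [e.left_inv hx, hβ1.self_of_nhds] at this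
  rw [h3, e.extendByZero_of_notMem hβ0'] at h2
  · norm_num at h2
    linarith
  · rintro ⟨w, hw, hws⟩
    exact hiU (hws ▸ hρ₃U (hsub₃ hw))

end FinslerStructure

/-! ### Ekeland's variational principle. -/

/-- A weak form of Ekeland's variational principle, for a distance function which is not registered
as a metric space structure. -/
theorem exists_le_add_mul_of_complete {M : Type*} {d : M → M → ℝ} (hself : ∀ x, d x x = 0)
    (hcomm : ∀ x y, d x y = d y x) (htri : ∀ x y z, d x z ≤ d x y + d y z)
    (hnonneg : ∀ x y, 0 ≤ d x y)
    (hcomplete : ∀ s : ℕ → M, (∀ ε > 0, ∃ N, ∀ m ≥ N, ∀ n ≥ N, d (s m) (s n) < ε) →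
      ∃ x, Tendsto (fun n => d (s n) x) atTop (𝓝 0))
    {f : M → ℝ} {c : ℝ} (hc : ∀ x, c ≤ f x)
    (hlsc : ∀ (s : ℕ → M) (x : M), Tendsto (fun n => d (s n) x) atTop (𝓝 0) →
      ∀ r < f x, ∀ᶠ n in atTop, r < f (s n)) {ε : ℝ} (hε : 0 < ε) (z : M) :
    ∃ x, f x ≤ f z ∧ ∀ y, f x ≤ f y + ε * d y x := by
  -- Each new point almost minimizes `f` on the cone of points that improve on `x` at rate `ε`;
  -- these cones are nested along the sequence.
  have hnext : ∀ (x : M) (η : ℝ), ∃ y, f y + ε * d y x ≤ f x ∧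
      (0 < η → ∀ y', f y' + ε * d y' x ≤ f x → f y ≤ f y' + η) := by
    intro x η
    by_cases hη : 0 < η
    · have hne : (f '' {y | f y + ε * d y x ≤ f x}).Nonempty :=
        ⟨_, x, by simp [hself], rfl⟩
      have hbd : BddBelow (f '' {y | f y + ε * d y x ≤ f x}) :=
        ⟨c, by rintro _ ⟨y, -, rfl⟩; exact hc y⟩
      obtain ⟨_, ⟨y, hy, rfl⟩, hlt⟩ := exists_lt_of_csInf_lt hne
        (lt_add_of_pos_right _ hη)
      refine ⟨y, hy, fun _ y' hy' => ?_⟩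
      linarith [csInf_le hbd ⟨y', hy', rfl⟩]
    · exact ⟨x, by simp [hself], fun h => absurd h hη⟩
  choose next hnext1 hnext2 using hnext
  let s : ℕ → M := fun n => Nat.rec z (fun n x => next x ((1 / 2) ^ n)) n
  have hs1 : ∀ n, f (s (n + 1)) + ε * d (s (n + 1)) (s n) ≤ f (s n) := fun n => hnext1 _ _
  have hs2 : ∀ n y, f y + ε * d y (s n) ≤ f (s n) → f (s (n + 1)) ≤ f y + (1 / 2) ^ n :=
    fun n y => hnext2 (s n) ((1 / 2) ^ n) (by positivity) y
  have hanti : Antitone fun n => f (s n) := antitone_nat_of_succ_le fun n => by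
    have := mul_nonneg hε.le (hnonneg (s (n + 1)) (s n))
    linarith [hs1 n]
  have hmn : ∀ n k, f (s (n + k)) + ε * d (s (n + k)) (s n) ≤ f (s n) := by
    intro n k
    induction k with
    | zero => simp [hself]
    | succ k ih =>
      have h1 := hs1 (n + k)
      have h2 := mul_le_mul_of_nonneg_left (htri (s (n + k + 1)) (s (n + k)) (s n)) hε.le
      rw [← add_assoc]
      linarith
  have hmn' : ∀ m n, n ≤ m → f (s m) + ε * d (s m) (s n) ≤ f (s n) := fun m n h => by
    obtain ⟨k, rfl⟩ := Nat.exists_eq_add_of_le h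
    exact hmn n k
  have hconv := tendsto_atTop_ciInf hanti ⟨c, by rintro _ ⟨n, rfl⟩; exact hc _⟩
  obtain ⟨x, hx⟩ := hcomplete s fun η hη => by
    obtain ⟨N, hN⟩ := Metric.cauchySeq_iff.1 hconv.cauchySeq (ε * η) (by positivity)
    refine ⟨N, fun m hm n hn => ?_⟩
    rcases le_total n m with h | h
    · have h1 := hN n hn m hm
      rw [Real.dist_eq] at h1
      have h2 : ε * d (s m) (s n) < ε * η := by
        linarith [hmn' m n h, le_abs_self (f (s n) - f (s m))]
      exact lt_of_mul_lt_mul_left h2 hε.le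
    · have h1 := hN m hm n hn
      rw [Real.dist_eq] at h1
      have h2 : ε * d (s m) (s n) < ε * η := by
        rw [hcomm]
        linarith [hmn' n m h, le_abs_self (f (s m) - f (s n))]
      exact lt_of_mul_lt_mul_left h2 hε.le
  have hlim : ∀ n, f x + ε * d x (s n) ≤ f (s n) := by
    intro n
    by_contra! h
    set η := (f x + ε * d x (s n) - f (s n)) / 2 with hη
    have h1 : Tendsto (fun m => ε * d (s m) x) atTop (𝓝 (ε * 0)) := hx.const_mul ε
    rw [mul_zero] at h1
    obtain ⟨m, ⟨hm1, hm2⟩, hm3⟩ := (((hlsc s x hx (f x - η) (by linarith)).and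
      (h1.eventually_lt_const (show 0 < η by linarith))).and (eventually_ge_atTop n)).exists
    have h2 := mul_le_mul_of_nonneg_left (htri x (s m) (s n)) hε.le
    rw [hcomm x (s m)] at h2
    linarith [hmn' m n hm3]
  refine ⟨x, ?_, fun y => ?_⟩
  · have h1 : f x + ε * d x z ≤ f z := hlim 0
    linarith [mul_nonneg hε.le (hnonneg x z)]
  -- A point `y` violating the claim lies in the cone of every `s n`, so `f (s (n + 1))` is at most
  -- `f y` up to `2⁻ⁿ`. In the limit `f x ≤ f y`, contrary to the violation.
  · by_contra! h
    have hy : ∀ n, f x ≤ f y + (1 / 2) ^ n := fun n => by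
      have h1 := mul_le_mul_of_nonneg_left (htri y x (s n)) hε.le
      have h2 := hs2 n y (by linarith [hlim n])
      linarith [hlim (n + 1), mul_nonneg hε.le (hnonneg x (s (n + 1)))]
    have h3 : Tendsto (fun n : ℕ => f y + (1 / 2 : ℝ) ^ n) atTop (𝓝 (f y + 0)) :=
      (tendsto_pow_atTop_nhds_zero_of_lt_one (by norm_num) (by norm_num)).const_add _
    have h4 := ge_of_tendsto' h3 hy
    linarith [mul_nonneg hε.le (hnonneg y x)]

/-! ### The comparison principle. -/

namespace FinslerStructure

variable {X : Type*} [NormedAddCommGroup X] [NormedSpace ℝ X]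
  {M : Type*} [TopologicalSpace M] [ChartedSpace X M] [IsManifold 𝓘(ℝ, X) 1 M]
  (F : FinslerStructure X M)

/-- A modulus of continuity for the Hamiltonian which is uniform on `M`, and uniform in the second
variable on bounded sets. -/
def HasHamiltonianModulus (H : M × ℝ → ℝ) : Prop :=
  ∀ ε : ℝ, 0 < ε → ∃ δ : ℝ, 0 < δ ∧ ∀ R : ℝ, ∃ ρ : ℝ, 0 < ρ ∧ ∀ (x₁ x₂ : M) (t₁ t₂ : ℝ),
    F.dist x₁ x₂ < ρ → |t₁| ≤ R → |t₂| ≤ R → |t₁ - t₂| < δ → |H (x₁, t₁) - H (x₂, t₂)| < ε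

variable {F}

theorem _root_.IsUniformlyContinuousHamiltonian.hasHamiltonianModulus {H : M × ℝ → ℝ}
    (h : IsUniformlyContinuousHamiltonian F H) : F.HasHamiltonianModulus H := by
  intro ε hε
  obtain ⟨δ, hδ, h⟩ := h ε hε
  exact ⟨δ, hδ, fun _ => ⟨δ, hδ, fun x₁ x₂ t₁ t₂ h1 _ _ h2 => h x₁ x₂ t₁ t₂ h1 h2⟩⟩

/-- Continuity of `ω` at the origin fixes `δ` independently of `R`. The term growing with the `tᵢ`
is at most `C * R * d`, and only `ρ` has to shrink with `R`. -/
theorem _root_.ConditionA.hasHamiltonianModulus {H : M × ℝ → ℝ}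
    (h : ConditionA F H) : F.HasHamiltonianModulus H := by
  obtain ⟨C, ω, hC, hω, hω0, h⟩ := h
  intro ε hε
  obtain ⟨δ, hδ, hδω⟩ := Metric.continuousAt_iff.1 hω.continuousAt (ε / 2) (half_pos hε)
  rw [hω0] at hδω
  refine ⟨δ, hδ, fun R => ⟨min δ (ε / 2 / (C * |R| + 1)), by positivity,
    fun x₁ x₂ t₁ t₂ hd h1 h2 ht => ?_⟩⟩
  have hd0 := F.dist_nonneg x₁ x₂
  have h3 : ω (F.dist x₁ x₂, t₁ - t₂) < ε / 2 := by
    have : Dist.dist (F.dist x₁ x₂, t₁ - t₂) ((0 : ℝ), (0 : ℝ)) < δ := by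
      rw [Prod.dist_eq, max_lt_iff, Real.dist_eq, Real.dist_eq, sub_zero, sub_zero,
        abs_of_nonneg hd0]
      exact ⟨hd.trans_le (min_le_left _ _), ht⟩
    have := hδω this
    rw [Real.dist_eq, sub_zero] at this
    exact (le_abs_self _).trans_lt this
  have h4 : C * max |t₁| |t₂| * F.dist x₁ x₂ ≤ ε / 2 := by
    calc C * max |t₁| |t₂| * F.dist x₁ x₂
        ≤ (C * |R| + 1) * (ε / 2 / (C * |R| + 1)) := by
          have h5 : max |t₁| |t₂| ≤ |R| := (max_le h1 h2).trans (le_abs_self R)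
          have h6 : C * max |t₁| |t₂| ≤ C * |R| := by gcongr
          exact mul_le_mul (by linarith) (hd.le.trans (min_le_right _ _)) hd0 (by positivity)
      _ = ε / 2 := by field_simp
  linarith [h x₁ x₂ t₁ t₂]

/-- Both base points are compared with `y₀` through (P2), at the cost of a factor `(1 + θ)² ≤ 1 +
3θ`; the bound `R` turns this relative error into an absolute one. -/
theorem dual_chartNorm_le_of_mem {e : OpenPartialHomeomorph M X} {x y y₀ : X} {K θ κ ε δ R : ℝ}
    (hθ : 0 ≤ θ) (hθ1 : θ ≤ 1) (hκ : 0 ≤ κ) (hε : 0 ≤ ε)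
    (hK : ∀ v, ‖v‖ ≤ K * F.chartNorm e x v) (hK' : ∀ v, ‖v‖ ≤ K * F.chartNorm e y v)
    (hK0 : 0 ≤ K)
    (hx : ∀ v, F.chartNorm e y₀ v ≤ (1 + θ) * F.chartNorm e x v)
    (hy : ∀ v, F.chartNorm e y v ≤ (1 + θ) * F.chartNorm e y₀ v)
    {p q : X →L[ℝ] ℝ} (hpq : ∀ v, |p v| ≤ |q v| + (κ * F.chartNorm e y₀ v + ε * ‖v‖))
    (hR : (F.chartNorm e y).dual q ≤ R) (hδ : 3 * θ * R + (2 * κ + ε * K) ≤ δ) :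
    (F.chartNorm e x).dual p ≤ (F.chartNorm e y).dual q + δ := by
  have h1 : ∀ v, |p v| ≤ |q v| + (2 * κ + ε * K) * F.chartNorm e x v := fun v => by
    refine (hpq v).trans ?_
    have h2 : κ * F.chartNorm e y₀ v ≤ κ * (2 * F.chartNorm e x v) := by
      gcongr
      refine (hx v).trans ?_
      gcongr
      linarith
    have h3 : ε * ‖v‖ ≤ ε * (K * F.chartNorm e x v) := by gcongr; exact hK v
    linarith
  have h2 : ∀ v, F.chartNorm e y v ≤ (1 + 3 * θ) * F.chartNorm e x v := fun v => by
    have h0 := apply_nonneg (F.chartNorm e x) v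
    calc F.chartNorm e y v ≤ (1 + θ) * ((1 + θ) * F.chartNorm e x v) :=
          (hy v).trans (by gcongr; exact hx v)
      _ = ((1 + θ) * (1 + θ)) * F.chartNorm e x v := by ring
      _ ≤ _ := by gcongr; nlinarith
  have h3 := Seminorm.dual_le_add hK' (by positivity) (by positivity) h2 h1
  have h4 : 3 * θ * (F.chartNorm e y).dual q ≤ 3 * θ * R := by gcongr
  linarith

variable (X) in
/-- `u` is locally Lipschitz in the charts of `M`. -/
def _root_.LipschitzInCharts (u : M → ℝ) : Prop :=
  ∀ e ∈ IsManifold.maximalAtlas 𝓘(ℝ, X) 1 M, ∀ y₀ ∈ e.target, ∃ ρ > 0, ∃ L : ℝ, 0 ≤ L ∧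
    ∀ y ∈ Metric.ball y₀ ρ, ∀ z ∈ Metric.ball y₀ ρ, |u (e.symm y) - u (e.symm z)| ≤ L * ‖y - z‖

/-- The Lipschitz bound on `u` keeps the differentials bounded, and only on bounded sets is the
modulus of `H` uniform. No regularity of `v` beyond semicontinuity is needed. -/
theorem le_of_isViscositySubsolution_of_isViscositySupersolution [CompleteSpace X] [T2Space M]
    [ParacompactSpace M] [ConnectedSpace M] (hX : HasC1LipschitzBump X) (hF : F.IsComplete)
    {H : M × ℝ → ℝ} (hH : F.HasHamiltonianModulus H) {u v : M → ℝ}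
    (hu : IsViscositySubsolution F H u) (hv : IsViscositySupersolution F H v)
    {B : ℝ} (hub : ∀ x, |u x| ≤ B) (hvb : ∀ x, |v x| ≤ B) (hlip : LipschitzInCharts X u) (z₀ : M) :
    u z₀ ≤ v z₀ := by
  by_contra! hlt
  set m := u z₀ - v z₀ with hm
  have hm0 : 0 < m := sub_pos.2 hlt
  obtain ⟨δ, hδ, hδH⟩ := hH (m / 4) (by positivity)
  -- The slope `κ` is fixed before Ekeland's principle selects `x₀`, while the bound `R` depends on
  -- the chart at `x₀`. This is why `δ` precedes `R` in `HasHamiltonianModulus`. With `κ = δ / 24`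
  -- the three errors below are `δ / 4`, `6 * κ = δ / 4` and `δ / 8`, in total `5 * δ / 8`.
  obtain ⟨κ, hκ⟩ : ∃ κ, κ = δ / 24 := ⟨_, rfl⟩
  have hκ0 : 0 < κ := by rw [hκ]; positivity
  have hlsc : LowerSemicontinuous fun x => v x + -u x := hv.1.add fun x c hc =>
    (hu.1 x (-c) (by linarith)).mono fun y hy => by linarith
  obtain ⟨x₀, hx₀z, hx₀⟩ := exists_le_add_mul_of_complete F.dist_self F.dist_comm F.dist_triangle
    F.dist_nonneg hF (f := fun x => v x + -u x) (c := -(2 * B))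
    (fun x => by linarith [abs_le.1 (hub x), abs_le.1 (hvb x)])
    (fun s x hs r hr => (F.tendsto_of_tendsto_dist hX hs).eventually (hlsc x r hr)) hκ0 z₀
  set e := chartAt X x₀
  have he : e ∈ IsManifold.maximalAtlas 𝓘(ℝ, X) 1 M := IsManifold.chart_mem_maximalAtlas x₀
  have hxs : x₀ ∈ e.source := mem_chart_source X x₀
  set y₀ := e x₀ with hy₀def
  have hy₀ : y₀ ∈ e.target := mem_chart_target X x₀
  have hey₀ : e.symm y₀ = x₀ := e.left_inv hxs
  obtain ⟨ρ₁, hρ₁, L, hL0, hL⟩ := hlip e he y₀ hy₀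
  obtain ⟨ρ₂, hρ₂, hd⟩ := F.exists_dist_chart_le he hy₀
  obtain ⟨K, hK1, hK⟩ := F.exists_norm_le_chartNorm he hy₀
  have hK0 : 0 < K := by linarith
  set R := 2 * (L * K) + δ with hR
  have hR0 : 0 < R := by positivity
  obtain ⟨θ, hθ, hθ1, hθR⟩ : ∃ θ : ℝ, 0 < θ ∧ θ ≤ 1 / 3 ∧ 3 * θ * R ≤ δ / 4 := by
    refine ⟨min (1 / 3) (δ / 4 / (3 * R)), by positivity, min_le_left _ _, ?_⟩
    calc 3 * min (1 / 3) (δ / 4 / (3 * R)) * R ≤ 3 * (δ / 4 / (3 * R)) * R := by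
          gcongr; exact min_le_right _ _
      _ = δ / 4 := by field_simp
  obtain ⟨ρH, hρH, hHρ⟩ := hδH R
  obtain ⟨ρ₃, hρ₃, hball⟩ := Metric.eventually_nhds_iff_ball.1
    ((hK.and (F.eventually_chartNorm_le he hy₀ hθ)).and (e.open_target.mem_nhds hy₀))
  obtain ⟨r, hr, hr1, hr2, hr3⟩ : ∃ r : ℝ, 0 < r ∧ r < ρ₁ ∧ r < ρ₂ ∧ r < ρ₃ := by
    refine ⟨min ρ₁ (min ρ₂ ρ₃) / 2, by positivity, ?_, ?_, ?_⟩
    all_goals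
      have h1 := min_le_left ρ₁ (min ρ₂ ρ₃)
      have h2 := (min_le_right ρ₁ (min ρ₂ ρ₃)).trans (min_le_left ρ₂ ρ₃)
      have h3 := (min_le_right ρ₁ (min ρ₂ ρ₃)).trans (min_le_right ρ₂ ρ₃)
      have h4 : 0 < min ρ₁ (min ρ₂ ρ₃) := by positivity
      linarith
  have hs1 := Metric.closedBall_subset_ball (x := y₀) hr1
  have hs2 := Metric.closedBall_subset_ball (x := y₀) hr2
  have hs3 := Metric.closedBall_subset_ball (x := y₀) hr3
  have hy₀r : y₀ ∈ Metric.closedBall y₀ r := Metric.mem_closedBall_self hr.le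
  have hN0 : ∀ v, ‖v‖ ≤ K * F.chartNorm e y₀ v ∧ F.chartNorm e y₀ v ≤ K * ‖v‖ :=
    (hball y₀ (hs3 hy₀r)).1.1
  obtain ⟨ε, hε, hε1, hε2, hε3⟩ : ∃ ε : ℝ, 0 < ε ∧ ε * K ≤ δ / 8 ∧ 2 * (K * ε) ≤ ρH ∧
      ε ≤ m / 4 := by
    refine ⟨min (m / 4) (min (δ / 8 / K) (ρH / (2 * K))), by positivity, ?_, ?_, min_le_left _ _⟩
    · rw [← le_div_iff₀ hK0]
      exact (min_le_right _ _).trans (min_le_left _ _)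
    · rw [← mul_assoc, ← le_div_iff₀' (by positivity)]
      exact (min_le_right _ _).trans (min_le_right _ _)
  have hfusc : UpperSemicontinuousOn (fun y => -v (e.symm y)) (Metric.closedBall y₀ r) := by
    intro y hy c hc
    have h1 := hv.1 (e.symm y) (-c) (by linarith)
    have h2 := (e.continuousAt_symm (hball y (hs3 hy)).2).eventually h1
    exact (h2.mono fun z hz => by linarith).filter_mono nhdsWithin_le_nhds
  -- In the penalty `3 * κ * N (y - y₀)`, the part `2 * κ * N` absorbs Ekeland's term, since `d ≤ 2
  -- * N` near `x₀`. The remaining `κ * N` is at least `κ * r / (2 * K)` once `‖y - y₀‖ ≥ r / 2`,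
  -- which is the gap.
  obtain ⟨x, y, z, hx, hxy, -, hy, -, ⟨p, hp, q, hq, s, hs, hpqs⟩, hval⟩ :=
    hX.exists_fuzzy_sum (c := y₀) (a := y₀) (r := r) (r' := r / 2) (η := κ * (r / (2 * K)))
      (f := fun y => -v (e.symm y)) (g := fun y => -u (e.symm y))
      (k := fun y => 3 * κ * F.chartNorm e y₀ (y - y₀)) (Lg := L) (Lk := 3 * κ * K)
      (by linarith) (by positivity) hy₀r hfusc
      ⟨B, by rintro _ ⟨y, -, rfl⟩; linarith [abs_le.1 (hvb (e.symm y))]⟩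
      (fun y hy z hz => by
        rw [neg_sub_neg, abs_sub_comm]
        exact hL y (hs1 hy) z (hs1 hz))
      (fun y hy z hz => by
        rw [← mul_sub, abs_mul, abs_of_nonneg (by positivity), mul_assoc (3 * κ)]
        gcongr
        refine (abs_sub_map_le_sub (F.chartNorm e y₀) _ _).trans ?_
        rw [sub_sub_sub_cancel_right]
        exact (hN0 _).2)
      (fun y hy hry => by
        have h1 := hx₀ (e.symm y)
        have h2 := hd y₀ (hs2 hy₀r) y (hs2 hy)
        rw [hey₀, F.dist_comm] at h2
        have h3 : κ * F.dist (e.symm y) x₀ ≤ κ * (2 * F.chartNorm e y₀ (y - y₀)) := by gcongr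
        have h4 : r / (2 * K) ≤ F.chartNorm e y₀ (y - y₀) := by
          rw [div_le_iff₀ (by positivity)]
          linarith [(hN0 (y - y₀)).1]
        have h5 : κ * (r / (2 * K)) ≤ κ * F.chartNorm e y₀ (y - y₀) := by gcongr
        simp only [sub_self, map_zero, mul_zero, hey₀]
        linarith) hε
  have hxr : x ∈ Metric.closedBall y₀ r := by rw [mem_closedBall_iff_norm]; linarith
  have hyr : y ∈ Metric.closedBall y₀ r := Metric.ball_subset_closedBall hy
  obtain ⟨⟨hKx, hNx⟩, hxt⟩ := hball x (hs3 hxr)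
  obtain ⟨⟨hKy, hNy⟩, hyt⟩ := hball y (hs3 hyr)
  have hsup := hv.le_of_mem_c1Subdifferential he hxt hX (neg_mem_c1Subdifferential hp)
  have hsub := hu.le_of_mem_c1Superdifferential he hyt hX (neg_mem_c1Superdifferential hq)
  have hsv : ∀ v, |s v| ≤ 3 * κ * F.chartNorm e y₀ v := by
    refine abs_le_of_mem_c1Subdifferential (Eventually.of_forall fun w => ?_) hs
    rw [← mul_sub, abs_mul, abs_of_nonneg (by positivity)]
    gcongr
    refine (abs_sub_map_le_sub (F.chartNorm e y₀) _ _).trans ?_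
    rw [sub_sub_sub_cancel_right]
  have hqv : ∀ v, |q v| ≤ L * ‖v‖ := by
    refine abs_le_of_mem_c1Subdifferential (N := normSeminorm ℝ X) ?_ hq
    filter_upwards [Metric.isOpen_ball.mem_nhds (hs1 hyr)] with w hw
    rw [neg_sub_neg, abs_sub_comm]
    exact hL w hw y (hs1 hyr)
  have hpqv : ∀ v, |p v - q v| ≤ 3 * κ * F.chartNorm e y₀ v + ε * ‖v‖ := fun v => by
    have h1 : |(p - q - s) v| ≤ ε * ‖v‖ := ((p - q - s).le_opNorm v).trans (by gcongr)
    have h2 : p v - q v = s v + (p - q - s) v := by simp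
    rw [h2]
    exact (abs_add_le _ _).trans (add_le_add (hsv v) h1)
  have hq0 := (F.chartNorm e y).dual_nonneg (-q)
  have hp0 := (F.chartNorm e x).dual_nonneg (-p)
  have hTq : (F.chartNorm e y).dual (-q) ≤ L * K := by
    refine Seminorm.dual_le (by positivity) fun v => ?_
    rw [neg_apply, abs_neg]
    refine (hqv v).trans ?_
    rw [mul_assoc]
    gcongr
    exact (hKy v).1
  have hLK : 0 ≤ L * K := by positivity
  have hTp1 := dual_chartNorm_le_of_mem (F := F) (κ := 3 * κ) (ε := ε) (R := R) (δ := 5 * δ / 8)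
    (p := -p) (q := -q) hθ.le (by linarith) (by positivity) hε.le (fun v => (hKx v).1)
    (fun v => (hKy v).1) hK0.le (fun v => (hNx v).1) (fun v => (hNy v).2)
    (fun v => by
      rw [neg_apply, neg_apply, abs_neg, abs_neg]
      have := abs_sub_abs_le_abs_sub (p v) (q v)
      linarith [hpqv v]) (by linarith) (by linarith)
  have hTq1 := dual_chartNorm_le_of_mem (F := F) (κ := 3 * κ) (ε := ε) (R := R) (δ := 5 * δ / 8)
    (p := -q) (q := -p) hθ.le (by linarith) (by positivity) hε.le (fun v => (hKy v).1)
    (fun v => (hKx v).1) hK0.le (fun v => (hNy v).1) (fun v => (hNx v).2)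
    (fun v => by
      rw [neg_apply, neg_apply, abs_neg, abs_neg]
      have := abs_sub_abs_le_abs_sub (q v) (p v)
      rw [abs_sub_comm] at this
      linarith [hpqv v]) (by linarith) (by linarith)
  have hdxy : F.dist (e.symm x) (e.symm y) < ρH := by
    refine (hd x (hs2 hxr) y (hs2 hyr)).trans_lt ?_
    have h1 := (hN0 (y - x)).2
    rw [norm_sub_rev] at h1
    have h2 : K * ‖x - y‖ < K * ε := by gcongr
    linarith
  have hfin := hHρ _ _ ((F.chartNorm e x).dual (-p)) ((F.chartNorm e y).dual (-q)) hdxy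
    (by rw [abs_of_nonneg hp0]; linarith) (by rw [abs_of_nonneg hq0]; linarith)
    (by rw [abs_lt]; constructor <;> linarith)
  have hz0 : 0 ≤ 3 * κ * F.chartNorm e y₀ (z - y₀) := by positivity
  simp only [sub_self, map_zero, mul_zero, hey₀] at hval
  -- The two inequalities of the equation give `u - v < m / 4` across the two points, whereas the
  -- fuzzy sum rule keeps this difference at least `m - ε ≥ 3 * m / 4`.
  linarith [le_abs_self (H (e.symm x, (F.chartNorm e x).dual (-p)) -
    H (e.symm y, (F.chartNorm e y).dual (-q)))]

end FinslerStructure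

/-! ### Lipschitz regularity, continuity of the equation in charts, coercivity. -/

namespace FinslerStructure

variable {X : Type*} [NormedAddCommGroup X] [NormedSpace ℝ X]
  {M : Type*} [TopologicalSpace M] [ChartedSpace X M] [IsManifold 𝓘(ℝ, X) 1 M]
  {F : FinslerStructure X M}

theorem exists_chart_symm_eq (X : Type*) [NormedAddCommGroup X] [NormedSpace ℝ X]
    {M : Type*} [TopologicalSpace M] [ChartedSpace X M] [IsManifold 𝓘(ℝ, X) 1 M] (x : M) :
    ∃ e ∈ IsManifold.maximalAtlas 𝓘(ℝ, X) 1 M, ∃ y ∈ e.target, e.symm y = x :=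
  ⟨chartAt X x, IsManifold.chart_mem_maximalAtlas x, _, mem_chart_target X x,
    (chartAt X x).left_inv (mem_chart_source X x)⟩

theorem _root_.LipschitzInCharts.continuous {u : M → ℝ} (h : LipschitzInCharts X u) :
    Continuous u := by
  rw [continuous_iff_continuousAt]
  intro x
  obtain ⟨e, he, y, hy, rfl⟩ := exists_chart_symm_eq X x
  obtain ⟨ρ, hρ, L, hL0, hL⟩ := h e he y hy
  have h1 : LipschitzOnWith ⟨L, hL0⟩ (fun z => u (e.symm z)) (Metric.ball y ρ) :=
    LipschitzOnWith.of_dist_le_mul fun z hz z' hz' => by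
      rw [Real.dist_eq, dist_eq_norm]
      exact hL z hz z' hz'
  have h2 : ContinuousAt (fun z => u (e.symm z)) y :=
    h1.continuousOn.continuousAt (Metric.ball_mem_nhds y hρ)
  have h3 : ContinuousAt e (e.symm y) := e.continuousAt (e.map_target hy)
  have h4 : ContinuousAt (fun x => u (e.symm (e x))) (e.symm y) :=
    ContinuousAt.comp (g := fun z => u (e.symm z)) (by rwa [e.right_inv hy]) h3
  refine h4.congr ?_
  filter_upwards [e.open_source.mem_nhds (e.map_target hy)] with x hx
  rw [e.left_inv hx]

theorem _root_.LipschitzInCharts.locallyLipschitz [T2Space M] [ParacompactSpace M]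
    [ConnectedSpace M] (hX : HasC1LipschitzBump X) {u : M → ℝ} (h : LipschitzInCharts X u) :
    F.LocallyLipschitz u := by
  intro x
  obtain ⟨e, he, y, hy, rfl⟩ := exists_chart_symm_eq X x
  obtain ⟨ρ₁, hρ₁, L, hL0, hL⟩ := h e he y hy
  obtain ⟨ρ₂, hρ₂, K, hK0, hK⟩ := F.exists_norm_sub_le_mul_dist he hX hy
  have h1 : Tendsto e (𝓝 (e.symm y)) (𝓝 y) := by
    have := (e.continuousAt (e.map_target hy)).tendsto
    rwa [e.right_inv hy] at this
  refine ⟨e.source ∩ e ⁻¹' (Metric.ball y ρ₁ ∩ Metric.ball y ρ₂),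
    inter_mem (e.open_source.mem_nhds (e.map_target hy))
      (h1 (inter_mem (Metric.ball_mem_nhds y hρ₁) (Metric.ball_mem_nhds y hρ₂))), L * K, ?_⟩
  rintro p ⟨hp, hp1, hp2⟩ q ⟨hq, hq1, hq2⟩
  have h2 := hL _ hp1 _ hq1
  have h3 := hK _ hp2 _ hq2
  rw [e.left_inv hp, e.left_inv hq] at h2 h3
  calc _ ≤ L * ‖e p - e q‖ := h2
    _ ≤ L * (K * F.dist p q) := by gcongr
    _ = _ := by ring

theorem eventually_dist_lt (x : M) {δ : ℝ} (hδ : 0 < δ) : ∀ᶠ y in 𝓝 x, F.dist y x < δ := by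
  obtain ⟨e, he, y, hy, rfl⟩ := exists_chart_symm_eq X x
  obtain ⟨ρ, hρ, h⟩ := F.exists_dist_chart_le he hy
  obtain ⟨K, hK1, hK⟩ := F.exists_norm_le_chartNorm he hy
  have h1 : Tendsto e (𝓝 (e.symm y)) (𝓝 y) := by
    have := (e.continuousAt (e.map_target hy)).tendsto
    rwa [e.right_inv hy] at this
  filter_upwards [e.open_source.mem_nhds (e.map_target hy), h1 (Metric.ball_mem_nhds y hρ),
    h1 (Metric.ball_mem_nhds y (show 0 < δ / (2 * K) by positivity))] with z hz hz1 hz2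
  have h2 := h _ hz1 _ (Metric.mem_ball_self hρ)
  rw [e.left_inv hz] at h2
  refine h2.trans_lt ?_
  rw [mem_preimage, mem_ball_iff_norm, norm_sub_rev, lt_div_iff₀ (by positivity)] at hz2
  linarith [(hK.self_of_nhds (y - e z)).2]

variable {e : OpenPartialHomeomorph M X} {y₀ : X}

theorem exists_of_mem_superdifferential (he : e ∈ IsManifold.maximalAtlas 𝓘(ℝ, X) 1 M)
    (hy₀ : y₀ ∈ e.target) {w : M → ℝ}
    {Δ : TangentSpace 𝓘(ℝ, X) (e.symm y₀) →L[ℝ] ℝ} (hΔ : Δ ∈ superdifferential X w (e.symm y₀)) :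
    ∃ φ : X → ℝ, ContDiffAt ℝ 1 φ y₀ ∧ IsLocalMax (fun y => w (e.symm y) - φ y) y₀ ∧
      F.dualNorm (e.symm y₀) Δ = (F.chartNorm e y₀).dual (fderiv ℝ φ y₀) := by
  obtain ⟨g, hg, hmax, rfl⟩ := hΔ
  refine ⟨fun y => g (e.symm y), ?_, (e.isLocalMax_symm hy₀).1 hmax,
    F.dualNorm_mvfderiv he hy₀ (hg.mdifferentiable one_ne_zero _)⟩
  exact (hg.contMDiffAt.comp y₀ (contMDiffAt_symm_of_mem_maximalAtlas he hy₀)).contDiffAt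

theorem exists_of_mem_subdifferential (he : e ∈ IsManifold.maximalAtlas 𝓘(ℝ, X) 1 M)
    (hy₀ : y₀ ∈ e.target) {w : M → ℝ}
    {Δ : TangentSpace 𝓘(ℝ, X) (e.symm y₀) →L[ℝ] ℝ} (hΔ : Δ ∈ subdifferential X w (e.symm y₀)) :
    ∃ φ : X → ℝ, ContDiffAt ℝ 1 φ y₀ ∧ IsLocalMin (fun y => w (e.symm y) - φ y) y₀ ∧
      F.dualNorm (e.symm y₀) Δ = (F.chartNorm e y₀).dual (fderiv ℝ φ y₀) := by
  obtain ⟨g, hg, hmin, rfl⟩ := hΔ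
  refine ⟨fun y => g (e.symm y), ?_, (e.isLocalMin_symm hy₀).1 hmin,
    F.dualNorm_mvfderiv he hy₀ (hg.mdifferentiable one_ne_zero _)⟩
  exact (hg.contMDiffAt.comp y₀ (contMDiffAt_symm_of_mem_maximalAtlas he hy₀)).contDiffAt

theorem dual_chartNorm_zero (y : X) : (F.chartNorm e y).dual 0 = 0 :=
  le_antisymm (Seminorm.dual_le le_rfl fun v => by simp) (Seminorm.dual_nonneg _ _)

theorem isViscositySubsolution_const {H : M × ℝ → ℝ} {c : ℝ} (hc : ∀ x, c + H (x, 0) ≤ 0) :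
    IsViscositySubsolution F H (fun _ => c) := by
  refine ⟨continuous_const.upperSemicontinuous, fun x Δ hΔ => ?_⟩
  obtain ⟨e, he, y, hy, rfl⟩ := exists_chart_symm_eq X x
  obtain ⟨φ, hφ, hmax, hdual⟩ := exists_of_mem_superdifferential (F := F) he hy hΔ
  have h1 := hmax.fderiv_eq_zero
  rw [fderiv_const_sub, neg_eq_zero] at h1
  rw [hdual, h1, dual_chartNorm_zero]
  exact hc _

theorem continuousAt_dual_chartNorm (he : e ∈ IsManifold.maximalAtlas 𝓘(ℝ, X) 1 M)
    (hy₀ : y₀ ∈ e.target) (p₀ : X →L[ℝ] ℝ) :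
    ContinuousAt (fun z : X × (X →L[ℝ] ℝ) => (F.chartNorm e z.1).dual z.2) (y₀, p₀) := by
  rw [Metric.continuousAt_iff']
  intro ε hε
  obtain ⟨K, hK1, hK⟩ := F.exists_norm_le_chartNorm he hy₀
  set T := (F.chartNorm e y₀).dual p₀ with hT
  have hT0 : 0 ≤ T := Seminorm.dual_nonneg _ _
  -- The first estimate yields `dual p < T + ε`; only then is the relative error `θ * dual p` in the
  -- reverse estimate under control.
  obtain ⟨θ, hθ, hθT⟩ : ∃ θ : ℝ, 0 < θ ∧ θ * (T + ε) = ε / 4 :=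
    ⟨ε / 4 / (T + ε), by positivity, by field_simp⟩
  have hp : ∀ᶠ z : X × (X →L[ℝ] ℝ) in 𝓝 (y₀, p₀), ‖z.2 - p₀‖ < ε / (4 * K) := by
    have : ContinuousAt (fun z : X × (X →L[ℝ] ℝ) => ‖z.2 - p₀‖) (y₀, p₀) := by fun_prop
    exact this.eventually_lt_const (by simp; positivity)
  filter_upwards [hp, (continuousAt_fst (p := (y₀, p₀))).eventually hK,
    (continuousAt_fst (p := (y₀, p₀))).eventually (F.eventually_chartNorm_le he hy₀ hθ)]
    with ⟨y, p⟩ hp hKy hNy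
  rw [lt_div_iff₀ (by positivity)] at hp
  have hK0 := hK.self_of_nhds
  have hdiff : ∀ v, |p v - p₀ v| ≤ ‖p - p₀‖ * ‖v‖ := fun v => (p - p₀).le_opNorm v
  have h1 := Seminorm.dual_le_add (c := ‖p - p₀‖ * K) (fun v => (hK0 v).1) hθ.le
    (by positivity) (fun v => (hNy v).1) (p := p) (q := p₀) fun v => by
      have h2 : ‖p - p₀‖ * ‖v‖ ≤ ‖p - p₀‖ * (K * F.chartNorm e y v) := by
        gcongr; exact (hKy v).1
      linarith [abs_sub_abs_le_abs_sub (p v) (p₀ v), hdiff v]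
  have h2 := Seminorm.dual_le_add (c := ‖p - p₀‖ * K) (fun v => (hKy v).1) hθ.le
    (by positivity) (fun v => (hNy v).2) (p := p₀) (q := p) fun v => by
      have h2 : ‖p - p₀‖ * ‖v‖ ≤ ‖p - p₀‖ * (K * F.chartNorm e y₀ v) := by
        gcongr; exact (hK0 v).1
      have h3 := abs_sub_abs_le_abs_sub (p₀ v) (p v)
      rw [abs_sub_comm] at h3
      linarith [hdiff v]
  rw [← hT] at h1 h2
  have h3 : (F.chartNorm e y).dual p < T + ε := by nlinarith
  have h4 : θ * (F.chartNorm e y).dual p ≤ θ * (T + ε) := by gcongr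
  rw [Real.dist_eq, abs_lt]
  constructor <;> simp only <;> linarith

/-- A strict inequality in the equation thereby survives small changes of value, point and
derivative, as both halves of Perron's method require. -/
theorem continuousAt_hamiltonian (he : e ∈ IsManifold.maximalAtlas 𝓘(ℝ, X) 1 M)
    (hy₀ : y₀ ∈ e.target) {H : M × ℝ → ℝ} (hH : Continuous H) (a₀ : ℝ) (p₀ : X →L[ℝ] ℝ) :
    ContinuousAt (fun z : ℝ × X × (X →L[ℝ] ℝ) =>
      z.1 + H (e.symm z.2.1, (F.chartNorm e z.2.1).dual z.2.2)) (a₀, y₀, p₀) := by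
  refine continuousAt_fst.add (hH.continuousAt.comp (ContinuousAt.prodMk ?_ ?_))
  · exact ContinuousAt.comp (g := e.symm) (f := fun z : ℝ × X × (X →L[ℝ] ℝ) => z.2.1)
      (x := (a₀, y₀, p₀)) (e.continuousAt_symm hy₀) (by fun_prop)
  · exact ContinuousAt.comp (g := fun z : X × (X →L[ℝ] ℝ) => (F.chartNorm e z.1).dual z.2)
      (f := fun z : ℝ × X × (X →L[ℝ] ℝ) => z.2) (x := (a₀, y₀, p₀))
      (continuousAt_dual_chartNorm he hy₀ p₀) continuousAt_snd

/-- `H(x, t) > K` for all large `t`, locally uniformly in `x`. -/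
def _root_.LocallyUniformlyEventuallyGT (H : M × ℝ → ℝ) (K : ℝ) : Prop :=
  ∀ x₀ : M, ∃ U ∈ 𝓝 x₀, ∃ R : ℝ, ∀ x ∈ U, ∀ t : ℝ, R ≤ t → K < H (x, t)

theorem _root_.LocallyUniformLiminfGE.locallyUniformlyEventuallyGT {H : M × ℝ → ℝ} {K K' : ℝ}
    (h : LocallyUniformLiminfGE H K') (hK : K < K') : LocallyUniformlyEventuallyGT H K := by
  intro x₀
  obtain ⟨U, hU, h⟩ := h x₀
  obtain ⟨R, hR⟩ := h ((K' - K) / 2) (by linarith)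
  exact ⟨U, hU, R, fun x hx t ht => by linarith [hR x hx t ht]⟩

/-- Uniform continuity is uniform in `t` as well, so a bound `H (x₀, t) > c > K` for large `t` loses
less than `c - K` on a whole `d`-ball. Both alternatives of the hypothesis thus lead to the same
coercivity. -/
theorem _root_.IsUniformlyContinuousHamiltonian.locallyUniformlyEventuallyGT {H : M × ℝ → ℝ}
    (h : IsUniformlyContinuousHamiltonian F H) {K : ℝ}
    (hK : ∀ x : M, (K : EReal) < liminf (fun t : ℝ => (H (x, t) : EReal)) atTop) :
    LocallyUniformlyEventuallyGT H K := by
  intro x₀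
  obtain ⟨c, hKc, hc⟩ := EReal.lt_iff_exists_real_btwn.1 (hK x₀)
  obtain ⟨R, hR⟩ := eventually_atTop.1 (eventually_lt_of_lt_liminf hc)
  rw [EReal.coe_lt_coe_iff] at hKc
  obtain ⟨δ, hδ, hδH⟩ := h (c - K) (by linarith)
  refine ⟨_, eventually_dist_lt (F := F) x₀ hδ, R, fun x hx t ht => ?_⟩
  have h1 := abs_lt.1 (hδH x x₀ t t hx (by simpa using hδ))
  have h2 := EReal.coe_lt_coe_iff.1 (hR t ht)
  linarith

variable [T2Space M] [ParacompactSpace M] [CompleteSpace X]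

/-- At a superdifferential `p` of `w ≥ -K₁` the equation forces `H ≤ K₁`, so coercivity bounds the
dual norm of `p`. The radius and the constant do not depend on `w`, which lets the estimate pass to
suprema. -/
theorem exists_lipschitz_of_isViscositySubsolution (hX : HasC1LipschitzBump X) {H : M × ℝ → ℝ}
    {K₁ B : ℝ} (hH : LocallyUniformlyEventuallyGT H K₁)
    (he : e ∈ IsManifold.maximalAtlas 𝓘(ℝ, X) 1 M) (hy₀ : y₀ ∈ e.target) :
    ∃ ρ > 0, ∃ L : ℝ, 0 ≤ L ∧ ∀ w : M → ℝ, IsViscositySubsolution F H w → (∀ x, |w x| ≤ B) →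
      (∀ x, -K₁ ≤ w x) → ∀ y ∈ Metric.ball y₀ ρ, ∀ z ∈ Metric.ball y₀ ρ,
        |w (e.symm y) - w (e.symm z)| ≤ L * ‖y - z‖ := by
  obtain ⟨K, hK1, hK⟩ := F.exists_norm_le_chartNorm he hy₀
  obtain ⟨U, hU, R, hR⟩ := hH (e.symm y₀)
  obtain ⟨r, hr, hball⟩ := Metric.nhds_basis_closedBall.eventually_iff.1
    ((hK.and ((e.continuousAt_symm hy₀).eventually hU)).and (e.open_target.mem_nhds hy₀))
  -- The slope must exceed the bound `|R| * K` on the superdifferentials and satisfy `4 * |B| < L *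
  -- r`.
  set L : ℝ := |R| * K + 1 + 4 * |B| / r with hL
  have hB0 : 0 ≤ 4 * |B| / r := by positivity
  have hRK : 0 ≤ |R| * K := by positivity
  refine ⟨r / 4, by positivity, L, by positivity, fun w hw hwB hwK => ?_⟩
  have key : ∀ y ∈ Metric.ball y₀ (r / 4), ∀ z ∈ Metric.ball y₀ (r / 4),
      w (e.symm y) - w (e.symm z) ≤ L * ‖y - z‖ := by
    intro y hy z hz
    refine hX.sub_le_of_c1Superdifferential_bounded (w := fun y => w (e.symm y)) (B := |B|)
      (R := |R| * K) hr ?_ (fun x _ => (hwB _).trans (le_abs_self B)) ?_ (by linarith) ?_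
      (Metric.ball_subset_closedBall hz) (Metric.ball_subset_closedBall hy)
    · intro x hx c hc
      exact ((e.continuousAt_symm (hball hx).2).eventually (hw.1 _ c hc)).filter_mono
        nhdsWithin_le_nhds
    · intro x hx p hp
      obtain ⟨⟨hKx, hUx⟩, hxt⟩ := hball (Metric.ball_subset_closedBall hx)
      have h1 := hw.le_of_mem_c1Superdifferential he hxt hX hp
      have h2 : (F.chartNorm e x).dual p < R := by
        by_contra! h
        linarith [hR _ hUx _ h, hwK (e.symm x)]
      refine ContinuousLinearMap.opNorm_le_bound _ hRK fun v => ?_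
      have h3 := Seminorm.dual_nonneg (F.chartNorm e x) p
      calc ‖p v‖ ≤ (F.chartNorm e x).dual p * F.chartNorm e x v :=
            Seminorm.abs_le_dual_mul (fun v => (hKx v).1) p v
        _ ≤ |R| * (K * ‖v‖) := by
          gcongr
          · exact h2.le.trans (le_abs_self R)
          · exact (hKx v).2
        _ = _ := by ring
    · rw [hL, add_mul, div_mul_cancel₀ _ hr.ne']
      have : 0 < (|R| * K + 1) * r := by positivity
      linarith
  intro y hy z hz
  rw [abs_le]
  have h1 := key y hy z hz
  have h2 := key z hz y hy
  rw [norm_sub_rev] at h2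
  constructor <;> linarith

end FinslerStructure

/-! ### Perron's method. -/

namespace FinslerStructure

variable {X : Type*} [NormedAddCommGroup X] [NormedSpace ℝ X] [CompleteSpace X]
  {M : Type*} [TopologicalSpace M] [ChartedSpace X M] [IsManifold 𝓘(ℝ, X) 1 M]
  [T2Space M] [ParacompactSpace M] {F : FinslerStructure X M} {H : M × ℝ → ℝ} {K₁ B : ℝ}

section Supremum

variable {𝓕 : Set (M → ℝ)} {u : M → ℝ}

theorem lipschitzInCharts_of_isLUB (hX : HasC1LipschitzBump X)
    (hcoer : LocallyUniformlyEventuallyGT H K₁)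
    (h𝓕 : ∀ w ∈ 𝓕, IsViscositySubsolution F H w ∧ (∀ x, |w x| ≤ B) ∧ ∀ x, -K₁ ≤ w x)
    (hu : ∀ x, IsLUB ((fun w : M → ℝ => w x) '' 𝓕) (u x)) : LipschitzInCharts X u := by
  intro e he y₀ hy₀
  obtain ⟨ρ, hρ, L, hL0, hL⟩ := exists_lipschitz_of_isViscositySubsolution (F := F) (B := B)
    hX hcoer he hy₀
  have key : ∀ y ∈ Metric.ball y₀ ρ, ∀ z ∈ Metric.ball y₀ ρ,
      u (e.symm y) ≤ u (e.symm z) + L * ‖y - z‖ := by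
    intro y hy z hz
    refine (hu _).2 ?_
    rintro _ ⟨w, hw, rfl⟩
    have h1 : w (e.symm z) ≤ u (e.symm z) := (hu _).1 ⟨w, hw, rfl⟩
    have h2 := hL w (h𝓕 w hw).1 (h𝓕 w hw).2.1 (h𝓕 w hw).2.2 y hy z hz
    change w (e.symm y) ≤ _
    linarith [le_abs_self (w (e.symm y) - w (e.symm z))]
  refine ⟨ρ, hρ, L, hL0, fun y hy z hz => ?_⟩
  have h1 := key y hy z hz
  have h2 := key z hz y hy
  rw [norm_sub_rev] at h2
  rw [abs_le]
  constructor <;> linarith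

/-- The supremum of a family of viscosity subsolutions is a viscosity subsolution. -/
theorem isViscositySubsolution_of_isLUB (hX : HasC1LipschitzBump X) (hH : Continuous H)
    (hcoer : LocallyUniformlyEventuallyGT H K₁)
    (h𝓕 : ∀ w ∈ 𝓕, IsViscositySubsolution F H w ∧ (∀ x, |w x| ≤ B) ∧ ∀ x, -K₁ ≤ w x)
    (hu : ∀ x, IsLUB ((fun w : M → ℝ => w x) '' 𝓕) (u x)) : IsViscositySubsolution F H u := by
  refine ⟨(lipschitzInCharts_of_isLUB hX hcoer h𝓕 hu).continuous.upperSemicontinuous,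
    fun x₀ Δ hΔ => ?_⟩
  obtain ⟨e, he, y₀, hy₀, rfl⟩ := exists_chart_symm_eq X x₀
  obtain ⟨φ, hφ, hmax, hdual⟩ := exists_of_mem_superdifferential (F := F) he hy₀ hΔ
  rw [hdual]
  by_contra! hpos
  obtain ⟨ρ₁, hρ₁, L, hL0, hL⟩ := exists_lipschitz_of_isViscositySubsolution (F := F) (B := B)
    hX hcoer he hy₀
  set p₀ := fderiv ℝ φ y₀
  obtain ⟨τ, hτ, hτG⟩ := Metric.eventually_nhds_iff.1
    ((continuousAt_hamiltonian (F := F) he hy₀ hH (u (e.symm y₀)) p₀).eventually_const_lt hpos)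
  obtain ⟨Lφ, t, ht, hLφ⟩ := hφ.exists_lipschitzOnWith
  have hφd : ∀ᶠ y in 𝓝 y₀, DifferentiableAt ℝ φ y :=
    (hφ.eventually (by simp)).mono fun y hy => hy.differentiableAt one_ne_zero
  have hφc : ∀ᶠ y in 𝓝 y₀, ‖fderiv ℝ φ y - p₀‖ < τ / 4 := by
    have : ContinuousAt (fun y => ‖fderiv ℝ φ y - p₀‖) y₀ :=
      ((hφ.continuousAt_fderiv one_ne_zero).sub continuousAt_const).norm
    exact this.eventually_lt_const (by simp [p₀]; positivity)
  obtain ⟨ρ₂, hρ₂, hball⟩ := Metric.eventually_nhds_iff_ball.1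
    ((((hφd.and hφc).and hmax).and (e.open_target.mem_nhds hy₀)).and ht)
  obtain ⟨r, hr, hr1, hr2, hr3, hr4⟩ : ∃ r : ℝ, 0 < r ∧ r < ρ₁ ∧ r < ρ₂ ∧ r < τ ∧
      L * r ≤ τ / 4 := by
    refine ⟨min (min ρ₁ ρ₂) (min τ (τ / 4 / (L + 1))) / 2, by positivity, ?_, ?_, ?_, ?_⟩
    all_goals
      have h1 := min_le_left (min ρ₁ ρ₂) (min τ (τ / 4 / (L + 1)))
      have h2 := min_le_right (min ρ₁ ρ₂) (min τ (τ / 4 / (L + 1)))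
      have h3 := min_le_left ρ₁ ρ₂
      have h4 := min_le_right ρ₁ ρ₂
      have h5 := min_le_left τ (τ / 4 / (L + 1))
      have h6 := min_le_right τ (τ / 4 / (L + 1))
      have h7 : 0 < min (min ρ₁ ρ₂) (min τ (τ / 4 / (L + 1))) := by positivity
    · linarith
    · linarith
    · linarith
    · have h8 : min (min ρ₁ ρ₂) (min τ (τ / 4 / (L + 1))) / 2 ≤ τ / 4 / (L + 1) := by linarith
      calc _ ≤ (L + 1) * (τ / 4 / (L + 1)) := by gcongr; linarith
        _ = τ / 4 := by field_simp
  have hs1 := Metric.closedBall_subset_ball (x := y₀) hr1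
  have hs2 := Metric.closedBall_subset_ball (x := y₀) hr2
  have hy₀r : y₀ ∈ Metric.closedBall y₀ r := Metric.mem_closedBall_self hr.le
  obtain ⟨κ, hκ, hκτ⟩ : ∃ κ, 0 < κ ∧ κ ≤ τ / 4 := ⟨τ / 4, by positivity, le_rfl⟩
  -- A single member `w` almost attains the supremum at `y₀`. Its defect `κ * r / 4` is half of the
  -- penalty `κ * r / 2` available at distance `r / 2`, so `w - φ - κ * ‖· - y₀‖` keeps a gap; the
  -- bound `τ / 4` keeps its value close to `u`.
  obtain ⟨_, ⟨w, hw, rfl⟩, hwu⟩ := (lt_isLUB_iff (hu (e.symm y₀))).1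
    (show u (e.symm y₀) - min (κ * r / 4) (τ / 4) < u (e.symm y₀) by
      have : 0 < min (κ * r / 4) (τ / 4) := by positivity
      linarith)
  obtain ⟨hwsub, hwB, hwK⟩ := h𝓕 w hw
  have hwu' : u (e.symm y₀) - min (κ * r / 4) (τ / 4) < w (e.symm y₀) := hwu
  have hwle : ∀ x, w x ≤ u x := fun x => (hu x).1 ⟨w, hw, rfl⟩
  have hm1 := min_le_left (κ * r / 4) (τ / 4)
  have hm2 := min_le_right (κ * r / 4) (τ / 4)
  obtain ⟨x, y, z, hx, hxy, -, hy, -, ⟨p, hp, q, hq, s, hs, hpqs⟩, -⟩ :=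
    hX.exists_fuzzy_sum (c := y₀) (a := y₀) (r := r) (r' := r / 2) (η := κ * r / 4)
      (f := fun y => w (e.symm y)) (g := φ) (k := fun y => κ * ‖y - y₀‖) (Lg := Lφ) (Lk := κ)
      (by linarith) (by positivity) hy₀r
      (fun x hx c hc => ((e.continuousAt_symm (hball x (hs2 hx)).1.2).eventually
        (hwsub.1 _ c hc)).filter_mono nhdsWithin_le_nhds)
      ⟨B, by rintro _ ⟨y, -, rfl⟩; exact (le_abs_self _).trans (hwB _)⟩
      (fun y hy z hz => by
        have := hLφ.dist_le_mul y (hball y (hs2 hy)).2 z (hball z (hs2 hz)).2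
        rwa [Real.dist_eq, dist_eq_norm] at this)
      (fun y hy z hz => by
        rw [← mul_sub, abs_mul, abs_of_nonneg hκ.le]
        gcongr
        simpa using abs_norm_sub_norm_le (y - y₀) (z - y₀))
      (fun y hy hry => by
        have h1 := (hball y (hs2 hy)).1.1.2
        have h2 := hwle (e.symm y)
        have h3 : κ * (r / 2) ≤ κ * ‖y - y₀‖ := by gcongr
        simp only [sub_self, norm_zero, mul_zero]
        linarith) (show 0 < τ / 4 by positivity)
  have hxr : x ∈ Metric.closedBall y₀ r := by rw [mem_closedBall_iff_norm]; linarith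
  have hyr : y ∈ Metric.closedBall y₀ r := Metric.ball_subset_closedBall hy
  have hsub := hwsub.le_of_mem_c1Superdifferential he (hball x (hs2 hxr)).1.2 hX hp
  have hq' := eq_fderiv_of_mem_c1Subdifferential (hball y (hs2 hyr)).1.1.1.1 hq
  have hqp : ‖q - p₀‖ < τ / 4 := by
    rw [hq']
    exact (hball y (hs2 hyr)).1.1.1.2
  have hsn : ‖s‖ ≤ κ := by
    refine s.opNorm_le_bound hκ.le fun v => ?_
    refine abs_le_of_mem_c1Subdifferential (N := normSeminorm ℝ X)
      (Eventually.of_forall fun w => ?_) hs v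
    rw [← mul_sub, abs_mul, abs_of_nonneg hκ.le]
    gcongr
    simpa using abs_norm_sub_norm_le (w - y₀) (z - y₀)
  have hp' : ‖p - p₀‖ < τ := by
    have h1 : p - p₀ = (p - q - s) + s + (q - p₀) := by abel
    rw [h1]
    refine (norm_add₃_le).trans_lt ?_
    linarith
  have hwx : |w (e.symm x) - u (e.symm y₀)| < τ := by
    have h1 := abs_le.1 (hL w hwsub hwB hwK x (hs1 hxr) y₀ (hs1 hy₀r))
    have h2 : L * ‖x - y₀‖ ≤ L * r := by gcongr; linarith
    have h3 := hwle (e.symm y₀)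
    rw [abs_lt]
    constructor <;> linarith
  have hG := hτG (y := (w (e.symm x), x, p)) (by
    rw [Prod.dist_eq, Prod.dist_eq, max_lt_iff, max_lt_iff, Real.dist_eq, dist_eq_norm,
      dist_eq_norm]
    exact ⟨hwx, by linarith, hp'⟩)
  simp only at hG
  linarith

omit [CompleteSpace X] in
/-- Perron's method: the supremum of all subsolutions between `-K₁` and `-K₀` is a supersolution. -/
theorem isViscositySupersolution_of_isLUB (hX : HasC1LipschitzBump X) (hH : Continuous H)
    {K₀ : ℝ} (hK₀ : ∀ x, K₀ ≤ H (x, 0)) (hucont : Continuous u)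
    (husub : IsViscositySubsolution F H u) (huK : ∀ x, -K₁ ≤ u x ∧ u x ≤ -K₀)
    (hmaximal : ∀ w : M → ℝ, IsViscositySubsolution F H w → (∀ x, -K₁ ≤ w x ∧ w x ≤ -K₀) →
      ∀ x, w x ≤ u x) : IsViscositySupersolution F H u := by
  classical
  refine ⟨hucont.lowerSemicontinuous, fun x₀ Δ hΔ => ?_⟩
  obtain ⟨e, he, y₀, hy₀, rfl⟩ := exists_chart_symm_eq X x₀
  obtain ⟨φ₀, hφ₀, hmin, hdual⟩ := exists_of_mem_subdifferential (F := F) he hy₀ hΔ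
  rw [hdual]
  by_contra! hneg
  set a₀ := u (e.symm y₀) with ha₀
  set φ : X → ℝ := fun y => φ₀ y + (a₀ - φ₀ y₀) with hφdef
  have hφ : ContDiffAt ℝ 1 φ y₀ := hφ₀.add contDiffAt_const
  have hfd : fderiv ℝ φ = fderiv ℝ φ₀ := by
    ext1 y
    exact fderiv_add_const _
  have hφy₀ : φ y₀ = a₀ := by simp [hφdef]
  have hφle : ∀ᶠ y in 𝓝 y₀, φ y ≤ u (e.symm y) := by
    filter_upwards [hmin] with y hy
    simp only [hφdef]
    linarith
  rw [← hfd] at hneg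
  set p₀ := fderiv ℝ φ y₀
  -- Room is needed to push `u` up without leaving the family. If `u` had reached `-K₀`, the test
  -- function would have a local maximum at `y₀`, so `p₀ = 0`, and `K₀ ≤ H (x, 0)` would contradict
  -- `hneg`.
  have hlt : a₀ < -K₀ := by
    refine lt_of_le_of_ne (huK _).2 fun heq => ?_
    have h1 : IsLocalMax φ y₀ := by
      filter_upwards [hφle] with y hy
      rw [hφy₀, heq]
      exact hy.trans (huK _).2
    have h2 : p₀ = 0 := h1.fderiv_eq_zero
    rw [h2, dual_chartNorm_zero] at hneg
    linarith [hK₀ (e.symm y₀)]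
  obtain ⟨τ, hτ, hτG⟩ := Metric.eventually_nhds_iff.1
    ((continuousAt_hamiltonian (F := F) he hy₀ hH a₀ p₀).eventually_lt_const hneg)
  obtain ⟨ρ₁, hρ₁, hρ₁t, hcl⟩ := e.exists_isClosed_image_closedBall hy₀
  have hφd : ∀ᶠ y in 𝓝 y₀, DifferentiableAt ℝ φ y :=
    (hφ.eventually (by simp)).mono fun y hy => hy.differentiableAt one_ne_zero
  have hφc : ∀ᶠ y in 𝓝 y₀, ‖fderiv ℝ φ y - p₀‖ < τ / 2 := by
    have : ContinuousAt (fun y => ‖fderiv ℝ φ y - p₀‖) y₀ :=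
      ((hφ.continuousAt_fderiv one_ne_zero).sub continuousAt_const).norm
    exact this.eventually_lt_const (by simp [p₀]; positivity)
  have hφv : ∀ᶠ y in 𝓝 y₀, |φ y - a₀| < min (τ / 2) ((-K₀ - a₀) / 2) := by
    have : ContinuousAt (fun y => |φ y - a₀|) y₀ :=
      (hφ.continuousAt.sub continuousAt_const).abs
    refine this.eventually_lt_const ?_
    simp only [hφy₀, sub_self, abs_zero]
    have := sub_pos.2 hlt
    positivity
  obtain ⟨ρ₂, hρ₂, hball⟩ := Metric.eventually_nhds_iff_ball.1
    (((hφd.and hφc).and hφv).and hφle)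
  set ρ := min (min ρ₁ ρ₂) τ with hρdef
  have hρ : 0 < ρ := by positivity
  have hρρ₁ : ρ ≤ ρ₁ := (min_le_left _ _).trans (min_le_left _ _)
  have hρρ₂ : ρ ≤ ρ₂ := (min_le_left _ _).trans (min_le_right _ _)
  have hρτ : ρ ≤ τ := min_le_right _ _
  have hs1 : Metric.ball y₀ ρ ⊆ e.target :=
    (Metric.ball_subset_closedBall.trans (Metric.closedBall_subset_closedBall hρρ₁)).trans hρ₁t
  have hs2 : Metric.ball y₀ ρ ⊆ Metric.ball y₀ ρ₂ := Metric.ball_subset_ball hρρ₂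
  obtain ⟨L, hL, hbump⟩ := hX.exists_bump
  obtain ⟨β, hβC, hβ, hβ1, hβ0, hβd⟩ := hbump y₀ (ρ / 2) (by positivity)
  -- The height of the bump is limited by three margins: the value and the derivative must stay
  -- within `τ`, where the strict inequality holds, and the raised function must stay below `-K₀`.
  obtain ⟨η, hη, hη1, hη2, hη3⟩ : ∃ η : ℝ, 0 < η ∧ η ≤ τ / 2 ∧ η ≤ (-K₀ - a₀) / 2 ∧
      η * (L / (ρ / 2)) ≤ τ / 2 := by
    have h0 := sub_pos.2 hlt
    refine ⟨min (min (τ / 2) ((-K₀ - a₀) / 2)) (τ / 2 / (L / (ρ / 2) + 1)), by positivity,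
      (min_le_left _ _).trans (min_le_left _ _), (min_le_left _ _).trans (min_le_right _ _), ?_⟩
    calc _ ≤ (τ / 2 / (L / (ρ / 2) + 1)) * (L / (ρ / 2) + 1) := by
          gcongr
          · exact min_le_right _ _
          · linarith
      _ = τ / 2 := by field_simp
  set ψ : X → ℝ := fun y => φ y + η * β y with hψ
  have hψd : ∀ y ∈ Metric.ball y₀ ρ, HasFDerivAt ψ (fderiv ℝ φ y + η • fderiv ℝ β y) y :=
    fun y hy => ((hball y (hs2 hy)).1.1.1.hasFDerivAt).add
      ((hβC.differentiable one_ne_zero y).hasFDerivAt.const_mul η)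
  have hβη : ∀ y, 0 ≤ η * β y ∧ η * β y ≤ η := fun y =>
    ⟨mul_nonneg hη.le (hβ y).1, mul_le_of_le_one_right hη.le (hβ y).2⟩
  have hψG : ∀ y ∈ Metric.ball y₀ ρ,
      ψ y + H (e.symm y, (F.chartNorm e y).dual (fderiv ℝ ψ y)) < 0 := by
    intro y hy
    have h1 := abs_lt.1 ((hball y (hs2 hy)).1.2.trans_le (min_le_left _ _))
    refine hτG (y := (ψ y, y, fderiv ℝ ψ y)) ?_
    rw [Prod.dist_eq, Prod.dist_eq, max_lt_iff, max_lt_iff, Real.dist_eq,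
      dist_eq_norm (fderiv ℝ ψ y), (hψd y hy).fderiv]
    refine ⟨?_, hy.trans_le hρτ, ?_⟩
    · simp only [hψ]
      rw [abs_lt]
      constructor <;> linarith [hβη y]
    · have h2 : fderiv ℝ φ y + η • fderiv ℝ β y - p₀ =
          (fderiv ℝ φ y - p₀) + η • fderiv ℝ β y := by abel
      rw [h2]
      refine (norm_add_le _ _).trans_lt ?_
      rw [norm_smul, Real.norm_of_nonneg hη.le]
      have h3 : η * ‖fderiv ℝ β y‖ ≤ η * (L / (ρ / 2)) := by gcongr; exact hβd y
      linarith [(hball y (hs2 hy)).1.1.2]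
  set V : Set M := e.source ∩ e ⁻¹' Metric.ball y₀ ρ with hV
  have hVo : IsOpen V := e.continuousOn.isOpen_inter_preimage e.open_source Metric.isOpen_ball
  have hC : IsClosed (e.symm '' Metric.closedBall y₀ (ρ / 2)) :=
    hcl _ (Metric.closedBall_subset_closedBall (by linarith)) Metric.isClosed_closedBall
  -- Off the half-radius ball `β` vanishes and `φ ≤ u`, so the two branches agree on an annulus and
  -- `w` is continuous.
  set w : M → ℝ := fun x => if x ∈ V then max (u x) (ψ (e x)) else u x with hw
  have hwV : ∀ x ∈ V, w x = max (u x) (ψ (e x)) := fun x hx => if_pos hx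
  have huw : ∀ x, u x ≤ w x := fun x => by
    simp only [hw]
    split_ifs
    · exact le_max_left _ _
    · exact le_rfl
  have hwout : ∀ x ∉ e.symm '' Metric.closedBall y₀ (ρ / 2), w x = u x := fun x hx => by
    by_cases hxV : x ∈ V
    · rw [hwV x hxV, max_eq_left]
      have h1 : β (e x) = 0 := hβ0 _ (by
        by_contra! h
        exact hx ⟨e x, by rw [mem_closedBall_iff_norm]; exact h.le, e.left_inv hxV.1⟩)
      have h2 := (hball _ (hs2 hxV.2)).2
      rw [e.left_inv hxV.1] at h2
      simpa [hψ, h1] using h2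
    · exact if_neg hxV
  have hCV : e.symm '' Metric.closedBall y₀ (ρ / 2) ⊆ V := by
    rintro _ ⟨y, hy, rfl⟩
    have hyb : y ∈ Metric.ball y₀ ρ := Metric.closedBall_subset_ball (by linarith) hy
    refine ⟨e.map_target (hs1 hyb), ?_⟩
    rwa [mem_preimage, e.right_inv (hs1 hyb)]
  have hwcont : Continuous w := by
    rw [continuous_iff_continuousAt]
    intro x
    by_cases hxV : x ∈ V
    · have h1 : ContinuousAt (fun x => max (u x) (ψ (e x))) x :=
        hucont.continuousAt.max (ContinuousAt.comp (g := ψ)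
          (hψd _ hxV.2).differentiableAt.continuousAt (e.continuousAt hxV.1))
      refine h1.congr ?_
      filter_upwards [hVo.mem_nhds hxV] with z hz using (hwV z hz).symm
    · refine (hucont.continuousAt (x := x)).congr ?_
      filter_upwards [hC.isOpen_compl.mem_nhds fun h => hxV (hCV h)] with z hz
      exact (hwout z hz).symm
  have hwsub : IsViscositySubsolution F H w := by
    refine ⟨hwcont.upperSemicontinuous, fun x Δ hΔ => ?_⟩
    -- Where `w = u`, a test function for `w` also touches `u` from above, since `u ≤ w`. Elsewhere
    -- `w` coincides at `x` with the differentiable function `ψ`, which lies below it, so the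
    -- derivative of the test function is that of `ψ`.
    by_cases hwu : w x = u x
    · rw [hwu]
      obtain ⟨g, hg, hmax, rfl⟩ := hΔ
      refine husub.2 x _ ⟨g, hg, ?_, rfl⟩
      filter_upwards [hmax] with z hz
      rw [hwu] at hz
      linarith [huw z]
    · have hxV : x ∈ V := by
        by_contra h
        exact hwu (hwout x fun h' => h (hCV h'))
      have hwψ : w x = ψ (e x) := by
        rw [hwV x hxV] at hwu ⊢
        exact max_eq_right (le_of_not_ge fun h => hwu (max_eq_left h))
      obtain ⟨y, hy, rfl⟩ : ∃ y ∈ Metric.ball y₀ ρ, e.symm y = x :=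
        ⟨e x, hxV.2, e.left_inv hxV.1⟩
      rw [e.right_inv (hs1 hy)] at hwψ
      obtain ⟨h, hh, hmax, hdual⟩ := exists_of_mem_superdifferential (F := F) he (hs1 hy) hΔ
      have h1 : IsLocalMax (fun z => ψ z - h z) y := by
        filter_upwards [hmax, Metric.isOpen_ball.mem_nhds hy] with z hz hzb
        have h2 : ψ z ≤ w (e.symm z) := by
          rw [hwV _ ⟨e.map_target (hs1 hzb), by rwa [mem_preimage, e.right_inv (hs1 hzb)]⟩,
            e.right_inv (hs1 hzb)]
          exact le_max_right _ _
        rw [hwψ] at hz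
        linarith
      have h2 := h1.fderiv_eq_zero
      rw [fderiv_fun_sub (hψd y hy).differentiableAt (hh.differentiableAt one_ne_zero),
        sub_eq_zero] at h2
      rw [hdual, hwψ, ← h2]
      exact (hψG y hy).le
  have hwK : ∀ x, -K₁ ≤ w x ∧ w x ≤ -K₀ := fun x => by
    refine ⟨(huK x).1.trans (huw x), ?_⟩
    by_cases hxV : x ∈ V
    · rw [hwV x hxV]
      refine max_le (huK x).2 ?_
      have h1 := abs_lt.1 ((hball _ (hs2 hxV.2)).1.2.trans_le (min_le_right _ _))
      simp only [hψ]
      linarith [hβη (e x)]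
    · rw [hwout x fun h => hxV (hCV h)]
      exact (huK x).2
  have hfin := hmaximal w hwsub hwK (e.symm y₀)
  have hy₀V : e.symm y₀ ∈ V := hCV ⟨y₀, Metric.mem_closedBall_self (by positivity), rfl⟩
  rw [hwV _ hy₀V, e.right_inv hy₀] at hfin
  have h1 := (le_max_right _ _).trans hfin
  simp only [hψ, hβ1.self_of_nhds, hφy₀] at h1
  linarith

end Supremum

end FinslerStructure

/-! ### Existence, uniqueness and regularity assembled. -/

theorem mainTheorem3
    {X : Type*} [NormedAddCommGroup X] [NormedSpace ℝ X] [CompleteSpace X]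
    (hX : HasC1LipschitzBump X)
    {M : Type*} [TopologicalSpace M] [T2Space M] [ParacompactSpace M] [ConnectedSpace M]
    [ChartedSpace X M] [IsManifold 𝓘(ℝ, X) 1 M]
    (F : FinslerStructure X M) (hF : F.IsComplete)
    (H : M × ℝ → ℝ) (hH : Continuous H)
    (K₀ K₁ : ℝ) (hK : ∀ x : M, K₀ ≤ H (x, 0) ∧ H (x, 0) ≤ K₁)
    (hcond :
      (IsUniformlyContinuousHamiltonian F H ∧
        ∀ x : M, (K₁ : EReal) < liminf (fun t : ℝ => (H (x, t) : EReal)) atTop) ∨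
      (ConditionA F H ∧ ∃ K₁' : ℝ, K₁ < K₁' ∧ LocallyUniformLiminfGE H K₁')) :
    ∃ u : M → ℝ,
      ((∃ B : ℝ, ∀ x, |u x| ≤ B) ∧ IsViscositySolution F H u) ∧
      (∀ v : M → ℝ, (∃ B : ℝ, ∀ x, |v x| ≤ B) → IsViscositySolution F H v → v = u) ∧
      (∀ x : M, IsLUB {r : ℝ | ∃ w : M → ℝ, (∀ y, -K₁ ≤ w y ∧ w y ≤ -K₀) ∧
        IsViscositySubsolution F H w ∧ w x = r} (u x)) ∧
      F.LocallyLipschitz u := by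
  have hmod : F.HasHamiltonianModulus H := by
    rcases hcond with h | h
    · exact h.1.hasHamiltonianModulus
    · exact h.1.hasHamiltonianModulus
  have hcoer : LocallyUniformlyEventuallyGT H K₁ := by
    rcases hcond with ⟨h1, h2⟩ | ⟨-, K₁', h1, h2⟩
    · exact h1.locallyUniformlyEventuallyGT h2
    · exact h2.locallyUniformlyEventuallyGT h1
  have hK₀₁ : K₀ ≤ K₁ := by
    obtain ⟨x⟩ := (inferInstance : Nonempty M)
    exact (hK x).1.trans (hK x).2
  have hconst : IsViscositySubsolution F H (fun _ => -K₁) :=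
    FinslerStructure.isViscositySubsolution_const fun x => by linarith [(hK x).2]
  set 𝓕 : Set (M → ℝ) :=
    {w | (∀ y, -K₁ ≤ w y ∧ w y ≤ -K₀) ∧ IsViscositySubsolution F H w} with h𝓕def
  have habs : ∀ r : ℝ, -K₁ ≤ r ∧ r ≤ -K₀ → |r| ≤ |K₀| + |K₁| := fun r hr => by
    rw [abs_le]
    constructor <;>
      linarith [neg_abs_le K₀, le_abs_self K₁, neg_abs_le K₁, le_abs_self K₀, abs_nonneg K₀,
        abs_nonneg K₁]
  have h𝓕 : ∀ w ∈ 𝓕, IsViscositySubsolution F H w ∧ (∀ x, |w x| ≤ |K₀| + |K₁|) ∧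
      ∀ x, -K₁ ≤ w x :=
    fun w hw => ⟨hw.2, fun x => habs _ (hw.1 x), fun x => (hw.1 x).1⟩
  set u : M → ℝ := fun x => sSup ((fun w : M → ℝ => w x) '' 𝓕)
  have hmem : (fun _ => -K₁) ∈ 𝓕 := ⟨fun _ => ⟨le_rfl, neg_le_neg hK₀₁⟩, hconst⟩
  have hu : ∀ x, IsLUB ((fun w : M → ℝ => w x) '' 𝓕) (u x) := fun x =>
    isLUB_csSup ⟨_, _, hmem, rfl⟩ ⟨-K₀, by rintro _ ⟨w, hw, rfl⟩; exact (hw.1 x).2⟩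
  have huK : ∀ x, -K₁ ≤ u x ∧ u x ≤ -K₀ := fun x =>
    ⟨(hu x).1 ⟨_, hmem, rfl⟩, (hu x).2 (by rintro _ ⟨w, hw, rfl⟩; exact (hw.1 x).2)⟩
  have hulip : LipschitzInCharts X u :=
    FinslerStructure.lipschitzInCharts_of_isLUB hX hcoer h𝓕 hu
  have husub : IsViscositySubsolution F H u :=
    FinslerStructure.isViscositySubsolution_of_isLUB hX hH hcoer h𝓕 hu
  have husup : IsViscositySupersolution F H u :=
    FinslerStructure.isViscositySupersolution_of_isLUB hX hH (fun x => (hK x).1)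
      hulip.continuous husub huK fun w hw hwK x => (hu x).1 ⟨w, ⟨hwK, hw⟩, rfl⟩
  refine ⟨u, ⟨⟨_, fun x => habs _ (huK x)⟩, husub, husup⟩, ?_, fun x => ?_,
    hulip.locallyLipschitz hX⟩
  · rintro v ⟨B, hB⟩ ⟨hvsub, hvsup⟩
    set B' := max B (|K₀| + |K₁|)
    have hvB : ∀ x, |v x| ≤ B' := fun x => (hB x).trans (le_max_left _ _)
    have huB : ∀ x, |u x| ≤ B' := fun x => (habs _ (huK x)).trans (le_max_right _ _)
    have hcB : ∀ _ : M, |-K₁| ≤ B' := fun _ =>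
      (habs _ ⟨le_rfl, neg_le_neg hK₀₁⟩).trans (le_max_right _ _)
    have hclip : LipschitzInCharts X (fun _ : M => -K₁) := fun e _ y₀ _ =>
      ⟨1, one_pos, 0, le_rfl, fun y _ z _ => by simp⟩
    -- The constant `-K₁` is a Lipschitz subsolution, so this comparison needs no regularity of `v`.
    -- The resulting lower bound is exactly what coercivity needs to make `v` Lipschitz, after which
    -- `v` can itself play the subsolution.
    have hvK : ∀ x, -K₁ ≤ v x :=
      FinslerStructure.le_of_isViscositySubsolution_of_isViscositySupersolution hX hF hmod hconst
        hvsup hcB hvB hclip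
    have hvlip : LipschitzInCharts X v := fun e he y₀ hy₀ => by
      obtain ⟨ρ, hρ, L, hL0, hL⟩ := FinslerStructure.exists_lipschitz_of_isViscositySubsolution
        (F := F) (B := B') hX hcoer he hy₀
      exact ⟨ρ, hρ, L, hL0, hL v hvsub hvB hvK⟩
    funext x
    exact le_antisymm
      (FinslerStructure.le_of_isViscositySubsolution_of_isViscositySupersolution hX hF hmod hvsub
        husup hvB huB hvlip x)
      (FinslerStructure.le_of_isViscositySubsolution_of_isViscositySupersolution hX hF hmod husub
        hvsup huB hvB hulip x)
  · convert hu x using 1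
    ext r
    constructor
    · rintro ⟨w, h1, h2, rfl⟩
      exact ⟨w, ⟨h1, h2⟩, rfl⟩
    · rintro ⟨w, ⟨h1, h2⟩, rfl⟩
      exact ⟨w, h1, h2, rfl⟩
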